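/- **Setting.** Let $X\subset\mathbb R^d$ be a finite set of $n=|X|$ points and let $1\le k<n$. A *clustering* $A$ of $X$ is a partition of $X$ into at most $k$ nonempty clusters; $m(S)$ is the mean of a cluster $S$, $m(A)=(m(S))_{S\in A}$, and $\phi(A)=\sum_{S\in A}\sum_{x\in S}\|x-m(S)\|^2$. For centroids $C=(c_1,\dots,c_k)$ let $\phi(C)=\sum_{x\in X}\min_r\|x-c_r\|^2$ and $\phi_{opt}=\min_C\phi(C)$. A clustering is *induced* by a family of centroids if it is obtained by assigning every $x\in X$ to a closest centroid (ties broken in any way, empty clusters dropped); a centroid is *non-degenerate* if it receives at least one point. $A^*$ is a *stationary clustering* if it is induced by $m(A^*)$, with each $x \in S$ assigned to $m(S)$; then $m(A^*)$ is a *stationary point*. $\{A^*\}_{[k]}$ is the set of stationary clusterings with at most $k$ clusters. **Assumption (A).** Every stationary point $C^*$ (with at most $k$ centroids) has a positive margin: for some $\delta'>0$ and some assignment of the points to closest centroids of $C^*$, for all $r\neq s$ and all $x$ assigned to $c^*_r$ or $c^*_s$, the orthogonal projection $\bar x$ of $x$ onto the line joining $c_r^*$ and $c_s^*$ satisfies $\big|\|\bar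 x-c_r^*\|-\|\bar x-c_s^*\|\big|\ge\delta'$ (the left side is $0$ if $c_r^*=c_s^*$). **The constant $r_{\min}$.** If $C=(c_1,\dots,c_k)$, with an induced clustering $A'$, has exactly $|A|$ non-degenerate centroids, put $\Delta(C,m(A))=\min_\pi\sum_{S\in A}|S|\,\|c_{\pi(S)}-m(S)\|^2$ over bijections $\pi$ from the clusters of $A$ to the non-degenerate centroids of $C$. A stationary point $m(A)$ is *$(b_0,\alpha)$-stable* ($0\le\alpha<1$) if for all such $C,A'$ and all $b'\le b_0$ with $\Delta(C,m(A))\le b'\phi(A)$ there is $0\le b\le\alpha b'$ such that $\max_{S\in A}|A'_{\pi(S)}\triangle S|/|S|\le \frac{b}{5b+4(1+\phi(C)/\phi(A))}$ for each $\pi$ attaining $\Delta$. Call $r>0$ *admissible* if (1) every stationary point is $(r,0)$-stable, and (2) whenever $A'$ is a clustering such that $m(A')$ is not a stationary point and $A'$ is induced by $C'=(c'_1,\dots,c'_k)$, then $\Delta(C',m(A'))\ge r\,\phi(m(A'))$, where $\phi(m(A'))$ denotes the cost $\phi(A')$ of $A'$ with centroids $m(A')$. **Algorithm (stochastic $k$-means).**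 Seeds $C^0=(c^0_1,\dots,c^0_k)$, mini-batch size $m$. At iteration $t\ge1$ draw $m$ points of $X$ independently and uniformly with replacement, assign each to a closest centroid of $C^{t-1}$ (by any fixed tie-breaking rule), and for every centroid that receives at least one sampled point set $c_r^t=(1-\eta^t)c_r^{t-1}+\eta^t\hat c_r^t$, where $\hat c_r^t$ is the average of the sampled points it receives; the other centroids do not move. Put $\phi^t=\phi(C^t)$, and let $\phi_{\max}$ be the supremum of $\phi^t$ over all $t\ge0$ and all possible sequences of mini-batches. **Theorem 1.** Suppose $X$ satisfies Assumption (A). Then an admissible $r>0$ exists. Let $r_{\min}$ be any admissible value and fix $0<\delta<\frac1e$. Run the algorithm with arbitrary seeds $C^0\subset \mathrm{conv}(X)$, any mini-batch size $m\ge1$, and learning rate $\eta^t=\frac{c'}{t+t_o}$, where $$c'>\max\Big\{\frac{\phi_{\max}}{(1-e^{-m/n})\,r_{\min}\,\phi_{opt}},\ \frac{1}{1-e^{-4m/(5n)}}\Big\},\qquad t_o\ge 768\,(c')^2\Big(1+\frac1{r_{\min}}\Big)^2n^2\ln^2\frac1\delta .$$ Then there are events $G(A^*)$, $A^*\in\{A^*\}_{[k]}$,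 such that on $G(A^*)$ the clustering of $X$ induced by $C^t$ (with the tie-breaking rule of the algorithm) equals $A^*$ for all sufficiently large $t$, $$\Pr\Big\{\bigcup_{A^*\in\{A^*\}_{[k]}}G(A^*)\Big\}\ge1-\delta,$$ and for every stationary clustering $A^*\in\{A^*\}_{[k]}$, with $\phi^*=\phi(A^*)$, $E\{\phi^t-\phi^*\mid G(A^*)\}=O(\frac1t)$; precisely, there is a constant $K$ with $\big|E\{\phi^t-\phi^*\mid G(A^*)\}\big|\le\frac{K}{t+t_o}$ for all $t\ge0$. (If $G(A^*)$ has probability zero, the last statement is void.) -/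

import Mathlib

open scoped symmDiff
open MeasureTheory ProbabilityTheory

noncomputable section

open Classical in
/-- The mean `m(S)` of a finite set of points (used for nonempty `S`). -/
def clusterMean {d : ℕ} (S : Finset (EuclideanSpace ℝ (Fin d))) : EuclideanSpace ℝ (Fin d) :=
  (S.card : ℝ)⁻¹ • ∑ x ∈ S, x

/-- The `k`-means cost `φ_X(C)` of a family of centroids: every data point pays the squared
distance to its closest centroid. -/
def centroidCost {d k : ℕ} (X : Finset (EuclideanSpace ℝ (Fin d)))
    (C : Fin k → EuclideanSpace ℝ (Fin d)) : ℝ :=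
  ∑ x ∈ X, ⨅ r : Fin k, ‖x - C r‖ ^ 2

open Classical in
/-- The `k`-means cost `φ_X(A)` of a clustering, that is, of a partition of `X` into nonempty
clusters: every cluster is centred at its mean. -/
def clusteringCost {d : ℕ} {X : Finset (EuclideanSpace ℝ (Fin d))} (A : Finpartition X) : ℝ :=
  ∑ S ∈ A.parts, ∑ x ∈ S, ‖x - clusterMean S‖ ^ 2

/-- The optimal `k`-means cost `φ_opt`. -/
def optCost {d : ℕ} (X : Finset (EuclideanSpace ℝ (Fin d))) (k : ℕ) : ℝ :=
  ⨅ C : Fin k → EuclideanSpace ℝ (Fin d), centroidCost X C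

/-- `a` assigns every data point to a closest centroid of the indexed family `C`. The clusterings
`V(C) ∩ X` induced by the Voronoi diagram of `C` are those given by such assignments. There is
more than one assignment exactly when some data point has several closest centroids. -/
def IsVoronoi {d : ℕ} {ι : Type*} (X : Finset (EuclideanSpace ℝ (Fin d)))
    (C : ι → EuclideanSpace ℝ (Fin d)) (a : EuclideanSpace ℝ (Fin d) → ι) : Prop :=
  ∀ x ∈ X, ∀ r, ‖x - C (a x)‖ ≤ ‖x - C r‖

open Classical in
/-- The set of data points with label `r`. -/
def cell {d : ℕ} {ι : Type*} (X : Finset (EuclideanSpace ℝ (Fin d)))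
    (a : EuclideanSpace ℝ (Fin d) → ι) (r : ι) : Finset (EuclideanSpace ℝ (Fin d)) :=
  X.filter (fun x => a x = r)

open Classical in
/-- The clustering (set of nonempty clusters) of `X` given by an assignment. -/
def clusters {d : ℕ} {ι : Type*} (X : Finset (EuclideanSpace ℝ (Fin d)))
    (a : EuclideanSpace ℝ (Fin d) → ι) : Finset (Finset (EuclideanSpace ℝ (Fin d))) :=
  X.image (fun x => cell X a (a x))

open Classical in
/-- The indices of the non-degenerate centroids: those to which some data point is assigned. -/
def nondegenerate {d : ℕ} {ι : Type*} (X : Finset (EuclideanSpace ℝ (Fin d)))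
    (a : EuclideanSpace ℝ (Fin d) → ι) : Finset ι :=
  X.image a

open Classical in
/-- The family of the means of the clusters of `A`, indexed by the clusters. -/
def means {d : ℕ} {X : Finset (EuclideanSpace ℝ (Fin d))} (A : Finpartition X) :
    A.parts → EuclideanSpace ℝ (Fin d) :=
  fun S => clusterMean S.1

open Classical in
/-- The set `{A*}_[k]` of stationary clusterings with at most `k` (nonempty) clusters: the
clustering `A` is itself one of the clusterings induced by the Voronoi diagram of its means. -/
def stationaryClusterings {d : ℕ} (X : Finset (EuclideanSpace ℝ (Fin d))) (k : ℕ) :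
    Set (Finpartition X) :=
  {A | A.parts.card ≤ k ∧
    ∀ S ∈ A.parts, ∀ x ∈ S, ∀ T ∈ A.parts, ‖x - clusterMean S‖ ≤ ‖x - clusterMean T‖}

/-- For the orthogonal projection `y` of `x` onto the line joining `p` and `q`, the difference
`|‖y - p‖ - ‖y - q‖|`; it is `0` if `p = q`. -/
def bisectorGap {d : ℕ} (p q x : EuclideanSpace ℝ (Fin d)) : ℝ :=
  |dist (EuclideanGeometry.orthogonalProjection (affineSpan ℝ {p, q}) x :
      EuclideanSpace ℝ (Fin d)) p -
    dist (EuclideanGeometry.orthogonalProjection (affineSpan ℝ {p, q}) x :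
      EuclideanSpace ℝ (Fin d)) q|

/-- The Voronoi diagram of `C` has margin at least `δ` with respect to `X` (no condition if there
is only one centroid). -/
def HasMargin {d : ℕ} {ι : Type*} (X : Finset (EuclideanSpace ℝ (Fin d)))
    (C : ι → EuclideanSpace ℝ (Fin d)) (δ : ℝ) : Prop :=
  ∃ a : EuclideanSpace ℝ (Fin d) → ι, IsVoronoi X C a ∧
    ∀ r s : ι, r ≠ s → ∀ x ∈ X, (a x = r ∨ a x = s) → δ ≤ bisectorGap (C r) (C s) x

/-- General dataset: every stationary point, that is, the family of the means of a stationary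
clustering with at most `k` clusters, has a positive margin. -/
def IsGeneral {d : ℕ} (X : Finset (EuclideanSpace ℝ (Fin d))) (k : ℕ) : Prop :=
  ∀ A ∈ stationaryClusterings X k, ∃ δ : ℝ, 0 < δ ∧ HasMargin X (means A) δ

open Classical in
/-- `∑_S |S| ‖c_{π(S)} - m(S)‖²` for a matching `π` of the clusters of `A` with the non-degenerate
centroids of `C`. -/
def matchingCost {d k : ℕ} {X : Finset (EuclideanSpace ℝ (Fin d))} (A : Finpartition X)
    (C : Fin k → EuclideanSpace ℝ (Fin d)) {N : Finset (Fin k)} (π : A.parts ≃ N) : ℝ :=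
  ∑ S : A.parts, (S.1.card : ℝ) * ‖C (π S).1 - clusterMean S.1‖ ^ 2

open Classical in
/-- The centroidal distance `Δ(C, m(A))`, where `C` comes with the assignment `a`: the least
matching cost. Used only if `C` has exactly as many non-degenerate centroids as `A` has
clusters. -/
def centroidalDist {d k : ℕ} {X : Finset (EuclideanSpace ℝ (Fin d))} (A : Finpartition X)
    (C : Fin k → EuclideanSpace ℝ (Fin d)) (a : EuclideanSpace ℝ (Fin d) → Fin k) : ℝ :=
  ⨅ π : A.parts ≃ nondegenerate X a, matchingCost A C π

open Classical in
/-- `(b₀, α)`-stability of the stationary point `m(A)`. For every set `C` of `k` centroids for which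
`Δ(C, m(A))` is defined and at most `b' φ(A)` with `b' ≤ b₀`, the clustering distance
`max_S |A'_{π(S)} ∆ S| / |S|` between the clustering `A'` of `C` and `A` (for a matching `π` that
attains `Δ`) is at most `b / (5 b + 4 (1 + φ(C) / φ(A)))` for some `0 ≤ b ≤ α b'`. -/
def IsStable {d : ℕ} {X : Finset (EuclideanSpace ℝ (Fin d))} (k : ℕ) (A : Finpartition X)
    (b₀ α : ℝ) : Prop :=
  0 ≤ α ∧ α < 1 ∧
  ∀ (C : Fin k → EuclideanSpace ℝ (Fin d)) (a : EuclideanSpace ℝ (Fin d) → Fin k),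
    IsVoronoi X C a → (nondegenerate X a).card = A.parts.card →
    ∀ b' ≤ b₀, centroidalDist A C a ≤ b' * clusteringCost A →
    ∃ b : ℝ, 0 ≤ b ∧ b ≤ α * b' ∧
      ∀ π : A.parts ≃ nondegenerate X a, matchingCost A C π = centroidalDist A C a →
        ∀ S : A.parts, ((cell X a (π S).1 ∆ S.1).card : ℝ) / (S.1.card : ℝ) ≤
          b / (5 * b + 4 * (1 + centroidCost X C / clusteringCost A))

open Classical in
/-- `r` is an admissible value of `r_min`: it is positive, all stationary points are
`(r, 0)`-stable, and if `m(A')` is not a stationary point and `A'` is a clustering induced by `C'`,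
then `Δ(C', m(A')) ≥ r φ(m(A'))`. -/
def IsRMin {d : ℕ} (X : Finset (EuclideanSpace ℝ (Fin d))) (k : ℕ) (r : ℝ) : Prop :=
  0 < r ∧
  (∀ A ∈ stationaryClusterings X k, IsStable k A r 0) ∧
  (∀ A : Finpartition X, A.parts.card ≤ k →
    (¬ ∃ B ∈ stationaryClusterings X k,
      A.parts.val.map clusterMean = B.parts.val.map clusterMean) →
    ∀ (C : Fin k → EuclideanSpace ℝ (Fin d)) (a : EuclideanSpace ℝ (Fin d) → Fin k),
      IsVoronoi X C a → clusters X a = A.parts →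
      r * clusteringCost A ≤ centroidalDist A C a)

open Classical in
/-- One iteration of stochastic `k`-means with assignment `a`, learning rate `η` and mini-batch
`s 0, …, s (m - 1)`: a centroid to which part of the mini-batch is assigned moves towards the mean
of that part (counted with multiplicity), the other centroids do not move. -/
def kmeansStep {d k m : ℕ} (a : EuclideanSpace ℝ (Fin d) → Fin k) (η : ℝ)
    (s : Fin m → EuclideanSpace ℝ (Fin d)) (C : Fin k → EuclideanSpace ℝ (Fin d)) :
    Fin k → EuclideanSpace ℝ (Fin d) :=
  fun r =>
    if (Finset.univ.filter (fun j => a (s j) = r)).card = 0 then C r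
    else (1 - η) • C r + η •
      (((Finset.univ.filter (fun j => a (s j) = r)).card : ℝ)⁻¹ •
        ∑ j ∈ Finset.univ.filter (fun j => a (s j) = r), s j)

/-- The centroids `C^t` of stochastic `k`-means with seeds `C₀`, learning rate `η t` at iteration
`t ≥ 1`, tie-breaking rule `tie` and mini-batch `s t` at iteration `t + 1`. -/
def kmeansIter {d k m : ℕ}
    (tie : (Fin k → EuclideanSpace ℝ (Fin d)) → EuclideanSpace ℝ (Fin d) → Fin k)
    (η : ℕ → ℝ) (C₀ : Fin k → EuclideanSpace ℝ (Fin d))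
    (s : ℕ → Fin m → EuclideanSpace ℝ (Fin d)) : ℕ → Fin k → EuclideanSpace ℝ (Fin d)
  | 0 => C₀
  | t + 1 => kmeansStep (tie (kmeansIter tie η C₀ s t)) (η (t + 1)) (s t)
      (kmeansIter tie η C₀ s t)

/-- `φ_max`: the supremum of the cost `φ^t` over all times and over all possible sequences of
mini-batches of size `m`. -/
def maxCost {d k : ℕ} (X : Finset (EuclideanSpace ℝ (Fin d))) (m : ℕ)
    (tie : (Fin k → EuclideanSpace ℝ (Fin d)) → EuclideanSpace ℝ (Fin d) → Fin k)
    (η : ℕ → ℝ) (C₀ : Fin k → EuclideanSpace ℝ (Fin d)) : ℝ :=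
  sSup {y | ∃ (s : ℕ → Fin m → EuclideanSpace ℝ (Fin d)) (t : ℕ),
    (∀ i j, s i j ∈ X) ∧ y = centroidCost X (kmeansIter tie η C₀ s t)}

end

/-!
The clustering cost `φ C`, the minimum over all labellings `a` of the data points of
`labelCost a C = ∑ i, ‖P i - C (a i)‖ ^ 2`, is a Lyapunov function of mini-batch `k`-means. Since
`labelCost a C = labelVal a + labelDev a C`, where `labelDev` measures the deviation of the
centroids from the means of their cells, a step with learning rate `η` and labelling `a` satisfies
`E φ ≤ φ - 2 p η labelDev + O(η ^ 2)` (`avg_labelCost_batchStep_le`). Hence `∑ η * labelDev < ∞`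
almost surely, while `∑ η = ∞`. If the deviation of an induced labelling is small, then the
labelling is self-consistent, that is, its clustering is stationary
(`exists_dev_isSelfConsistent`), and by the margin assumption it has no ties.

The main point is that the clustering almost surely settles. The obstacle are degenerate centroids,
which may sit anywhere and take over points close to a tie. There are two kinds of such changes.

* From a group of self-consistent labellings with a common value to a labelling outside of it. There
  the deviation is bounded below, so the excess `H` of the best cost within the group over `φ` has
  an upward drift of order `η`, against increments of order `η`. Therefore `exp (- l * H / η)` is a
  supermartingale with a definite decrease at each escape, and there are only finitely many escapes
  (`exists_escape_drift`, `exists_ae_finite_escapes`). Together with the summability above, the path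
  ends up in one group, with deviation tending to zero (`eventually_selfConsistent`).
* Between labellings of the same group. Now all centroids converge, only the centroids in use move,
  and two labellings that use the same centroid at the limit give it the same cell. The total
  weighted deviation of the centroids not in use cannot decrease at a change of labelling, since the
  new labelling is the cheaper one, and it tends to zero; so it vanishes
  (`eventually_frozenDev_eq_zero`). Consequently a change of the clustering is only possible while
  the centroids concerned sit exactly at their means, and a mini-batch concentrated at a single point
  of a cell, which has probability bounded below, would destroy this. So almost surely there are only
  finitely many changes (`ae_eventually_stable`).

The event `G A` is that the clustering equals `A` from a fixed time `T` on. For `T` large, these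
events exhaust `Ω` up to probability `δ`. On `G A` the excess cost is `labelDev`, which contracts by
`1 - 2 p c / (t + t₀)` up to `O(1 / (t + t₀) ^ 2)` in each step; the condition on `c` gives
`2 p c > 1`, and the rate `O(1 / t)` follows (`exists_setIntegral_le`).
-/

set_option linter.unusedSectionVars false

/-! ### Labellings, their cells and their costs -/

section Labels

variable {ι κ V : Type*} [Fintype ι] [DecidableEq κ]
  [NormedAddCommGroup V] [InnerProductSpace ℝ V]

/-- The mean of the points with label `r`. -/
noncomputable def labelMean (P : ι → V) (a : ι → κ) (r : κ) : V :=
  ((Finset.univ.filter (fun i => a i = r)).card : ℝ)⁻¹ •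
    ∑ i ∈ Finset.univ.filter (fun i => a i = r), P i

/-- The cost of the labelling `a` with centroids `C`. -/
noncomputable def labelCost (P : ι → V) (a : ι → κ) (C : κ → V) : ℝ :=
  ∑ i, ‖P i - C (a i)‖ ^ 2

/-- The weighted squared deviation of the centroids in use from the means of their cells. The sum
runs over the points, so every cell is counted with its size. -/
noncomputable def labelDev (P : ι → V) (a : ι → κ) (C : κ → V) : ℝ :=
  ∑ i, ‖C (a i) - labelMean P a (a i)‖ ^ 2

/-- The cost of the labelling `a` with every cell centred at its mean. -/
noncomputable def labelVal (P : ι → V) (a : ι → κ) : ℝ :=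
  ∑ i, ‖P i - labelMean P a (a i)‖ ^ 2

/-- Every point carries the label of a closest centroid. -/
def IsClosest (P : ι → V) (a : ι → κ) (C : κ → V) : Prop :=
  ∀ i r, ‖P i - C (a i)‖ ≤ ‖P i - C r‖

/-- Every point is at least as close to the mean of its own cell as to those of the other cells. -/
def IsSelfConsistent (P : ι → V) (a : ι → κ) : Prop :=
  ∀ i j, ‖P i - labelMean P a (a i)‖ ≤ ‖P i - labelMean P a (a j)‖

/-- Every point is strictly closer to the mean of its own cell than to those of the other cells. -/
def IsStrict (P : ι → V) (a : ι → κ) : Prop :=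
  ∀ i j, a j ≠ a i → ‖P i - labelMean P a (a i)‖ < ‖P i - labelMean P a (a j)‖

variable {P : ι → V} {a b : ι → κ} {C C' : κ → V}

lemma labelCost_nonneg : 0 ≤ labelCost P a C := Finset.sum_nonneg fun _ _ => by positivity

lemma labelDev_nonneg : 0 ≤ labelDev P a C := Finset.sum_nonneg fun _ _ => by positivity

lemma cell_card_pos (i : ι) : 0 < (Finset.univ.filter (fun j => a j = a i)).card :=
  Finset.card_pos.2 ⟨i, by simp⟩

lemma sum_cell_eq_card_smul_mean (r : κ) :
    ∑ i ∈ Finset.univ.filter (fun i => a i = r), P i =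
      ((Finset.univ.filter (fun i => a i = r)).card : ℝ) • labelMean P a r := by
  unfold labelMean
  rcases Finset.eq_empty_or_nonempty (Finset.univ.filter (fun i => a i = r)) with h | h
  · rw [h]; simp
  · rw [smul_smul, mul_inv_cancel₀ (by simpa using h.ne_empty), one_smul]

lemma sum_cell_sub_mean (r : κ) :
    ∑ i ∈ Finset.univ.filter (fun i => a i = r), (P i - labelMean P a r) = 0 := by
  rw [Finset.sum_sub_distrib, sum_cell_eq_card_smul_mean, Finset.sum_const, sub_eq_zero,
    Nat.cast_smul_eq_nsmul]

/-- On a single cell, moving the centre from the mean to `z` costs `‖z - m‖ ^ 2` per point. -/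
lemma sum_cell_sq (r : κ) (z : V) :
    ∑ i ∈ Finset.univ.filter (fun i => a i = r), ‖P i - z‖ ^ 2 =
      ∑ i ∈ Finset.univ.filter (fun i => a i = r), ‖P i - labelMean P a r‖ ^ 2 +
      ∑ _i ∈ Finset.univ.filter (fun i => a i = r), ‖z - labelMean P a r‖ ^ 2 := by
  have key : ∀ i, ‖P i - z‖ ^ 2 = ‖P i - labelMean P a r‖ ^ 2 + ‖z - labelMean P a r‖ ^ 2
      - 2 * inner ℝ (P i - labelMean P a r) (z - labelMean P a r) := by
    intro i
    have : P i - z = (P i - labelMean P a r) - (z - labelMean P a r) := by abel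
    rw [this, norm_sub_sq_real]; ring
  simp_rw [key]
  rw [Finset.sum_sub_distrib, Finset.sum_add_distrib, ← Finset.mul_sum, ← sum_inner,
    sum_cell_sub_mean, inner_zero_left]
  ring

lemma sum_eq_sum_cells [Fintype κ] (f : ι → ℝ) (a : ι → κ) :
    ∑ i, f i = ∑ r, ∑ i ∈ Finset.univ.filter (fun i => a i = r), f i :=
  (Finset.sum_fiberwise Finset.univ a f).symm

lemma sum_label_eq [Fintype κ] (f : κ → ι → ℝ) (a : ι → κ) :
    ∑ i, f (a i) i = ∑ r, ∑ i ∈ Finset.univ.filter (fun i => a i = r), f r i := by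
  rw [sum_eq_sum_cells _ a]
  refine Finset.sum_congr rfl fun r _ => Finset.sum_congr rfl fun i hi => ?_
  rw [(Finset.mem_filter.1 hi).2]

lemma labelCost_eq [Fintype κ] : labelCost P a C = labelVal P a + labelDev P a C := by
  unfold labelCost labelVal labelDev
  rw [sum_label_eq (fun r i => ‖P i - C r‖ ^ 2) a,
    sum_label_eq (fun r i => ‖P i - labelMean P a r‖ ^ 2) a,
    sum_label_eq (fun r _ => ‖C r - labelMean P a r‖ ^ 2) a, ← Finset.sum_add_distrib]
  exact Finset.sum_congr rfl fun r _ => sum_cell_sq r (C r)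

lemma labelVal_le_labelCost [Fintype κ] : labelVal P a ≤ labelCost P a C := by
  rw [labelCost_eq]; linarith [labelDev_nonneg (P := P) (a := a) (C := C)]

lemma IsClosest.labelCost_le (h : IsClosest P a C) (b : ι → κ) :
    labelCost P a C ≤ labelCost P b C :=
  Finset.sum_le_sum fun i _ => by
    have := h i (b i)
    gcongr

lemma norm_sq_le_labelDev (i : ι) : ‖C (a i) - labelMean P a (a i)‖ ^ 2 ≤ labelDev P a C :=
  Finset.single_le_sum (f := fun i => ‖C (a i) - labelMean P a (a i)‖ ^ 2)
    (fun _ _ => by positivity) (Finset.mem_univ i)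

lemma norm_sub_mean_lt {ε : ℝ} (hε : 0 < ε) (h : labelDev P a C < ε ^ 2) (i : ι) :
    ‖C (a i) - labelMean P a (a i)‖ < ε :=
  lt_of_pow_lt_pow_left₀ 2 hε.le ((norm_sq_le_labelDev i).trans_lt h)

lemma norm_labelMean_le {M : ℝ} (hM : ∀ i, ‖P i‖ ≤ M) (hM0 : 0 ≤ M) (r : κ) :
    ‖labelMean P a r‖ ≤ M := by
  unfold labelMean
  set s := Finset.univ.filter (fun i => a i = r)
  rcases Finset.eq_empty_or_nonempty s with h | h
  · rw [h]; simpa using hM0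
  · have hc : (0 : ℝ) < s.card := by exact_mod_cast h.card_pos
    rw [norm_smul, norm_inv, Real.norm_natCast, inv_mul_le_iff₀ hc]
    calc ‖∑ i ∈ s, P i‖ ≤ ∑ i ∈ s, ‖P i‖ := norm_sum_le _ _
      _ ≤ ∑ _i ∈ s, M := Finset.sum_le_sum fun i _ => hM i
      _ = s.card * M := by rw [Finset.sum_const, nsmul_eq_mul]

/-- A finite family of positive numbers has a positive lower bound. -/
lemma exists_pos_le_of_finite {α : Type*} [Finite α] (p : α → Prop) (f : α → ℝ)
    (h : ∀ x, p x → 0 < f x) : ∃ g > 0, ∀ x, p x → g ≤ f x := by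
  classical
  cases nonempty_fintype α
  rcases (Finset.univ.filter p).eq_empty_or_nonempty with he | hne
  · refine ⟨1, one_pos, fun x hx => ?_⟩
    have : x ∈ Finset.univ.filter p := by simp [hx]
    simp [he] at this
  · refine ⟨(Finset.univ.filter p).inf' hne f, ?_, fun x hx => Finset.inf'_le _ (by simp [hx])⟩
    rw [gt_iff_lt, Finset.lt_inf'_iff]
    intro x hx
    exact h x (by simpa using hx)

/-- If the centroids are close enough to the means of the cells that they induce, then the
labelling is self-consistent. -/
lemma exists_dev_isSelfConsistent (P : ι → V) (κ : Type*) [Fintype κ] [DecidableEq κ] :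
    ∃ ρ > 0, ∀ (a : ι → κ) (C : κ → V), IsClosest P a C → labelDev P a C < ρ →
      IsSelfConsistent P a := by
  obtain ⟨g, hg, h⟩ := exists_pos_le_of_finite (α := (ι → κ) × ι × ι)
    (fun x => 0 < ‖P x.2.1 - labelMean P x.1 (x.1 x.2.1)‖
      - ‖P x.2.1 - labelMean P x.1 (x.1 x.2.2)‖)
    (fun x => ‖P x.2.1 - labelMean P x.1 (x.1 x.2.1)‖
      - ‖P x.2.1 - labelMean P x.1 (x.1 x.2.2)‖) (fun _ hx => hx)
  refine ⟨(g / 2) ^ 2, by positivity, fun a C hC hD i j => ?_⟩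
  by_contra hlt
  push Not at hlt
  have h1 := h (a, i, j) (sub_pos.2 hlt)
  have h2 := norm_sub_mean_lt (by positivity) hD i
  have h3 := norm_sub_mean_lt (by positivity) hD j
  have h4 := hC i (a j)
  have h5 : ‖P i - labelMean P a (a i)‖ ≤ ‖P i - C (a i)‖ + ‖C (a i) - labelMean P a (a i)‖ :=
    norm_sub_le_norm_sub_add_norm_sub _ _ _
  have h6 : ‖P i - C (a j)‖ ≤ ‖P i - labelMean P a (a j)‖ + ‖labelMean P a (a j) - C (a j)‖ :=
    norm_sub_le_norm_sub_add_norm_sub _ _ _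
  rw [norm_sub_rev (labelMean P a (a j))] at h6
  simp only at h1
  linarith

lemma abs_norm_sq_sub_le {u v : V} {R e : ℝ} (hu : ‖u‖ ≤ R) (hv : ‖v‖ ≤ R)
    (h : ‖u - v‖ ≤ e) : |‖u‖ ^ 2 - ‖v‖ ^ 2| ≤ 2 * R * e := by
  have h1 : |‖u‖ - ‖v‖| ≤ e := (abs_norm_sub_norm_le u v).trans h
  have h2 : ‖u‖ ^ 2 - ‖v‖ ^ 2 = (‖u‖ + ‖v‖) * (‖u‖ - ‖v‖) := by ring
  rw [h2, abs_mul, abs_of_nonneg (by positivity)]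
  have := abs_nonneg (‖u‖ - ‖v‖)
  have := norm_nonneg u
  have := norm_nonneg v
  have hR : 0 ≤ R := (norm_nonneg u).trans hu
  calc (‖u‖ + ‖v‖) * |‖u‖ - ‖v‖| ≤ (R + R) * e := by gcongr
    _ = _ := by ring

lemma abs_labelDev_sub_le {M e : ℝ} (hM0 : 0 ≤ M) (hM : ∀ i, ‖P i‖ ≤ M) (hC : ∀ r, ‖C r‖ ≤ M)
    (hC' : ∀ r, ‖C' r‖ ≤ M) (h : ∀ r, ‖C' r - C r‖ ≤ e) :
    |labelDev P a C' - labelDev P a C| ≤ 4 * M * Fintype.card ι * e := by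
  unfold labelDev
  rw [← Finset.sum_sub_distrib]
  refine (Finset.abs_sum_le_sum_abs _ _).trans ?_
  calc _ ≤ ∑ _i : ι, 2 * (2 * M) * e := by
        refine Finset.sum_le_sum fun i _ => abs_norm_sq_sub_le ?_ ?_ ?_
        · linarith [norm_sub_le (C' (a i)) (labelMean P a (a i)), hC' (a i),
            norm_labelMean_le (a := a) hM hM0 (a i)]
        · linarith [norm_sub_le (C (a i)) (labelMean P a (a i)), hC (a i),
            norm_labelMean_le (a := a) hM hM0 (a i)]
        · simpa using h (a i)
    _ = _ := by rw [Finset.sum_const, nsmul_eq_mul, Finset.card_univ]; ring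

lemma abs_labelCost_sub_le [Fintype κ] {M e : ℝ} (hM0 : 0 ≤ M) (hM : ∀ i, ‖P i‖ ≤ M) (hC : ∀ r, ‖C r‖ ≤ M)
    (hC' : ∀ r, ‖C' r‖ ≤ M) (h : ∀ r, ‖C' r - C r‖ ≤ e) :
    |labelCost P a C' - labelCost P a C| ≤ 4 * M * Fintype.card ι * e := by
  rw [labelCost_eq, labelCost_eq, add_sub_add_left_eq_sub]
  exact abs_labelDev_sub_le hM0 hM hC hC' h

/-- The deviation decreases by a small factor up to a second-order term, when the centroids move
by at most `e`. -/
lemma le_labelDev_of_move {e θ : ℝ} (hθ : 0 < θ) (h : ∀ r, ‖C' r - C r‖ ≤ e) :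
    (1 - θ) * labelDev P a C - Fintype.card ι * e ^ 2 / θ ≤ labelDev P a C' := by
  unfold labelDev
  have key : ∀ i ∈ Finset.univ, (1 - θ) * ‖C (a i) - labelMean P a (a i)‖ ^ 2 - e ^ 2 / θ ≤
      ‖C' (a i) - labelMean P a (a i)‖ ^ 2 := by
    intro i _
    set u := ‖C (a i) - labelMean P a (a i)‖
    set u' := ‖C' (a i) - labelMean P a (a i)‖
    have he := h (a i)
    have h1 : |u' - u| ≤ e := (abs_norm_sub_norm_le _ _).trans (by simpa using he)
    have h2 := abs_le.1 h1
    have he0 : 0 ≤ e := (norm_nonneg _).trans he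
    have hu : 0 ≤ u := norm_nonneg _
    have hu' : 0 ≤ u' := norm_nonneg _
    have h3 : 2 * u * e ≤ θ * u ^ 2 + e ^ 2 / θ := by
      have : 0 ≤ (θ * u - e) ^ 2 / θ := by positivity
      have h5 : (θ * u - e) ^ 2 / θ = θ * u ^ 2 - 2 * u * e + e ^ 2 / θ := by
        field_simp
        ring
      linarith
    have h4 : u ^ 2 - 2 * u * e ≤ u' ^ 2 := by
      rcases le_total u e with hle | hle
      · nlinarith [sq_nonneg u']
      · nlinarith
    linarith
  have := Finset.sum_le_sum key
  rw [Finset.sum_sub_distrib, ← Finset.mul_sum, Finset.sum_const, nsmul_eq_mul,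
    Finset.card_univ] at this
  calc _ = _ := by rw [mul_div_assoc]
    _ ≤ _ := this

end Labels

/-! ### Mini-batch steps and their drift -/

section Step

variable {ι κ V : Type*} [Fintype ι] [DecidableEq κ]
  [NormedAddCommGroup V] [InnerProductSpace ℝ V] {m : ℕ}

/-- The displacement of centroid `r`, before scaling by the learning rate: the vector from `C r` to
the mean of the points of the mini-batch `s` with label `r`, and `0` if there are none. -/
noncomputable def batchMove (P : ι → V) (a : ι → κ) (s : Fin m → ι) (C : κ → V) (r : κ) : V :=
  if (Finset.univ.filter (fun j => a (s j) = r)).card = 0 then 0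
  else ((Finset.univ.filter (fun j => a (s j) = r)).card : ℝ)⁻¹ •
      (∑ j ∈ Finset.univ.filter (fun j => a (s j) = r), P (s j)) - C r

/-- One mini-batch step with labelling `a`, learning rate `η` and mini-batch `s`. -/
noncomputable def batchStep (P : ι → V) (a : ι → κ) (η : ℝ) (s : Fin m → ι) (C : κ → V) : κ → V :=
  fun r => C r + η • batchMove P a s C r

variable {P : ι → V} {a : ι → κ} {C : κ → V} {s : Fin m → ι} {η M : ℝ}

lemma batchMove_eq_zero {r : κ} (h : ∀ j, a (s j) ≠ r) : batchMove P a s C r = 0 := by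
  rw [batchMove, if_pos]
  rw [Finset.card_eq_zero, Finset.filter_eq_empty_iff]
  exact fun j _ => h j

lemma batchStep_of_unused {r : κ} (h : ∀ i, a i ≠ r) : batchStep P a η s C r = C r := by
  rw [batchStep, batchMove_eq_zero fun j => h (s j), smul_zero, add_zero]

lemma batchStep_const (hm : 1 ≤ m) (z : ι) :
    batchStep P a η (fun _ : Fin m => z) C (a z) = (1 - η) • C (a z) + η • P z := by
  have : (m : ℝ) ≠ 0 := by positivity
  simp only [batchStep, batchMove, Finset.filter_true, Finset.card_univ, Fintype.card_fin,
    Finset.sum_const]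
  rw [if_neg (by omega), ← Nat.cast_smul_eq_nsmul ℝ, smul_smul, inv_mul_cancel₀ this, one_smul,
    smul_sub, sub_smul, one_smul]
  abel

lemma norm_batchMean_le (hM : ∀ i, ‖P i‖ ≤ M) (hM0 : 0 ≤ M) (t : Finset (Fin m)) :
    ‖(t.card : ℝ)⁻¹ • ∑ j ∈ t, P (s j)‖ ≤ M := by
  rcases Finset.eq_empty_or_nonempty t with h | h
  · rw [h]; simpa using hM0
  · have hc : (0 : ℝ) < t.card := by exact_mod_cast h.card_pos
    rw [norm_smul, norm_inv, Real.norm_natCast, inv_mul_le_iff₀ hc]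
    calc ‖∑ i ∈ t, P (s i)‖ ≤ ∑ i ∈ t, ‖P (s i)‖ := norm_sum_le _ _
      _ ≤ ∑ _i ∈ t, M := Finset.sum_le_sum fun i _ => hM _
      _ = t.card * M := by rw [Finset.sum_const, nsmul_eq_mul]

lemma norm_batchMove_le (hM : ∀ i, ‖P i‖ ≤ M) (hM0 : 0 ≤ M) (hC : ∀ r, ‖C r‖ ≤ M) (r : κ) :
    ‖batchMove P a s C r‖ ≤ 2 * M := by
  unfold batchMove
  split_ifs
  · simpa using hM0
  · linarith [norm_sub_le (((Finset.univ.filter (fun j => a (s j) = r)).card : ℝ)⁻¹ •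
      (∑ j ∈ Finset.univ.filter (fun j => a (s j) = r), P (s j))) (C r),
      norm_batchMean_le (s := s) hM hM0 (Finset.univ.filter (fun j => a (s j) = r)), hC r]

lemma norm_batchStep_sub_le (hM : ∀ i, ‖P i‖ ≤ M) (hM0 : 0 ≤ M) (hC : ∀ r, ‖C r‖ ≤ M)
    (hη : 0 ≤ η) (r : κ) : ‖batchStep P a η s C r - C r‖ ≤ 2 * M * η := by
  rw [batchStep, add_sub_cancel_left, norm_smul, Real.norm_of_nonneg hη, mul_comm]
  have := norm_batchMove_le (a := a) (s := s) hM hM0 hC r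
  gcongr

lemma norm_batchStep_le (hM : ∀ i, ‖P i‖ ≤ M) (hM0 : 0 ≤ M) (hC : ∀ r, ‖C r‖ ≤ M)
    (hη : 0 ≤ η) (hη1 : η ≤ 1) (r : κ) : ‖batchStep P a η s C r‖ ≤ M := by
  unfold batchStep batchMove
  split_ifs
  · simpa using hC r
  · have h1 := norm_batchMean_le (s := s) hM hM0 (Finset.univ.filter (fun j => a (s j) = r))
    set v := ((Finset.univ.filter (fun j => a (s j) = r)).card : ℝ)⁻¹ •
      (∑ j ∈ Finset.univ.filter (fun j => a (s j) = r), P (s j))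
    have h2 : C r + η • (v - C r) = (1 - η) • C r + η • v := by
      rw [smul_sub, sub_smul, one_smul]; abel
    rw [h2]
    calc _ ≤ ‖(1 - η) • C r‖ + ‖η • v‖ := norm_add_le _ _
      _ = (1 - η) * ‖C r‖ + η * ‖v‖ := by
        rw [norm_smul, norm_smul, Real.norm_of_nonneg hη, Real.norm_of_nonneg (by linarith)]
      _ ≤ (1 - η) * M + η * M := by
        have := hC r
        have : 0 ≤ 1 - η := by linarith
        gcongr
      _ = M := by ring

/-- Exchanging two points with the same label permutes the mini-batches, hence the batch mean of a
cell is an unbiased estimate of the mean of the cell, on the mini-batches that meet the cell. -/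
lemma sum_batchMove (P : ι → V) (a : ι → κ) (C : κ → V) (r : κ) :
    ∑ s : Fin m → ι, batchMove P a s C r =
      ((Finset.univ.filter (fun s : Fin m → ι => ∃ j, a (s j) = r)).card : ℝ) •
        (labelMean P a r - C r) := by
  classical
  set N : (Fin m → ι) → ℕ := fun s => (Finset.univ.filter (fun j => a (s j) = r)).card with hN
  have hN0 : ∀ s, N s = 0 ↔ ¬ ∃ j, a (s j) = r := by
    intro s
    simp [hN, Finset.filter_eq_empty_iff]
  set w : Fin m → ι → ℝ := fun j i => ∑ s : Fin m → ι with s j = i, (N s : ℝ)⁻¹ with hw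
  have hsymm : ∀ j i i', a i = r → a i' = r → w j i = w j i' := by
    intro j i i' hi hi'
    have hswap : ∀ x, a (Equiv.swap i i' x) = a x := by
      intro x
      by_cases h1 : x = i
      · rw [h1, Equiv.swap_apply_left, hi, hi']
      · by_cases h2 : x = i'
        · rw [h2, Equiv.swap_apply_right, hi, hi']
        · rw [Equiv.swap_apply_of_ne_of_ne h1 h2]
    refine Finset.sum_bij' (fun s _ => fun j => Equiv.swap i i' (s j))
      (fun s _ => fun j => Equiv.swap i i' (s j)) ?_ ?_ ?_ ?_ ?_
    · intro s hs
      simp only [Finset.mem_filter, Finset.mem_univ, true_and] at hs ⊢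
      rw [hs, Equiv.swap_apply_left]
    · intro s hs
      simp only [Finset.mem_filter, Finset.mem_univ, true_and] at hs ⊢
      rw [hs, Equiv.swap_apply_right]
    · intro s _; funext j; simp
    · intro s _; funext j; simp
    · intro s _; simp only [hN, hswap]
  have key : ∀ s : Fin m → ι, batchMove P a s C r =
      ∑ j, (if a (s j) = r then (N s : ℝ)⁻¹ • (P (s j) - labelMean P a r) else 0) +
      (if ∃ j, a (s j) = r then labelMean P a r - C r else 0) := by
    intro s
    rw [← Finset.sum_filter, ← Finset.smul_sum, Finset.sum_sub_distrib, Finset.sum_const]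
    unfold batchMove
    by_cases h : N s = 0
    · rw [if_pos h, if_neg ((hN0 s).1 h), h]; simp
    · rw [if_neg h, if_pos (not_not.1 ((not_congr (hN0 s)).1 h)), smul_sub,
        ← Nat.cast_smul_eq_nsmul ℝ, smul_smul, inv_mul_cancel₀ (by exact_mod_cast h), one_smul]
      abel
  rw [Finset.sum_congr rfl fun s _ => key s, Finset.sum_add_distrib, ← Finset.sum_filter,
    Finset.sum_const, Nat.cast_smul_eq_nsmul, Finset.sum_comm, add_eq_right]
  refine Finset.sum_eq_zero fun j _ => ?_
  have h1 : ∑ s : Fin m → ι, (if a (s j) = r then (N s : ℝ)⁻¹ • (P (s j) - labelMean P a r)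
      else 0) = ∑ i with a i = r, w j i • (P i - labelMean P a r) := by
    rw [← Finset.sum_fiberwise Finset.univ (fun s : Fin m → ι => s j), Finset.sum_filter]
    refine Finset.sum_congr rfl fun i _ => ?_
    split_ifs with hi
    · rw [hw, Finset.sum_smul]
      refine Finset.sum_congr rfl fun s hs => ?_
      rw [(Finset.mem_filter.1 hs).2, if_pos hi]
    · refine Finset.sum_eq_zero fun s hs => ?_
      rw [(Finset.mem_filter.1 hs).2, if_neg hi]
  rw [h1]
  rcases (Finset.univ.filter (fun i => a i = r)).eq_empty_or_nonempty with he | ⟨i₀, hi₀⟩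
  · rw [he, Finset.sum_empty]
  · rw [Finset.sum_congr rfl fun i hi => by
      rw [hsymm j i i₀ (Finset.mem_filter.1 hi).2 (Finset.mem_filter.1 hi₀).2],
      ← Finset.smul_sum, sum_cell_sub_mean, smul_zero]

/-- A lower bound for the probability that a mini-batch of size `m` from `n` points meets a given
nonempty set. -/
noncomputable def hitProb (n m : ℕ) : ℝ := 1 - (((n : ℝ) - 1) / n) ^ m

lemma hitProb_le_card (i : ι) :
    hitProb (Fintype.card ι) m * (Fintype.card (Fin m → ι) : ℝ) ≤
      ((Finset.univ.filter (fun s : Fin m → ι => ∃ j, a (s j) = a i)).card : ℝ) := by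
  classical
  have hn : 0 < Fintype.card ι := Fintype.card_pos_iff.2 ⟨i⟩
  have h1 := Finset.card_filter_add_card_filter_not (s := (Finset.univ : Finset (Fin m → ι)))
    (fun s : Fin m → ι => ∃ j, a (s j) = a i)
  have h2 : (Finset.univ.filter (fun s : Fin m → ι => ¬ ∃ j, a (s j) = a i)).card ≤
      (Fintype.card ι - 1) ^ m := by
    calc _ ≤ (Fintype.piFinset (fun _ : Fin m => (Finset.univ.erase i))).card := by
          refine Finset.card_le_card fun s hs => ?_
          simp only [Finset.mem_filter, Finset.mem_univ, true_and, not_exists] at hs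
          simp only [Fintype.mem_piFinset, Finset.mem_erase, Finset.mem_univ, and_true]
          intro j hj
          exact hs j (by rw [hj])
      _ = _ := by simp
  have h3 : (((Finset.univ.filter (fun s : Fin m → ι => ¬ ∃ j, a (s j) = a i)).card : ℕ) : ℝ) ≤
      ((Fintype.card ι : ℝ) - 1) ^ m := by
    have : ((Fintype.card ι - 1 : ℕ) : ℝ) = (Fintype.card ι : ℝ) - 1 := by
      rw [Nat.cast_sub hn]; simp
    rw [← this]
    exact_mod_cast h2
  have h4 : ((Fintype.card (Fin m → ι) : ℕ) : ℝ) = (Fintype.card ι : ℝ) ^ m := by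
    rw [Fintype.card_fun, Fintype.card_fin]; push_cast; ring
  have h5 : (((Fintype.card ι : ℝ) - 1) / Fintype.card ι) ^ m * (Fintype.card ι : ℝ) ^ m =
      ((Fintype.card ι : ℝ) - 1) ^ m := by
    have : (Fintype.card ι : ℝ) ≠ 0 := by positivity
    rw [div_pow, div_mul_cancel₀ _ (by positivity)]
  rw [Finset.card_univ] at h1
  have h6 : (((Finset.univ.filter (fun s : Fin m → ι => ∃ j, a (s j) = a i)).card : ℕ) : ℝ) +
    (((Finset.univ.filter (fun s : Fin m → ι => ¬ ∃ j, a (s j) = a i)).card : ℕ) : ℝ) =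
      (Fintype.card ι : ℝ) ^ m := by
    rw [← h4]
    exact_mod_cast h1
  rw [h4, hitProb, sub_mul, h5, one_mul]
  linarith

/-- The average of `f` over a finite type. -/
noncomputable def avg {β : Type*} [Fintype β] (f : β → ℝ) : ℝ := (Fintype.card β : ℝ)⁻¹ * ∑ s, f s

lemma avg_mono {β : Type*} [Fintype β] {f g : β → ℝ} (h : ∀ s, f s ≤ g s) : avg f ≤ avg g := by
  unfold avg
  have := Finset.sum_le_sum fun s (_ : s ∈ Finset.univ) => h s
  gcongr

lemma avg_const {β : Type*} [Fintype β] [Nonempty β] (c : ℝ) : avg (fun _ : β => c) = c := by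
  unfold avg
  rw [Finset.sum_const, nsmul_eq_mul, Finset.card_univ]
  field_simp

lemma avg_add {β : Type*} [Fintype β] (f g : β → ℝ) :
    avg (fun s => f s + g s) = avg f + avg g := by
  unfold avg; rw [Finset.sum_add_distrib, mul_add]

lemma avg_mul {β : Type*} [Fintype β] (c : ℝ) (f : β → ℝ) :
    avg (fun s => c * f s) = c * avg f := by
  unfold avg; rw [← Finset.mul_sum]; ring

/-- In expectation, a step decreases the cost of the current labelling in proportion to the
deviation of the centroids from the means of their cells, up to a second-order term. -/
lemma avg_labelCost_batchStep_le [Fintype κ] [Nonempty ι] (hM : ∀ i, ‖P i‖ ≤ M) (hM0 : 0 ≤ M)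
    (hC : ∀ r, ‖C r‖ ≤ M) (hη : 0 ≤ η) :
    avg (fun s : Fin m → ι => labelCost P a (batchStep P a η s C)) ≤
      labelCost P a C - 2 * hitProb (Fintype.card ι) m * η * labelDev P a C
        + 4 * M ^ 2 * Fintype.card ι * η ^ 2 := by
  have hdev : avg (fun s : Fin m → ι => labelDev P a (batchStep P a η s C)) ≤
      labelDev P a C - 2 * hitProb (Fintype.card ι) m * η * labelDev P a C
        + 4 * M ^ 2 * Fintype.card ι * η ^ 2 := by
    have hexp : ∀ (s : Fin m → ι), labelDev P a (batchStep P a η s C) ≤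
        (labelDev P a C + 4 * M ^ 2 * Fintype.card ι * η ^ 2) + 2 * η *
          ∑ i, inner ℝ (batchMove P a s C (a i)) (C (a i) - labelMean P a (a i)) := by
      intro s
      unfold labelDev
      have : ∀ i ∈ Finset.univ, ‖batchStep P a η s C (a i) - labelMean P a (a i)‖ ^ 2 ≤
          ‖C (a i) - labelMean P a (a i)‖ ^ 2 + 4 * M ^ 2 * η ^ 2 +
          2 * η * inner ℝ (batchMove P a s C (a i)) (C (a i) - labelMean P a (a i)) := by
        intro i _
        have e : batchStep P a η s C (a i) - labelMean P a (a i) =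
          (C (a i) - labelMean P a (a i)) + η • batchMove P a s C (a i) := by
          rw [batchStep]; abel
        rw [e, norm_add_sq_real, inner_smul_right, norm_smul, mul_pow, real_inner_comm,
          Real.norm_of_nonneg hη]
        have h1 : ‖batchMove P a s C (a i)‖ ^ 2 ≤ (2 * M) ^ 2 := by
          have := norm_batchMove_le (a := a) (s := s) hM hM0 hC (a i)
          gcongr
        nlinarith [sq_nonneg η]
      refine (Finset.sum_le_sum this).trans_eq ?_
      rw [Finset.sum_add_distrib, Finset.sum_add_distrib, Finset.sum_const, nsmul_eq_mul,
        Finset.card_univ, ← Finset.mul_sum]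
      ring
    refine (avg_mono hexp).trans ?_
    rw [avg_add, avg_const, avg_mul]
    have hin : avg (fun s : Fin m → ι => ∑ i, inner ℝ (batchMove P a s C (a i))
        (C (a i) - labelMean P a (a i))) ≤ - hitProb (Fintype.card ι) m * labelDev P a C := by
      unfold avg
      rw [Finset.sum_comm, labelDev]
      rw [inv_mul_le_iff₀ (by positivity), ← mul_assoc, Finset.mul_sum]
      refine Finset.sum_le_sum fun i _ => ?_
      rw [← sum_inner, sum_batchMove, inner_smul_left, ← neg_sub (C (a i)), inner_neg_left,
        real_inner_self_eq_norm_sq]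
      have := hitProb_le_card (m := m) (a := a) i
      simp only [conj_trivial]
      nlinarith [sq_nonneg ‖C (a i) - labelMean P a (a i)‖]
    nlinarith
  have e : (fun s : Fin m → ι => labelCost P a (batchStep P a η s C)) =
      fun s => labelVal P a + labelDev P a (batchStep P a η s C) := by
    funext s; exact labelCost_eq
  rw [e, avg_add, avg_const, labelCost_eq]
  linarith

end Step

/-! ### Uniform sampling and summability along supermartingales -/

section Sampling

variable {β Ω : Type*} [Fintype β] [Nonempty β] [MeasurableSpace β] [MeasurableSingletonClass β]
  [MeasurableSpace Ω] {μ : Measure Ω} {B : ℕ → Ω → β}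

/-- The variables `B 0, B 1, …` are independent and uniformly distributed, expressed by the
probabilities of finite histories. -/
def IsUniformSampling (μ : Measure Ω) (B : ℕ → Ω → β) : Prop :=
  (∀ t, Measurable (B t)) ∧
    ∀ t (h : Fin t → β), μ.real {ω | ∀ i : Fin t, B i ω = h i} = ((Fintype.card β : ℝ)⁻¹) ^ t

/-- The sample path of `ω`. -/
def samplePath (B : ℕ → Ω → β) (ω : Ω) : ℕ → β := fun t => B t ω

/-- The extension of a finite history by an arbitrary fixed value. -/
noncomputable def extendHistory {t : ℕ} (h : Fin t → β) : ℕ → β :=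
  fun i => if hi : i < t then h ⟨i, hi⟩ else Classical.arbitrary β

lemma DependsOn.eq_extendHistory {γ : Type*} {t : ℕ} {f : (ℕ → β) → γ}
    (hf : DependsOn f (Set.Iio t)) (w : ℕ → β) : f w = f (extendHistory fun i : Fin t => w i) := by
  refine hf fun i hi => ?_
  rw [extendHistory, dif_pos (Set.mem_Iio.1 hi)]

lemma measurable_of_dependsOn {γ : Type*} [MeasurableSpace γ] (hB : ∀ t, Measurable (B t)) {t : ℕ}
    {f : (ℕ → β) → γ} (hf : DependsOn f (Set.Iio t)) : Measurable fun ω => f (samplePath B ω) := by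
  have h : (fun ω => f (samplePath B ω)) =
      (fun h : Fin t → β => f (extendHistory h)) ∘ fun ω i => B i ω := by
    funext ω; exact hf.eq_extendHistory _
  rw [h]
  exact (measurable_of_finite _).comp (measurable_pi_lambda _ fun i => hB i)

lemma integrable_of_dependsOn [IsProbabilityMeasure μ] (hB : ∀ t, Measurable (B t)) {t : ℕ}
    {f : (ℕ → β) → ℝ} (hf : DependsOn f (Set.Iio t)) :
    Integrable (fun ω => f (samplePath B ω)) μ := by
  obtain ⟨K, hK⟩ := (Set.finite_range fun h : Fin t → β => ‖f (extendHistory h)‖).bddAbove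
  refine Integrable.of_bound (measurable_of_dependsOn hB hf).aestronglyMeasurable K
    (Filter.Eventually.of_forall fun ω => ?_)
  rw [hf.eq_extendHistory]
  exact hK ⟨_, rfl⟩

lemma integral_samplePath [IsProbabilityMeasure μ] (hB : IsUniformSampling μ B) {t : ℕ}
    {f : (ℕ → β) → ℝ} (hf : DependsOn f (Set.Iio t)) :
    ∫ ω, f (samplePath B ω) ∂μ = avg fun h : Fin t → β => f (extendHistory h) := by
  have hm : Measurable fun ω (i : Fin t) => B i ω := measurable_pi_lambda _ fun i => hB.1 i
  have h1 : ∫ ω, f (samplePath B ω) ∂μ =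
      ∫ h : Fin t → β, f (extendHistory h) ∂(μ.map fun ω (i : Fin t) => B i ω) := by
    rw [integral_map hm.aemeasurable (measurable_of_finite _).aestronglyMeasurable]
    exact integral_congr_ae (Filter.Eventually.of_forall fun ω => hf.eq_extendHistory _)
  have : IsProbabilityMeasure (μ.map fun ω (i : Fin t) => B i ω) :=
    Measure.isProbabilityMeasure_map hm.aemeasurable
  rw [h1, integral_fintype .of_finite, avg, Finset.mul_sum]
  refine Finset.sum_congr rfl fun h _ => ?_
  rw [map_measureReal_apply hm (measurableSet_singleton _), smul_eq_mul]
  congr 1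
  have : ((fun ω (i : Fin t) => B i ω) ⁻¹' {h}) = {ω | ∀ i : Fin t, B i ω = h i} := by
    ext ω; simp [funext_iff]
  rw [this, hB.2, Fintype.card_fun, Fintype.card_fin]
  push_cast
  rw [inv_pow]

lemma avg_snoc {t : ℕ} (F : (Fin (t + 1) → β) → ℝ) :
    avg F = avg fun h : Fin t → β => avg fun s => F (Fin.snoc (α := fun _ => β) h s) := by
  unfold avg
  rw [← Finset.mul_sum, ← mul_assoc, ← (Fin.snocEquiv fun _ : Fin (t + 1) => β).sum_comp,
    Fintype.sum_prod_type, Finset.sum_comm]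
  congr 1
  rw [Fintype.card_fun, Fintype.card_fun, Fintype.card_fin, Fintype.card_fin]
  push_cast
  rw [pow_succ, mul_inv]

lemma dependsOn_avg_update {t : ℕ} {f : (ℕ → β) → ℝ} (hf : DependsOn f (Set.Iio (t + 1))) :
    DependsOn (fun w => avg fun s => f (Function.update w t s)) (Set.Iio t) := by
  intro w w' h
  simp only
  congr 1
  funext s
  refine hf fun i hi => ?_
  by_cases hit : i = t
  · subst hit; simp
  · rw [Function.update_of_ne hit, Function.update_of_ne hit]
    exact h i (Set.mem_Iio.2 (lt_of_le_of_ne (Nat.lt_succ_iff.1 hi) hit))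

/-- Averaging over the last draw does not change the expectation. -/
lemma integral_avg_update [IsProbabilityMeasure μ] (hB : IsUniformSampling μ B) {t : ℕ}
    {f : (ℕ → β) → ℝ} (hf : DependsOn f (Set.Iio (t + 1))) :
    ∫ ω, f (samplePath B ω) ∂μ =
      ∫ ω, avg (fun s => f (Function.update (samplePath B ω) t s)) ∂μ := by
  rw [integral_samplePath hB hf, integral_samplePath hB (dependsOn_avg_update hf), avg_snoc]
  congr 1
  funext h
  congr 1
  funext s
  refine hf fun i hi => ?_
  by_cases hit : i = t
  · subst hit
    rw [extendHistory, dif_pos (Nat.lt_succ_self _), Function.update_self]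
    exact Fin.snoc_last _ _
  · have hlt : i < t := lt_of_le_of_ne (Nat.lt_succ_iff.1 hi) hit
    rw [Function.update_of_ne hit, extendHistory, extendHistory, dif_pos (Set.mem_Iio.1 hi),
      dif_pos hlt]
    exact Fin.snoc_castSucc (α := fun _ => β) _ _ ⟨i, hlt⟩

/-- If a nonnegative adapted sequence `U` decreases in conditional expectation by `g`, up to
summable errors, then `g` is almost surely summable. -/
lemma ae_summable_of_avg_le [IsProbabilityMeasure μ] (hB : IsUniformSampling μ B)
    {U g : ℕ → (ℕ → β) → ℝ} {ε : ℕ → ℝ} (hU : ∀ t, DependsOn (U t) (Set.Iio t))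
    (hg : ∀ t, DependsOn (g t) (Set.Iio t)) (hU0 : ∀ t w, 0 ≤ U t w) (hg0 : ∀ t w, 0 ≤ g t w)
    (hε : Summable ε) (hε0 : ∀ t, 0 ≤ ε t)
    (hstep : ∀ t w, avg (fun s => U (t + 1) (Function.update w t s)) ≤ U t w - g t w + ε t) :
    ∀ᵐ ω ∂μ, Summable fun t => g t (samplePath B ω) := by
  have hint : ∀ t, ∫ ω, U (t + 1) (samplePath B ω) ∂μ ≤
      ∫ ω, U t (samplePath B ω) ∂μ - ∫ ω, g t (samplePath B ω) ∂μ + ε t := by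
    intro t
    rw [integral_avg_update hB (hU (t + 1))]
    have hiU := integrable_of_dependsOn (μ := μ) hB.1 (hU t)
    have hig := integrable_of_dependsOn (μ := μ) hB.1 (hg t)
    calc _ ≤ ∫ ω, (U t (samplePath B ω) - g t (samplePath B ω) + ε t) ∂μ :=
          integral_mono (integrable_of_dependsOn (μ := μ) hB.1 (dependsOn_avg_update (hU (t + 1))))
            ((hiU.sub hig).add (integrable_const _)) fun ω => hstep t _
      _ = _ := by
          have hUg : Integrable (fun ω => U t (samplePath B ω) - g t (samplePath B ω)) μ :=
            hiU.sub hig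
          rw [integral_add hUg (integrable_const _), integral_sub hiU hig]; simp
  have hsum : ∀ T, ∑ t ∈ Finset.range T, ∫ ω, g t (samplePath B ω) ∂μ ≤
      ∫ ω, U 0 (samplePath B ω) ∂μ + ∑' t, ε t := by
    intro T
    have h1 : ∑ t ∈ Finset.range T, ∫ ω, g t (samplePath B ω) ∂μ ≤
        ∫ ω, U 0 (samplePath B ω) ∂μ - ∫ ω, U T (samplePath B ω) ∂μ
          + ∑ t ∈ Finset.range T, ε t := by
      induction T with
      | zero => simp
      | succ T ih =>
        rw [Finset.sum_range_succ, Finset.sum_range_succ]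
        linarith [hint T]
    have h2 : 0 ≤ ∫ ω, U T (samplePath B ω) ∂μ := integral_nonneg fun ω => hU0 _ _
    have h3 := hε.sum_le_tsum (Finset.range T) fun t _ => hε0 t
    linarith
  have hgsum : Summable fun t => ∫ ω, g t (samplePath B ω) ∂μ :=
    summable_of_sum_range_le (fun t => integral_nonneg fun ω => hg0 t _) hsum
  have hlin : ∫⁻ ω, ∑' t, ENNReal.ofReal (g t (samplePath B ω)) ∂μ ≠ ⊤ := by
    rw [lintegral_tsum fun t =>
      (measurable_of_dependsOn hB.1 (hg t)).ennreal_ofReal.aemeasurable]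
    have : ∀ t, ∫⁻ ω, ENNReal.ofReal (g t (samplePath B ω)) ∂μ =
        ENNReal.ofReal (∫ ω, g t (samplePath B ω) ∂μ) := fun t =>
      (ofReal_integral_eq_lintegral_ofReal (integrable_of_dependsOn (μ := μ) hB.1 (hg t))
        (Filter.Eventually.of_forall fun ω => hg0 t _)).symm
    simp_rw [this]
    rw [← ENNReal.ofReal_tsum_of_nonneg (fun t => integral_nonneg fun ω => hg0 t _) hgsum]
    exact ENNReal.ofReal_ne_top
  have hae := ae_lt_top' (AEMeasurable.tsum fun t =>
    (measurable_of_dependsOn hB.1 (hg t)).ennreal_ofReal.aemeasurable) hlin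
  filter_upwards [hae] with ω hω
  have := ENNReal.summable_toReal hω.ne
  refine this.congr fun t => ?_
  exact ENNReal.toReal_ofReal (hg0 t _)

/-- If `K t` has probability at least `c > 0` to be followed by a decrease of the bounded
supermartingale `U`, then almost surely `K` occurs finitely often. -/
lemma ae_eventually_not_of_avg_le [IsProbabilityMeasure μ] (hB : IsUniformSampling μ B)
    {U : ℕ → (ℕ → β) → ℝ} {K : ℕ → (ℕ → β) → Prop} {c : ℝ} (hc : 0 < c) (T : ℕ)
    (hU : ∀ t, DependsOn (U t) (Set.Iio t)) (hK : ∀ t, DependsOn (K t) (Set.Iio t))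
    (hU0 : ∀ t w, 0 ≤ U t w) (hU1 : ∀ t w, U t w ≤ 1)
    (hle : ∀ t ≥ T, ∀ w, avg (fun s => U (t + 1) (Function.update w t s)) ≤ U t w)
    (hlt : ∀ t ≥ T, ∀ w, K t w →
      avg (fun s => U (t + 1) (Function.update w t s)) ≤ U t w - c) :
    ∀ᵐ ω ∂μ, ∀ᶠ t in Filter.atTop, ¬ K t (samplePath B ω) := by
  classical
  have h := ae_summable_of_avg_le hB (U := fun t w => if t < T then 1 else U t w)
    (g := fun t w => if T ≤ t ∧ K t w then c else 0) (ε := fun _ => 0) ?_ ?_ ?_ ?_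
    summable_zero (fun _ => le_rfl) ?_
  · filter_upwards [h] with ω hω
    have h1 := hω.tendsto_atTop_zero
    filter_upwards [h1.eventually_lt_const hc, Filter.eventually_ge_atTop T] with t ht htT hKt
    rw [if_pos ⟨htT, hKt⟩] at ht
    exact lt_irrefl _ ht
  · intro t w w' hw
    simp only [hU t hw]
  · intro t w w' hw
    simp only [hK t hw]
  · intro t w
    split_ifs
    · exact zero_le_one
    · exact hU0 t w
  · intro t w
    split_ifs
    · exact hc.le
    · exact le_rfl
  · intro t w
    rcases lt_or_ge t T with ht | ht
    · rw [if_pos ht, if_neg (by omega)]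
      simp only [sub_zero, add_zero]
      refine (avg_mono (g := fun _ => 1) fun s => ?_).trans_eq (avg_const 1)
      split_ifs
      · exact le_rfl
      · exact hU1 _ _
    · have h2 : ¬ t < T := by omega
      have h3 : ¬ t + 1 < T := by omega
      simp only [h2, h3, if_false, ht, true_and, add_zero]
      split_ifs with hk
      · exact hlt t ht w hk
      · simpa using hle t ht w

end Sampling

/-! ### Escapes from a group of self-consistent labellings -/

section Drift

variable {ι κ V : Type*} [Fintype ι] [Fintype κ] [DecidableEq κ]
  [NormedAddCommGroup V] [InnerProductSpace ℝ V] {m : ℕ}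

lemma hitProb_pos [Nonempty ι] (hm : 1 ≤ m) : 0 < hitProb (Fintype.card ι) m := by
  have hn : (1 : ℝ) ≤ Fintype.card ι := by exact_mod_cast Fintype.card_pos
  have : (((Fintype.card ι : ℝ) - 1) / Fintype.card ι) ^ m < 1 := by
    refine pow_lt_one₀ (div_nonneg (by linarith) (by linarith)) ?_ (by omega)
    rw [div_lt_one (by linarith)]
    linarith
  unfold hitProb
  linarith

lemma hitProb_le_one [Nonempty ι] (m : ℕ) : hitProb (Fintype.card ι) m ≤ 1 := by
  have hn : (1 : ℝ) ≤ Fintype.card ι := by exact_mod_cast Fintype.card_pos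
  have : 0 ≤ (((Fintype.card ι : ℝ) - 1) / Fintype.card ι) ^ m :=
    pow_nonneg (div_nonneg (by linarith) (by linarith)) _
  unfold hitProb
  linarith

/-- The least deviation among a set of labellings. -/
noncomputable def groupDev (P : ι → V) (A : Finset (ι → κ)) (hA : A.Nonempty) (C : κ → V) : ℝ :=
  A.inf' hA fun a => labelDev P a C

variable {P : ι → V} {C C' : κ → V} {A : Finset (ι → κ)} {hA : A.Nonempty} {M e : ℝ}

lemma groupDev_nonneg : 0 ≤ groupDev P A hA C :=
  (Finset.le_inf'_iff _ _).2 fun _ _ => labelDev_nonneg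

lemma groupDev_le {a : ι → κ} (ha : a ∈ A) : groupDev P A hA C ≤ labelDev P a C :=
  Finset.inf'_le _ ha

lemma groupDev_le_add (hM0 : 0 ≤ M) (hM : ∀ i, ‖P i‖ ≤ M) (hC : ∀ r, ‖C r‖ ≤ M)
    (hC' : ∀ r, ‖C' r‖ ≤ M) (h : ∀ r, ‖C' r - C r‖ ≤ e) :
    groupDev P A hA C' ≤ groupDev P A hA C + 4 * M * Fintype.card ι * e := by
  obtain ⟨a, ha, hae⟩ := A.exists_mem_eq_inf' hA fun a => labelDev P a C
  have h1 := (abs_le.1 (abs_labelDev_sub_le (a := a) hM0 hM hC hC' h)).2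
  have h2 : groupDev P A hA C = labelDev P a C := hae
  linarith [groupDev_le (P := P) (hA := hA) (C := C') ha]

lemma abs_groupDev_sub_le (hM0 : 0 ≤ M) (hM : ∀ i, ‖P i‖ ≤ M) (hC : ∀ r, ‖C r‖ ≤ M)
    (hC' : ∀ r, ‖C' r‖ ≤ M) (h : ∀ r, ‖C' r - C r‖ ≤ e) :
    |groupDev P A hA C' - groupDev P A hA C| ≤ 4 * M * Fintype.card ι * e := by
  have h1 := groupDev_le_add (hA := hA) hM0 hM hC hC' h
  have h2 := groupDev_le_add (hA := hA) hM0 hM hC' hC fun r => by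
    rw [norm_sub_rev]; exact h r
  rw [abs_le]
  constructor <;> linarith

lemma le_groupDev_of_move {θ : ℝ} (hθ : 0 < θ) (hθ1 : θ ≤ 1) (h : ∀ r, ‖C' r - C r‖ ≤ e) :
    (1 - θ) * groupDev P A hA C - Fintype.card ι * e ^ 2 / θ ≤ groupDev P A hA C' := by
  obtain ⟨a, ha, hae⟩ := A.exists_mem_eq_inf' hA fun a => labelDev P a C'
  have h2 : groupDev P A hA C' = labelDev P a C' := hae
  rw [h2]
  refine le_trans ?_ (le_labelDev_of_move (a := a) (C := C) hθ h)
  have := groupDev_le (P := P) (hA := hA) (C := C) ha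
  have h3 : 0 ≤ 1 - θ := by linarith
  gcongr

lemma avg_exp_le {β : Type*} [Fintype β] [Nonempty β] {X : β → ℝ} {c B l η : ℝ}
    (hη : 0 < η) (hl : 0 < l) (hX : ∀ s, |X s| ≤ B * η) (hlB : l * B ≤ 1)
    (hlc : l * B ^ 2 ≤ c / 2) (hm : c * η ≤ avg X) :
    avg (fun s => Real.exp (-(l * X s / η))) ≤ 1 - l * c / 2 := by
  have h1 : ∀ s, Real.exp (-(l * X s / η)) ≤ (1 + l ^ 2 * B ^ 2) + (-(l / η)) * X s := by
    intro s
    have hy : |l * X s / η| ≤ l * B := by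
      rw [abs_div, abs_mul, abs_of_pos hl, abs_of_pos hη, div_le_iff₀ hη, mul_assoc]
      exact mul_le_mul_of_nonneg_left (hX s) hl.le
    have h2 := Real.abs_exp_sub_one_sub_id_le (x := -(l * X s / η))
      (by rw [abs_neg]; linarith)
    have h3 : (-(l * X s / η)) ^ 2 ≤ l ^ 2 * B ^ 2 := by
      rw [neg_sq, ← sq_abs, ← mul_pow]
      exact pow_le_pow_left₀ (abs_nonneg _) hy 2
    have h4 := (abs_le.1 h2).2
    have h5 : -(l * X s / η) = -(l / η) * X s := by ring
    rw [h5] at h4 h3 ⊢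
    linarith
  refine (avg_mono h1).trans ?_
  rw [avg_add, avg_const, avg_mul]
  have h6 : l / η * (c * η) = l * c := by field_simp
  have h7 : l / η * (c * η) ≤ l / η * avg X := by gcongr
  nlinarith

/-- A group of labellings with the common value `v` absorbs the iterates up to escapes with a
positive drift: if the centroids are close to the means for a labelling of the group, and the
induced labelling is not in the group, then the amount by which the group exceeds the minimal cost
increases on average in proportion to the learning rate. This is expressed by an exponential
moment, at the scale of the learning rate. -/
lemma exists_escape_drift [Nonempty ι] [Nonempty κ] (hm : 1 ≤ m) (hM0 : 0 < M)
    (hM : ∀ i, ‖P i‖ ≤ M) :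
    ∃ ρ > 0, ∃ h₀ > 0, ∃ l > 0, ∃ c > 0, ∃ η₀ > 0, c ≤ 1 ∧
      ∀ (lab : (κ → V) → ι → κ), (∀ C, IsClosest P (lab C) C) →
      ∀ (A : Finset (ι → κ)) (hA : A.Nonempty) (v : ℝ), (∀ a ∈ A, labelVal P a = v) →
      (∀ a, IsSelfConsistent P a → labelVal P a = v → a ∈ A) →
      ∀ C : κ → V, (∀ r, ‖C r‖ ≤ M) → lab C ∉ A → groupDev P A hA C < ρ →
      v + groupDev P A hA C - labelCost P (lab C) C < h₀ →
      ∀ η, 0 < η → η ≤ 1 → η ≤ η₀ →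
      avg (fun s : Fin m → ι => Real.exp (-(l * (v + groupDev P A hA (batchStep P (lab C) η s C) -
          labelCost P (lab (batchStep P (lab C) η s C)) (batchStep P (lab C) η s C)) / η))) ≤
        Real.exp (-(l * (v + groupDev P A hA C - labelCost P (lab C) C) / η)) * (1 - c) := by
  obtain ⟨ρ₀, hρ₀, hsc⟩ := exists_dev_isSelfConsistent P κ
  obtain ⟨g, hg, hgap⟩ := exists_pos_le_of_finite (α := (ι → κ) × (ι → κ))
    (fun x => labelVal P x.1 ≠ labelVal P x.2) (fun x => |labelVal P x.1 - labelVal P x.2|)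
    (fun x hx => abs_pos.2 (sub_ne_zero.2 hx))
  have hn : (0 : ℝ) < Fintype.card ι := by exact_mod_cast Fintype.card_pos
  have hp := hitProb_pos (ι := ι) hm
  set n : ℝ := (Fintype.card ι : ℝ) with hndef
  set p := hitProb (Fintype.card ι) m with hpdef
  set ρ₁ := min ρ₀ (g / 4) with hρ₁def
  have hρ₁ : 0 < ρ₁ := lt_min hρ₀ (by positivity)
  set Q := 4 * M ^ 2 * n with hQdef
  have hQ : 0 < Q := by positivity
  set K := 2 * Q / (p * ρ₁) with hKdef
  have hK : 0 < K := by positivity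
  have hKQ : K * (p * ρ₁) = 2 * Q := by rw [hKdef]; field_simp
  set B := 4 * Q with hBdef
  have hB : 0 < B := by positivity
  set c₁ := p * ρ₁ / 2 with hc₁def
  have hc₁ : 0 < c₁ := by positivity
  set l := min (1 / B) (c₁ / (2 * B ^ 2)) with hldef
  have hl : 0 < l := lt_min (by positivity) (by positivity)
  have hlB : l * B ≤ 1 := by
    have : l ≤ 1 / B := min_le_left _ _
    calc l * B ≤ 1 / B * B := by gcongr
      _ = 1 := by field_simp
  have hlc : l * B ^ 2 ≤ c₁ / 2 := by
    have : l ≤ c₁ / (2 * B ^ 2) := min_le_right _ _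
    calc l * B ^ 2 ≤ c₁ / (2 * B ^ 2) * B ^ 2 := by gcongr
      _ = c₁ / 2 := by field_simp
  refine ⟨min (g / 4) (p * ρ₁ / (2 * K)), lt_min (by positivity) (by positivity), g / 4,
    by positivity, l, hl, min (l * c₁ / 2) 1, lt_min (by positivity) one_pos,
    min (p * ρ₁ / (2 * Q)) (1 / K), lt_min (by positivity) (by positivity), min_le_right _ _, ?_⟩
  intro lab hlab A hA v hAv hAin C hC hCA hG hH η hη hη1 hη₀
  have hD : ρ₁ ≤ labelDev P (lab C) C := by
    by_contra hlt
    push Not at hlt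
    have hs := hsc (lab C) C (hlab C) (hlt.trans_le (min_le_left _ _))
    have hne : labelVal P (lab C) ≠ v := fun h => hCA (hAin _ hs h)
    obtain ⟨a, ha⟩ := hA
    have h1 := hgap (lab C, a) (by simpa only [hAv a ha] using hne)
    simp only [hAv a ha] at h1
    rw [labelCost_eq] at hH
    have h2 : labelDev P (lab C) C < g / 4 := hlt.trans_le (min_le_right _ _)
    have h3 := (hlab C).labelCost_le a
    rw [labelCost_eq, labelCost_eq, hAv a ha] at h3
    have h4 := labelDev_nonneg (P := P) (a := lab C) (C := C)
    have h5 : groupDev P A ⟨a, ha⟩ C < g / 4 := hG.trans_le (min_le_left _ _)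
    have h6 : 0 ≤ groupDev P A ⟨a, ha⟩ C := groupDev_nonneg
    obtain ⟨b, hb, hbe⟩ := A.exists_mem_eq_inf' ⟨a, ha⟩ fun a => labelDev P a C
    have h7 : groupDev P A ⟨a, ha⟩ C = labelDev P b C := hbe
    have h8 := (hlab C).labelCost_le b
    rw [labelCost_eq, labelCost_eq, hAv b hb] at h8
    rcases abs_cases (labelVal P (lab C) - v) with ⟨h, _⟩ | ⟨h, _⟩ <;> linarith
  set a := lab C with hadef
  set X : (Fin m → ι) → ℝ := fun s =>
    (groupDev P A hA (batchStep P a η s C) - groupDev P A hA C) -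
      (labelCost P a (batchStep P a η s C) - labelCost P a C) with hXdef
  have hmove : ∀ (s : Fin m → ι) r, ‖batchStep P a η s C r - C r‖ ≤ 2 * M * η := fun s r =>
    norm_batchStep_sub_le hM hM0.le hC hη.le r
  have hbd : ∀ (s : Fin m → ι) r, ‖batchStep P a η s C r‖ ≤ M := fun s r =>
    norm_batchStep_le hM hM0.le hC hη.le hη1 r
  have hX : ∀ s, |X s| ≤ B * η := by
    intro s
    have h1 := abs_groupDev_sub_le (hA := hA) hM0.le hM hC (hbd s) (hmove s)
    have h2 := abs_labelCost_sub_le (a := a) hM0.le hM hC (hbd s) (hmove s)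
    calc |X s| ≤ _ := abs_sub _ _
      _ ≤ 4 * M * n * (2 * M * η) + 4 * M * n * (2 * M * η) := add_le_add h1 h2
      _ = B * η := by rw [hBdef, hQdef]; ring
  have hmean : c₁ * η ≤ avg X := by
    have h1 := avg_labelCost_batchStep_le (m := m) (a := a) (η := η) hM hM0.le hC hη.le
    have hη2 : η ≤ p * ρ₁ / (2 * Q) := hη₀.trans (min_le_left _ _)
    have hη3 : K * η ≤ 1 := by
      have : η ≤ 1 / K := hη₀.trans (min_le_right _ _)
      rwa [le_div_iff₀ hK, mul_comm] at this
    have h2 : ∀ s : Fin m → ι, -(K * η * groupDev P A hA C + Q * η / K) ≤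
        groupDev P A hA (batchStep P a η s C) - groupDev P A hA C := by
      intro s
      have h3 := le_groupDev_of_move (hA := hA) (P := P) (by positivity : 0 < K * η) hη3 (hmove s)
      have h4 : n * (2 * M * η) ^ 2 / (K * η) = Q * η / K := by
        rw [hQdef]; field_simp; ring
      rw [← hndef, h4] at h3
      linarith
    have h5 : avg X = avg (fun s : Fin m → ι =>
        groupDev P A hA (batchStep P a η s C) - groupDev P A hA C) + labelCost P a C -
          avg (fun s : Fin m → ι => labelCost P a (batchStep P a η s C)) := by
      have : X = fun s => (groupDev P A hA (batchStep P a η s C) - groupDev P A hA C) +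
          (labelCost P a C + (-1) * labelCost P a (batchStep P a η s C)) := by
        funext s; rw [hXdef]; ring
      rw [this, avg_add, avg_add, avg_mul, avg_const]; ring
    have h6 := avg_mono h2
    rw [avg_const] at h6
    rw [h5]
    have h7 : Q * η / K = c₁ * η := by
      rw [hc₁def, div_eq_iff hK.ne']
      linear_combination (-η / 2) * hKQ
    have h8 : K * groupDev P A hA C ≤ p * ρ₁ / 2 := by
      have : groupDev P A hA C ≤ p * ρ₁ / (2 * K) := (hG.trans_le (min_le_right _ _)).le
      calc K * groupDev P A hA C ≤ K * (p * ρ₁ / (2 * K)) := by gcongr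
        _ = p * ρ₁ / 2 := by field_simp
    have h9 : Q * η ≤ p * ρ₁ / 2 := by
      calc Q * η ≤ Q * (p * ρ₁ / (2 * Q)) := by gcongr
        _ = p * ρ₁ / 2 := by field_simp
    have h10 : K * η * groupDev P A hA C ≤ p * ρ₁ / 2 * η := by
      calc K * η * groupDev P A hA C = (K * groupDev P A hA C) * η := by ring
        _ ≤ _ := by gcongr
    have h11 : Q * η ^ 2 ≤ p * ρ₁ / 2 * η := by
      calc Q * η ^ 2 = (Q * η) * η := by ring
        _ ≤ _ := by gcongr
    have h12 : p * η * ρ₁ ≤ p * η * labelDev P a C := by gcongr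
    rw [hc₁def] at h7 ⊢
    linarith
  have hmain := avg_exp_le hη hl hX hlB hlc hmean
  set H := v + groupDev P A hA C - labelCost P a C with hHdef
  calc _ ≤ avg (fun s => Real.exp (-(l * H / η)) * Real.exp (-(l * X s / η))) := by
        refine avg_mono fun s => ?_
        rw [← Real.exp_add]
        apply Real.exp_le_exp.2
        rw [← neg_add, ← add_div, ← mul_add, neg_le_neg_iff]
        have := (hlab (batchStep P a η s C)).labelCost_le a
        have h1 : H + X s ≤ v + groupDev P A hA (batchStep P a η s C) -
            labelCost P (lab (batchStep P a η s C)) (batchStep P a η s C) := by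
          rw [hHdef, hXdef]
          simp only
          linarith
        gcongr
    _ = Real.exp (-(l * H / η)) * avg (fun s => Real.exp (-(l * X s / η))) := avg_mul _ _
    _ ≤ _ := by
        have : min (l * c₁ / 2) 1 ≤ l * c₁ / 2 := min_le_left _ _
        gcongr
        linarith

end Drift

/-! ### Almost sure properties of the iteration -/

section Recurrence

variable {β Ω : Type*} [Fintype β] [Nonempty β] [MeasurableSpace β] [MeasurableSingletonClass β]
  [MeasurableSpace Ω] {μ : Measure Ω} {B : ℕ → Ω → β}

/-- If an adapted event `J` occurs infinitely often, then infinitely often it is followed by a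
given draw `s₀`. -/
lemma ae_eventually_not_of_not_draw [IsProbabilityMeasure μ] (hB : IsUniformSampling μ B)
    {J : ℕ → (ℕ → β) → Prop} (hJ : ∀ t, DependsOn (J t) (Set.Iio t)) (s₀ : β) :
    ∀ᵐ ω ∂μ, ∀ T, (∀ t ≥ T, J t (samplePath B ω) → samplePath B ω t ≠ s₀) →
      ∀ᶠ t in Filter.atTop, ¬ J t (samplePath B ω) := by
  classical
  rw [ae_all_iff]
  intro T
  set R : ℕ → (ℕ → β) → Prop := fun t w => ∀ u, T ≤ u → u < t → J u w → w u ≠ s₀ with hR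
  have hRdep : ∀ t, DependsOn (R t) (Set.Iio t) := by
    intro t w w' hw
    simp only [hR, eq_iff_iff]
    refine forall_congr' fun u => imp_congr_right fun _ => imp_congr_right fun hu => ?_
    rw [hJ u fun i hi => hw i (lt_trans (Set.mem_Iio.1 hi) hu), hw u hu]
  have hstep : ∀ t ≥ T, ∀ w s, R (t + 1) (Function.update w t s) ↔ R t w ∧ (J t w → s ≠ s₀) := by
    intro t ht w s
    have hold : R t (Function.update w t s) ↔ R t w := by
      rw [hRdep t fun i hi => Function.update_of_ne (Set.mem_Iio.1 hi).ne _ _]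
    have hJt : J t (Function.update w t s) ↔ J t w := by
      rw [hJ t fun i hi => Function.update_of_ne (Set.mem_Iio.1 hi).ne _ _]
    rw [← hold, ← hJt]
    constructor
    · intro h
      refine ⟨fun u hu hut => h u hu (by omega), fun hj => ?_⟩
      simpa using h t ht (Nat.lt_succ_self _) hj
    · rintro ⟨h1, h2⟩ u hu hut
      rcases Nat.lt_succ_iff_lt_or_eq.1 hut with h | h
      · exact h1 u hu h
      · subst h; simpa using h2
  have hcard : (0 : ℝ) < Fintype.card β := by exact_mod_cast Fintype.card_pos
  have h := ae_eventually_not_of_avg_le hB (U := fun t w => if R t w then 1 else 0)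
    (K := fun t w => R t w ∧ J t w) (c := (Fintype.card β : ℝ)⁻¹) (by positivity) T
    ?_ ?_ ?_ ?_ ?_ ?_
  · filter_upwards [h] with ω hω hT
    filter_upwards [hω] with t ht hj
    exact ht ⟨fun u hu _ => hT u hu, hj⟩
  · intro t w w' hw
    simp only [hRdep t hw]
  · intro t w w' hw
    simp only [hRdep t hw, hJ t hw]
  · intro t w
    split_ifs
    · exact zero_le_one
    · exact le_rfl
  · intro t w
    split_ifs
    · exact le_rfl
    · exact zero_le_one
  · intro t ht w
    simp only [hstep t ht]
    refine (avg_mono (g := fun _ => if R t w then 1 else 0) fun s => ?_).trans_eq (avg_const _)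
    by_cases h1 : R t w
    · simp only [h1, true_and, if_true]
      split_ifs
      · exact le_rfl
      · exact zero_le_one
    · simp [h1]
  · intro t ht w hK
    simp only [hstep t ht, hK.1, hK.2, true_and, forall_const, if_true]
    refine le_of_eq ?_
    have h1 : (fun s : β => if s ≠ s₀ then (1 : ℝ) else 0) =
        fun s => 1 + (-1) * (if s = s₀ then (1 : ℝ) else 0) := by
      funext s; by_cases hs : s = s₀ <;> simp [hs]
    rw [h1, avg_add, avg_const, avg_mul]
    simp [avg, sub_eq_add_neg]

end Recurrence

section SamplePaths

variable {ι κ V : Type*} [Fintype ι] [Fintype κ] [DecidableEq κ]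
  [NormedAddCommGroup V] [InnerProductSpace ℝ V] {m : ℕ}

/-- The centroids of mini-batch `k`-means for the mini-batches `w 0, w 1, …`, where `lab C` is the
labelling induced by the centroids `C`. -/
noncomputable def labelIter (P : ι → V) (lab : (κ → V) → ι → κ) (η : ℕ → ℝ) (C₀ : κ → V)
    (w : ℕ → Fin m → ι) : ℕ → κ → V
  | 0 => C₀
  | t + 1 => batchStep P (lab (labelIter P lab η C₀ w t)) (η (t + 1)) (w t)
      (labelIter P lab η C₀ w t)

variable {P : ι → V} {lab : (κ → V) → ι → κ} {η : ℕ → ℝ} {C₀ : κ → V} {M : ℝ}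

lemma dependsOn_labelIter (P : ι → V) (lab : (κ → V) → ι → κ) (η : ℕ → ℝ) (C₀ : κ → V) (t : ℕ) :
    DependsOn (fun w : ℕ → Fin m → ι => labelIter P lab η C₀ w t) (Set.Iio t) := by
  induction t with
  | zero => intro w w' _; rfl
  | succ t ih =>
    intro w w' h
    have h1 := ih fun i hi => h i (lt_trans (Set.mem_Iio.1 hi) (Nat.lt_succ_self _))
    simp only at h1
    simp only [labelIter, h1, h t (Set.mem_Iio.2 (Nat.lt_succ_self _))]

lemma labelIter_update (w : ℕ → Fin m → ι) (t : ℕ) (s : Fin m → ι) :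
    labelIter P lab η C₀ (Function.update w t s) (t + 1) =
      batchStep P (lab (labelIter P lab η C₀ w t)) (η (t + 1)) s (labelIter P lab η C₀ w t) := by
  have h : labelIter P lab η C₀ (Function.update w t s) t = labelIter P lab η C₀ w t :=
    dependsOn_labelIter P lab η C₀ t fun _ hi => Function.update_of_ne (Set.mem_Iio.1 hi).ne _ _
  simp [labelIter, h]

lemma labelIter_update_of_le (w : ℕ → Fin m → ι) {t u : ℕ} (hu : u ≤ t) (s : Fin m → ι) :
    labelIter P lab η C₀ (Function.update w t s) u = labelIter P lab η C₀ w u :=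
  dependsOn_labelIter P lab η C₀ u fun _ hi =>
    Function.update_of_ne (lt_of_lt_of_le (Set.mem_Iio.1 hi) hu).ne _ _

lemma norm_labelIter_le (hM : ∀ i, ‖P i‖ ≤ M) (hM0 : 0 ≤ M) (hC₀ : ∀ r, ‖C₀ r‖ ≤ M)
    (hη : ∀ t, 0 < η t) (hη1 : ∀ t, η t ≤ 1) (w : ℕ → Fin m → ι) (t : ℕ) (r : κ) :
    ‖labelIter P lab η C₀ w t r‖ ≤ M := by
  induction t generalizing r with
  | zero => exact hC₀ r
  | succ t ih => exact norm_batchStep_le hM hM0 ih (hη _).le (hη1 _) r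

lemma labelIter_move (hM : ∀ i, ‖P i‖ ≤ M) (hM0 : 0 ≤ M) (hC₀ : ∀ r, ‖C₀ r‖ ≤ M)
    (hη : ∀ t, 0 < η t) (hη1 : ∀ t, η t ≤ 1) (w : ℕ → Fin m → ι) (t : ℕ) (r : κ) :
    ‖labelIter P lab η C₀ w (t + 1) r - labelIter P lab η C₀ w t r‖ ≤ 2 * M * η (t + 1) :=
  norm_batchStep_sub_le hM hM0 (norm_labelIter_le hM hM0 hC₀ hη hη1 w t) (hη _).le r

variable {Ω : Type*} [MeasurableSpace ι] [MeasurableSingletonClass ι] [MeasurableSpace Ω]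
  {μ : Measure Ω} [IsProbabilityMeasure μ] {B : ℕ → Ω → Fin m → ι}

/-- The Robbins-Monro argument: the minimal cost decreases on average by a multiple of
`η * labelDev`, up to `O(η ^ 2)`. -/
lemma ae_summable_labelDev [Nonempty ι] (hm : 1 ≤ m) (hlab : ∀ C, IsClosest P (lab C) C)
    (hM : ∀ i, ‖P i‖ ≤ M) (hM0 : 0 ≤ M) (hC₀ : ∀ r, ‖C₀ r‖ ≤ M)
    (hη : ∀ t, 0 < η t) (hη1 : ∀ t, η t ≤ 1) (hηsq : Summable fun t => η (t + 1) ^ 2)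
    (hB : IsUniformSampling μ B) :
    ∀ᵐ ω ∂μ, Summable fun t => η (t + 1) *
      labelDev P (lab (labelIter P lab η C₀ (samplePath B ω) t))
        (labelIter P lab η C₀ (samplePath B ω) t) := by
  have hp := hitProb_pos (ι := ι) hm
  have h := ae_summable_of_avg_le hB
    (U := fun t w => labelCost P (lab (labelIter P lab η C₀ w t)) (labelIter P lab η C₀ w t))
    (g := fun t w => 2 * hitProb (Fintype.card ι) m * (η (t + 1) *
      labelDev P (lab (labelIter P lab η C₀ w t)) (labelIter P lab η C₀ w t)))
    (ε := fun t => 4 * M ^ 2 * Fintype.card ι * η (t + 1) ^ 2) ?_ ?_ ?_ ?_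
    (hηsq.mul_left _) (fun t => by positivity) ?_
  · filter_upwards [h] with ω hω
    exact (summable_mul_left_iff (by positivity)).1 hω
  · intro t w w' hw
    simp only [dependsOn_labelIter P lab η C₀ t hw]
  · intro t w w' hw
    simp only [dependsOn_labelIter P lab η C₀ t hw]
  · intro t w; exact labelCost_nonneg
  · intro t w
    have := (hη (t + 1)).le
    have := labelDev_nonneg (P := P) (a := lab (labelIter P lab η C₀ w t))
      (C := labelIter P lab η C₀ w t)
    positivity
  · intro t w
    simp only [labelIter_update]
    have hC := norm_labelIter_le (lab := lab) hM hM0 hC₀ hη hη1 w t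
    set C := labelIter P lab η C₀ w t
    refine (avg_mono fun s => (hlab (batchStep P (lab C) (η (t + 1)) s C)).labelCost_le
      (lab C)).trans ?_
    refine (avg_labelCost_batchStep_le hM hM0 hC (hη _).le).trans_eq ?_
    ring

/-- As long as the centroids stay close to the means for a group of labellings with a common value,
the induced labelling leaves this group only finitely often. -/
lemma exists_ae_finite_escapes [Nonempty ι] [Nonempty κ] (hm : 1 ≤ m)
    (hlab : ∀ C, IsClosest P (lab C) C) (hM : ∀ i, ‖P i‖ ≤ M) (hM0 : 0 < M)
    (hC₀ : ∀ r, ‖C₀ r‖ ≤ M) (hη : ∀ t, 0 < η t) (hη1 : ∀ t, η t ≤ 1) (hηa : Antitone η)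
    (hη0 : Filter.Tendsto η Filter.atTop (nhds 0)) (hB : IsUniformSampling μ B) :
    ∃ ρ > 0, ∃ h₀ > 0, ∀ (A : Finset (ι → κ)) (hA : A.Nonempty) (v : ℝ),
      (∀ a ∈ A, labelVal P a = v) →
      (∀ a, IsSelfConsistent P a → labelVal P a = v → a ∈ A) → ∀ L : ℝ,
      ∀ᵐ ω ∂μ, ∀ T, (∀ t ≥ T, groupDev P A hA (labelIter P lab η C₀ (samplePath B ω) t) < ρ ∧
        v + groupDev P A hA (labelIter P lab η C₀ (samplePath B ω) t) -
          labelCost P (lab (labelIter P lab η C₀ (samplePath B ω) t))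
            (labelIter P lab η C₀ (samplePath B ω) t) < h₀) →
        ∀ᶠ t in Filter.atTop,
          v + groupDev P A hA (labelIter P lab η C₀ (samplePath B ω) t) -
            labelCost P (lab (labelIter P lab η C₀ (samplePath B ω) t))
              (labelIter P lab η C₀ (samplePath B ω) t) ≤ L * η (t + 1) →
          lab (labelIter P lab η C₀ (samplePath B ω) t) ∈ A := by
  classical
  obtain ⟨ρ, hρ, h₀, hh₀, l, hl, c, hc, η₀, hη₀, hc1, hdrift⟩ :=
    exists_escape_drift (κ := κ) hm hM0 hM
  refine ⟨ρ, hρ, h₀, hh₀, fun A hA v hAv hAin L => ?_⟩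
  obtain ⟨T₀, hT₀⟩ := Filter.eventually_atTop.1 (hη0.eventually_lt_const hη₀)
  set H : (κ → V) → ℝ := fun C => v + groupDev P A hA C - labelCost P (lab C) C with hH
  have hHnn : ∀ C, 0 ≤ H C := by
    intro C
    obtain ⟨b, hb, hbe⟩ := A.exists_mem_eq_inf' hA fun a => labelDev P a C
    have h7 : groupDev P A hA C = labelDev P b C := hbe
    have h8 := (hlab C).labelCost_le b
    rw [labelCost_eq (a := b), hAv b hb] at h8
    simp only [hH, h7]
    linarith
  have hHzero : ∀ C, lab C ∈ A → H C = 0 := by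
    intro C hC
    refine le_antisymm ?_ (hHnn C)
    have := groupDev_le (P := P) (hA := hA) (C := C) hC
    simp only [hH, labelCost_eq, hAv _ hC]
    linarith
  set Z : (ℕ → Fin m → ι) → ℕ → κ → V := fun w t => labelIter P lab η C₀ w t with hZ
  have hmain : ∀ T ≥ T₀, ∀ᵐ ω ∂μ,
      (∀ t ≥ T, groupDev P A hA (Z (samplePath B ω) t) < ρ ∧ H (Z (samplePath B ω) t) < h₀) →
      ∀ᶠ t in Filter.atTop, H (Z (samplePath B ω) t) ≤ L * η (t + 1) →
        lab (Z (samplePath B ω) t) ∈ A := by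
    intro T hT
    set R : ℕ → (ℕ → Fin m → ι) → Prop := fun t w => ∀ u, T ≤ u → u ≤ t →
      groupDev P A hA (Z w u) < ρ ∧ H (Z w u) < h₀ with hR
    have hZdep : ∀ t u, u ≤ t → DependsOn (fun w => Z w u) (Set.Iio t) := fun t u hut =>
      (dependsOn_labelIter P lab η C₀ u).mono (Set.Iio_subset_Iio hut)
    have hRdep : ∀ t, DependsOn (R t) (Set.Iio t) := by
      intro t w w' hw
      simp only [hR, eq_iff_iff]
      refine forall_congr' fun u => imp_congr_right fun _ => imp_congr_right fun hu => ?_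
      have := hZdep t u hu hw
      simp only at this
      rw [this]
    have hnext : ∀ t ≥ T, ∀ w,
        avg (fun s => if R (t + 1) (Function.update w t s) then
          Real.exp (-(l * H (Z (Function.update w t s) (t + 1)) / η (t + 1))) else 0) ≤
        if R t w then
          Real.exp (-(l * H (Z w t) / η t)) -
            (if lab (Z w t) ∈ A then 0 else Real.exp (-(l * H (Z w t) / η (t + 1))) * c) else 0 := by
      intro t ht w
      split_ifs with hRt hA'
      · rw [hHzero _ hA', mul_zero, zero_div, neg_zero, Real.exp_zero, sub_zero]
        refine (avg_mono (g := fun _ => 1) fun s => ?_).trans_eq (avg_const 1)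
        split_ifs
        · rw [Real.exp_le_one_iff, neg_nonpos]
          exact div_nonneg (mul_nonneg hl.le (hHnn _)) (hη _).le
        · exact zero_le_one
      · have hd := hdrift lab hlab A hA v hAv hAin (Z w t)
          (norm_labelIter_le hM hM0.le hC₀ hη hη1 w t) hA' (hRt t ht le_rfl).1 (hRt t ht le_rfl).2
          (η (t + 1)) (hη _) (hη1 _) (hT₀ (t + 1) (by omega)).le
        have hmono : Real.exp (-(l * H (Z w t) / η (t + 1))) ≤
            Real.exp (-(l * H (Z w t) / η t)) := by
          apply Real.exp_le_exp.2
          rw [neg_le_neg_iff]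
          have h1 := hηa (Nat.le_succ t)
          have h2 := hHnn (Z w t)
          have h3 := hη (t + 1)
          gcongr
        calc _ ≤ _ := avg_mono fun s => ?_
          _ ≤ _ := hd
          _ ≤ _ := by linarith
        have hs : Z (Function.update w t s) (t + 1) =
            batchStep P (lab (Z w t)) (η (t + 1)) s (Z w t) := labelIter_update w t s
        rw [hs]
        split_ifs
        · exact le_rfl
        · positivity
      · refine (avg_mono (g := fun _ => 0) fun s => ?_).trans_eq (avg_const 0)
        rw [if_neg]
        intro hR1
        refine hRt fun u hu hut => ?_
        have h1 := hR1 u hu (by omega)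
        have h2 : Z (Function.update w t s) u = Z w u := labelIter_update_of_le w hut s
        rwa [h2] at h1
    have h := ae_eventually_not_of_avg_le hB
      (U := fun t w => if R t w then Real.exp (-(l * H (Z w t) / η t)) else 0)
      (K := fun t w => R t w ∧ H (Z w t) ≤ L * η (t + 1) ∧ lab (Z w t) ∉ A)
      (c := Real.exp (-(l * L)) * c) (by positivity) T ?_ ?_ ?_ ?_ ?_ ?_
    · filter_upwards [h] with ω hω hreg
      filter_upwards [hω] with t ht hHt
      by_contra hnot
      exact ht ⟨fun u hu _ => hreg u hu, hHt, hnot⟩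
    · intro t w w' hw
      have := hZdep t t le_rfl hw
      simp only at this
      simp only [hRdep t hw, this]
    · intro t w w' hw
      have := hZdep t t le_rfl hw
      simp only at this
      simp only [hRdep t hw, this]
    · intro t w
      split_ifs
      · positivity
      · exact le_rfl
    · intro t w
      split_ifs
      · rw [Real.exp_le_one_iff, neg_nonpos]
        exact div_nonneg (mul_nonneg hl.le (hHnn _)) (hη _).le
      · exact zero_le_one
    · intro t ht w
      refine (hnext t ht w).trans ?_
      split_ifs
      · simp
      · have : 0 ≤ Real.exp (-(l * H (Z w t) / η (t + 1))) * c := by positivity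
        linarith
      · exact le_rfl
    · intro t ht w ⟨hRt, hHt, hA'⟩
      refine (hnext t ht w).trans ?_
      rw [if_pos hRt, if_pos hRt, if_neg hA']
      have : Real.exp (-(l * L)) ≤ Real.exp (-(l * H (Z w t) / η (t + 1))) := by
        apply Real.exp_le_exp.2
        rw [neg_le_neg_iff, div_le_iff₀ (hη _), mul_assoc]
        gcongr
      have : Real.exp (-(l * L)) * c ≤ Real.exp (-(l * H (Z w t) / η (t + 1))) * c := by gcongr
      linarith
  have hall : ∀ᵐ ω ∂μ, ∀ T ≥ T₀,
      (∀ t ≥ T, groupDev P A hA (Z (samplePath B ω) t) < ρ ∧ H (Z (samplePath B ω) t) < h₀) →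
      ∀ᶠ t in Filter.atTop, H (Z (samplePath B ω) t) ≤ L * η (t + 1) →
        lab (Z (samplePath B ω) t) ∈ A := by
    rw [ae_all_iff]
    intro T
    by_cases hT : T ≥ T₀
    · filter_upwards [hmain T hT] with ω hω _ using hω
    · exact Filter.Eventually.of_forall fun ω h => absurd h hT
  filter_upwards [hall] with ω hω T hreg
  exact hω (max T T₀) (le_max_right _ _) fun t ht => hreg t (le_trans (le_max_left _ _) ht)

end SamplePaths

/-! ### Convergence along a path -/

section Path

open Filter Topology

/-- If the steps of a sequence are controlled by `η` and `∑ η D < ∞` while `∑ η = ∞`, then every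
late term is close to an earlier (but still late) term at which `D` is small. -/
lemma exists_close_small {E : Type*} [PseudoMetricSpace E] {z : ℕ → E} {D η : ℕ → ℝ} {L : ℝ}
    (hL : 0 ≤ L) (hη : ∀ t, 0 < η t) (hη0 : Tendsto η atTop (𝓝 0))
    (hdiv : ¬ Summable fun t => η (t + 1)) (hsum : Summable fun t => η (t + 1) * D t)
    (hD : ∀ t, 0 ≤ D t) (hz : ∀ t, dist (z (t + 1)) (z t) ≤ L * η (t + 1))
    {ε ε' : ℝ} (hε : 0 < ε) (hε' : 0 < ε') (N : ℕ) :
    ∃ T ≥ N, ∀ t ≥ T, ∃ u, T ≤ u ∧ u ≤ t ∧ D u < ε' ∧ dist (z t) (z u) < ε := by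
  set f : ℕ → ℝ := fun t => η (t + 1) * D t with hf
  have hf0 : ∀ t, 0 ≤ f t := fun t => mul_nonneg (hη _).le (hD t)
  have htail : ∀ δ > 0, ∃ T₁, ∀ a ≥ T₁, ∀ b, ∑ v ∈ Finset.Ico a b, f v < δ := by
    intro δ hδ
    have h1 := hsum.hasSum.tendsto_sum_nat
    obtain ⟨T₁, hT₁⟩ := eventually_atTop.1 (h1.eventually_const_lt
      (show ∑' t, f t - δ < ∑' t, f t by linarith))
    refine ⟨T₁, fun a ha b => ?_⟩
    rcases le_total a b with hab | hab
    · rw [Finset.sum_Ico_eq_sub _ hab]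
      have := hT₁ a ha
      have h2 := hsum.sum_le_tsum (Finset.range b) fun t _ => hf0 t
      linarith
    · rw [Finset.Ico_eq_empty_of_le hab, Finset.sum_empty]; exact hδ
  have hsmall : ∀ N, ∃ t ≥ N, D t < ε' := by
    intro N
    by_contra hno
    push Not at hno
    apply hdiv
    rw [← summable_nat_add_iff N]
    refine Summable.of_nonneg_of_le (fun t => (hη _).le) (fun t => ?_)
      (((summable_nat_add_iff N).2 hsum).mul_left ε'⁻¹)
    rw [inv_mul_eq_div, le_div_iff₀ hε']
    exact mul_le_mul_of_nonneg_left (hno (t + N) (Nat.le_add_left _ _)) (hη _).le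
  obtain ⟨T₁, hT₁⟩ := htail (ε' * ε / (2 * (L + 1))) (by positivity)
  obtain ⟨T₂, hT₂⟩ := eventually_atTop.1 (hη0.eventually_lt_const
    (show 0 < ε / (2 * (L + 1)) by positivity))
  obtain ⟨T, hT, hTs⟩ := hsmall (max N (max T₁ T₂))
  refine ⟨T, (le_max_left _ _).trans hT, ?_⟩
  have key : ∀ t ≥ T, ∃ u, T ≤ u ∧ u ≤ t ∧ D u < ε' ∧
      dist (z t) (z u) ≤ L * η (u + 1) + L / ε' * ∑ v ∈ Finset.Ico (u + 1) t, f v := by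
    intro t ht
    induction t, ht using Nat.le_induction with
    | base =>
      refine ⟨T, le_rfl, le_rfl, hTs, ?_⟩
      rw [dist_self, Finset.Ico_eq_empty_of_le (Nat.le_succ _), Finset.sum_empty]
      have := (hη (T + 1)).le
      positivity
    | succ t ht ih =>
      by_cases hDt : D t < ε'
      · refine ⟨t, ht, Nat.le_succ _, hDt, ?_⟩
        rw [Finset.Ico_self, Finset.sum_empty, mul_zero, add_zero]
        exact hz t
      · push Not at hDt
        obtain ⟨u, hu1, hu2, hu3, hu4⟩ := ih
        have hut : u + 1 ≤ t := by
          rcases Nat.lt_or_eq_of_le hu2 with h | h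
          · exact h
          · subst h; exact absurd hDt (not_le.2 hu3)
        refine ⟨u, hu1, by omega, hu3, ?_⟩
        rw [Finset.sum_Ico_succ_top hut, mul_add]
        have h1 : L * η (t + 1) ≤ L / ε' * f t := by
          rw [div_mul_eq_mul_div, le_div_iff₀ hε', mul_assoc]
          have := (hη (t + 1)).le
          simp only [hf]
          gcongr
        linarith [dist_triangle (z (t + 1)) (z t) (z u), hz t]
  intro t ht
  obtain ⟨u, hu1, hu2, hu3, hu4⟩ := key t ht
  refine ⟨u, hu1, hu2, hu3, hu4.trans_lt ?_⟩
  have hTmax := (le_max_right N (max T₁ T₂)).trans hT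
  have h1 := hT₁ (u + 1) (by have := (le_max_left T₁ T₂).trans hTmax; omega) t
  have h2 := hT₂ (u + 1) (by have := (le_max_right T₁ T₂).trans hTmax; omega)
  have h3 : (L + 1) * η (u + 1) < ε / 2 := by
    rw [lt_div_iff₀ (by positivity)] at h2
    linarith
  have h4 : (L + 1) / ε' * ∑ v ∈ Finset.Ico (u + 1) t, f v < ε / 2 := by
    calc _ < (L + 1) / ε' * (ε' * ε / (2 * (L + 1))) := by gcongr
      _ = ε / 2 := by field_simp
  have h5 : L / ε' * ∑ v ∈ Finset.Ico (u + 1) t, f v ≤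
      (L + 1) / ε' * ∑ v ∈ Finset.Ico (u + 1) t, f v := by
    have : 0 ≤ ∑ v ∈ Finset.Ico (u + 1) t, f v := Finset.sum_nonneg fun v _ => hf0 v
    gcongr
    linarith
  nlinarith [hη (u + 1)]

/-- A sequence with vanishing steps that accumulates only at finitely many points converges. -/
lemma exists_tendsto_of_near_finset {V : Type*} [NormedAddCommGroup V] {z : ℕ → V} (F : Finset V)
    (hF : ∀ ε > 0, ∀ᶠ t in atTop, ∃ x ∈ F, ‖z t - x‖ < ε)
    (hz : Tendsto (fun t => ‖z (t + 1) - z t‖) atTop (𝓝 0)) : ∃ x, Tendsto z atTop (𝓝 x) := by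
  obtain ⟨g, hg, hsep⟩ := exists_pos_le_of_finite (α := F × F) (fun x => x.1.1 ≠ x.2.1)
    (fun x => ‖x.1.1 - x.2.1‖) (fun x hx => norm_pos_iff.2 (sub_ne_zero.2 hx))
  have huniq : ∀ x ∈ F, ∀ y ∈ F, ‖x - y‖ < g → x = y := by
    intro x hx y hy h
    by_contra hne
    exact absurd h (not_lt.2 (hsep (⟨x, hx⟩, ⟨y, hy⟩) hne))
  obtain ⟨N, hN⟩ := eventually_atTop.1 ((hF (g / 3) (by positivity)).and
    (hz.eventually_lt_const (show 0 < g / 3 by positivity)))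
  obtain ⟨x, hx, hxN⟩ := (hN N le_rfl).1
  have hstay : ∀ t ≥ N, ‖z t - x‖ < g / 3 := by
    intro t ht
    induction t, ht using Nat.le_induction with
    | base => exact hxN
    | succ t ht ih =>
      obtain ⟨y, hy, hyt⟩ := (hN (t + 1) (by omega)).1
      have h1 := (hN t ht).2
      have : y = x := huniq y hy x hx (by
        have e : y - x = -(z (t + 1) - y) + (z (t + 1) - z t) + (z t - x) := by abel
        rw [e]
        refine (norm_add₃_le).trans_lt ?_
        rw [norm_neg]
        linarith)
      rwa [this] at hyt
  refine ⟨x, ?_⟩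
  rw [Metric.tendsto_atTop]
  intro ε hε
  obtain ⟨N', hN'⟩ := eventually_atTop.1 (hF (min ε (g / 3)) (lt_min hε (by positivity)))
  refine ⟨max N N', fun t ht => ?_⟩
  obtain ⟨y, hy, hyt⟩ := hN' t ((le_max_right _ _).trans ht)
  have h1 := hstay t ((le_max_left _ _).trans ht)
  have h2 := hyt.trans_le (min_le_right _ _)
  have : y = x := huniq y hy x hx (by
    have e : y - x = -(z t - y) + (z t - x) := by abel
    rw [e]
    refine (norm_add_le _ _).trans_lt ?_
    rw [norm_neg]
    linarith)
  rw [dist_eq_norm, ← this]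
  exact hyt.trans_le (min_le_left _ _)

variable {ι κ V : Type*} [Fintype ι] [Fintype κ] [DecidableEq κ]
  [NormedAddCommGroup V] [InnerProductSpace ℝ V] {m : ℕ}
  {P : ι → V} {lab : (κ → V) → ι → κ} {η : ℕ → ℝ} {M : ℝ} {C : ℕ → κ → V} {s : ℕ → Fin m → ι}

/-- A path along which the deviations are summable against the learning rate, and along which no
group of self-consistent labellings is left infinitely often, ends up in one such group, with
vanishing deviation. -/
lemma eventually_selfConsistent (hlab : ∀ C, IsClosest P (lab C) C)
    (hM : ∀ i, ‖P i‖ ≤ M) (hM0 : 0 < M) (hC : ∀ t r, ‖C t r‖ ≤ M)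
    (hη : ∀ t, 0 < η t) (hη0 : Tendsto η atTop (𝓝 0)) (hη2 : ∀ t, η t ≤ 2 * η (t + 1))
    (hdiv : ¬ Summable fun t => η (t + 1))
    (hsum : Summable fun t => η (t + 1) * labelDev P (lab (C t)) (C t))
    (hmove : ∀ t r, ‖C (t + 1) r - C t r‖ ≤ 2 * M * η (t + 1))
    {ρ h₀ : ℝ} (hρ : 0 < ρ) (hh₀ : 0 < h₀)
    (hesc : ∀ (A : Finset (ι → κ)) (hA : A.Nonempty) (v : ℝ), (∀ a ∈ A, labelVal P a = v) →
      (∀ a, IsSelfConsistent P a → labelVal P a = v → a ∈ A) →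
      ∀ T, (∀ t ≥ T, groupDev P A hA (C t) < ρ ∧
        v + groupDev P A hA (C t) - labelCost P (lab (C t)) (C t) < h₀) →
        ∀ᶠ t in atTop, v + groupDev P A hA (C t) - labelCost P (lab (C t)) (C t) ≤
          32 * M ^ 2 * Fintype.card ι * η (t + 1) → lab (C t) ∈ A) :
    ∃ v, (∀ᶠ t in atTop, IsSelfConsistent P (lab (C t)) ∧ labelVal P (lab (C t)) = v) ∧
      Tendsto (fun t => labelDev P (lab (C t)) (C t)) atTop (𝓝 0) := by
  classical
  obtain ⟨ρ₀, hρ₀, hsc⟩ := exists_dev_isSelfConsistent P κ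
  obtain ⟨g, hg, hgap⟩ := exists_pos_le_of_finite (α := (ι → κ) × (ι → κ))
    (fun x => labelVal P x.1 ≠ labelVal P x.2) (fun x => |labelVal P x.1 - labelVal P x.2|)
    (fun x hx => abs_pos.2 (sub_ne_zero.2 hx))
  set n : ℝ := (Fintype.card ι : ℝ) with hn
  set D : ℕ → ℝ := fun t => labelDev P (lab (C t)) (C t) with hDdef
  have hD0 : ∀ t, 0 ≤ D t := fun t => labelDev_nonneg
  have hdist : ∀ t, dist (C (t + 1)) (C t) ≤ 2 * M * η (t + 1) := by
    intro t
    rw [dist_pi_le_iff (mul_nonneg (by positivity) (hη _).le)]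
    intro r
    rw [dist_eq_norm]
    exact hmove t r
  have hclose : ∀ {ε ε' : ℝ}, 0 < ε → 0 < ε' → ∀ N, ∃ T ≥ N, ∀ t ≥ T, ∃ u, T ≤ u ∧ u ≤ t ∧
      D u < ε' ∧ ∀ r, ‖C t r - C u r‖ ≤ ε := by
    intro ε ε' hε hε' N
    obtain ⟨T, hT, h⟩ := exists_close_small (by positivity) hη hη0 hdiv hsum hD0 hdist hε hε' N
    refine ⟨T, hT, fun t ht => ?_⟩
    obtain ⟨u, h1, h2, h3, h4⟩ := h t ht
    refine ⟨u, h1, h2, h3, fun r => ?_⟩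
    rw [← dist_eq_norm]
    exact (dist_le_pi_dist (C t) (C u) r).trans h4.le
  -- The minimal cost is Lipschitz.
  have hphi : ∀ t u e, (∀ r, ‖C t r - C u r‖ ≤ e) →
      labelCost P (lab (C u)) (C u) - labelCost P (lab (C t)) (C t) ≤ 4 * M * n * e := by
    intro t u e he
    have h1 := (hlab (C u)).labelCost_le (lab (C t))
    have h2 := abs_labelCost_sub_le (a := lab (C t)) hM0.le hM (hC u) (hC t) he
    linarith [(abs_le.1 h2).1]
  set e := min (min ρ h₀) (min ρ₀ g) with he
  have he0 : 0 < e := lt_min (lt_min hρ hh₀) (lt_min hρ₀ hg)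
  have heρ : e ≤ ρ := (min_le_left _ _).trans (min_le_left _ _)
  have heh : e ≤ h₀ := (min_le_left _ _).trans (min_le_right _ _)
  have heρ₀ : e ≤ ρ₀ := (min_le_right _ _).trans (min_le_left _ _)
  have heg : e ≤ g := (min_le_right _ _).trans (min_le_right _ _)
  set ε := e / (32 * M * (n + 1)) with hε
  have hn0 : 0 ≤ n := Nat.cast_nonneg _
  have hε0 : 0 < ε := by positivity
  have hLip : 4 * M * n * ε ≤ e / 8 := by
    have h1 : 4 * M * (n + 1) * ε = e / 8 := by rw [hε]; field_simp; norm_num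
    have h2 : 0 ≤ 4 * M * ε := by positivity
    linarith
  obtain ⟨N₀, hN₀⟩ := eventually_atTop.1 (hη0.eventually_lt_const
    (show 0 < ε / (2 * M) by positivity))
  obtain ⟨T, hTN, hT⟩ := hclose hε0 (show 0 < e / 4 by positivity) N₀
  set v := labelVal P (lab (C T)) with hv
  have hval : ∀ u ≥ T, D u < e / 4 → labelVal P (lab (C u)) = v := by
    intro u
    induction u using Nat.strong_induction_on with
    | _ u ih =>
      intro hu hDu
      rcases Nat.lt_or_eq_of_le hu with hlt | heq
      · obtain ⟨u', rfl⟩ : ∃ u', u = u' + 1 := ⟨u - 1, by omega⟩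
        obtain ⟨x, hx1, hx2, hx3, hx4⟩ := hT u' (by omega)
        have hx := ih x (by omega) hx1 hx3
        have hmv : ∀ r, ‖C (u' + 1) r - C x r‖ ≤ 2 * ε := by
          intro r
          have h1 := hN₀ (u' + 1) (by omega)
          rw [lt_div_iff₀ (by positivity)] at h1
          have h2 := hmove u' r
          have h3 := norm_sub_le_norm_sub_add_norm_sub (C (u' + 1) r) (C u' r) (C x r)
          linarith [hx4 r]
        have h1 := hphi _ _ _ hmv
        have h2 := hphi _ _ _ fun r => by rw [norm_sub_rev]; exact hmv r
        rw [labelCost_eq, labelCost_eq] at h1 h2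
        by_contra hne
        have h3 := hgap (lab (C (u' + 1)), lab (C x)) (by rw [hx]; exact hne)
        simp only at h3
        have h4 := hD0 x
        have h5 := hD0 (u' + 1)
        simp only [hDdef] at h4 h5 hx3 hDu
        rcases abs_cases (labelVal P (lab (C (u' + 1))) - labelVal P (lab (C x))) with
          ⟨h, _⟩ | ⟨h, _⟩ <;> linarith
      · rw [← heq]
  have hscu : ∀ u, D u < e / 4 → IsSelfConsistent P (lab (C u)) := fun u hu =>
    hsc _ _ (hlab _) (by simp only [hDdef] at hu; linarith)
  set A : Finset (ι → κ) := Finset.univ.filter fun a => IsSelfConsistent P a ∧ labelVal P a = v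
    with hAdef
  have hAmem : ∀ a, a ∈ A ↔ IsSelfConsistent P a ∧ labelVal P a = v := by
    intro a; simp [hAdef]
  have huA : ∀ u ≥ T, D u < e / 4 → lab (C u) ∈ A := fun u hu hDu =>
    (hAmem _).2 ⟨hscu u hDu, hval u hu hDu⟩
  have hA : A.Nonempty := by
    obtain ⟨u, h1, _, h3, _⟩ := hT T le_rfl
    exact ⟨_, huA u h1 h3⟩
  have hAv : ∀ a ∈ A, labelVal P a = v := fun a ha => ((hAmem a).1 ha).2
  have hzero : ∀ t, lab (C t) ∈ A →
      v + groupDev P A hA (C t) - labelCost P (lab (C t)) (C t) ≤ 0 := by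
    intro t ht
    have := groupDev_le (P := P) (hA := hA) (C := C t) ht
    rw [labelCost_eq, hAv _ ht]
    linarith
  have hreg : ∀ t ≥ T, groupDev P A hA (C t) < ρ ∧
      v + groupDev P A hA (C t) - labelCost P (lab (C t)) (C t) < h₀ := by
    intro t ht
    obtain ⟨u, hu1, hu2, hu3, hu4⟩ := hT t ht
    have h1 := groupDev_le_add (hA := hA) hM0.le hM (hC u) (hC t) hu4
    have h2 := groupDev_le (P := P) (hA := hA) (C := C u) (huA u hu1 hu3)
    have h3 := hzero u (huA u hu1 hu3)
    have h4 := hphi _ _ _ hu4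
    simp only [hDdef] at hu3
    rw [← hn] at h1
    constructor <;> linarith
  obtain ⟨T₁, hT₁⟩ := eventually_atTop.1 (hesc A hA v hAv (fun a h1 h2 => (hAmem a).2 ⟨h1, h2⟩)
    T hreg)
  obtain ⟨T₂, hT₂, hsm⟩ := hclose hε0 (show 0 < e / 4 by positivity) (max T T₁)
  obtain ⟨t₁, ht₁, _, ht₁D, _⟩ := hsm T₂ le_rfl
  have ht₁T : T ≤ t₁ := (le_max_left _ _).trans (hT₂.trans ht₁)
  have ht₁T₁ : T₁ ≤ t₁ := (le_max_right _ _).trans (hT₂.trans ht₁)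
  have hstay : ∀ t ≥ t₁, lab (C t) ∈ A := by
    intro t ht
    induction t, ht using Nat.le_induction with
    | base => exact huA t₁ ht₁T ht₁D
    | succ t ht ih =>
      refine hT₁ (t + 1) (by omega) ?_
      have h1 := groupDev_le_add (hA := hA) hM0.le hM (hC t) (hC (t + 1)) (hmove t)
      have h2 := hphi _ _ _ (hmove t)
      have h3 := hzero t ih
      have h4 := hη2 (t + 1)
      have h5 : 0 ≤ 16 * M ^ 2 * n := by positivity
      rw [← hn] at h1
      nlinarith
  refine ⟨v, eventually_atTop.2 ⟨t₁, fun t ht => (hAmem _).1 (hstay t ht)⟩, ?_⟩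
  rw [Metric.tendsto_atTop]
  intro δ hδ
  obtain ⟨T₃, hT₃, h⟩ := hclose (show 0 < δ / (8 * M * (n + 1)) by positivity)
    (show 0 < min (e / 4) (δ / 2) by positivity) t₁
  refine ⟨T₃, fun t ht => ?_⟩
  obtain ⟨u, hu1, hu2, hu3, hu4⟩ := h t ht
  have huT : lab (C u) ∈ A := huA u (ht₁T.trans (hT₃.trans hu1)) (hu3.trans_le (min_le_left _ _))
  have h2 := groupDev_le (P := P) (hA := hA) (C := C u) huT
  have h1 := groupDev_le_add (hA := hA) hM0.le hM (hC u) (hC t) hu4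
  have h3 : labelDev P (lab (C t)) (C t) ≤ groupDev P A hA (C t) := by
    refine (Finset.le_inf'_iff _ _).2 fun b hb => ?_
    have := (hlab (C t)).labelCost_le b
    rw [labelCost_eq, labelCost_eq, hAv _ hb, hAv _ (hstay t (hT₃.trans ht))] at this
    linarith
  have h4 := hu3.trans_le (min_le_right _ _)
  have h5 : 4 * M * n * (δ / (8 * M * (n + 1))) ≤ δ / 2 := by
    have h6 : 4 * M * (n + 1) * (δ / (8 * M * (n + 1))) = δ / 2 := by field_simp; norm_num
    have h7 : 0 ≤ 4 * M * (δ / (8 * M * (n + 1))) := by positivity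
    linarith
  rw [Real.dist_0_eq_abs, abs_of_nonneg labelDev_nonneg]
  simp only [hDdef] at h4
  linarith

lemma exists_tendsto_centroids (hD : Tendsto (fun t => labelDev P (lab (C t)) (C t)) atTop (𝓝 0))
    (hmove : ∀ t r, ‖C (t + 1) r - C t r‖ ≤ 2 * M * η (t + 1)) (hη0 : Tendsto η atTop (𝓝 0))
    (hunused : ∀ t r, (∀ i, lab (C t) i ≠ r) → C (t + 1) r = C t r) :
    ∃ Cs : κ → V, Tendsto C atTop (𝓝 Cs) := by
  classical
  have hmv : ∀ r, Tendsto (fun t => ‖C (t + 1) r - C t r‖) atTop (𝓝 0) := by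
    intro r
    have h1 : Tendsto (fun t => 2 * M * η (t + 1)) atTop (𝓝 0) := by
      simpa using ((tendsto_add_atTop_iff_nat 1).2 hη0).const_mul (2 * M)
    exact squeeze_zero (fun t => norm_nonneg _) (fun t => hmove t r) h1
  have h : ∀ r, ∃ x, Tendsto (fun t => C t r) atTop (𝓝 x) := by
    intro r
    by_cases hfr : ∃ᶠ t in atTop, ∃ i, lab (C t) i = r
    · refine exists_tendsto_of_near_finset
        (Finset.univ.image fun a : ι → κ => labelMean P a r) (fun ε hε => ?_) (hmv r)
      obtain ⟨N, hN⟩ := eventually_atTop.1 ((hD.eventually_lt_const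
        (show (0 : ℝ) < (ε / 2) ^ 2 by positivity)).and
          ((hmv r).eventually_lt_const (show 0 < ε / 2 by positivity)))
      have hused : ∀ t ≥ N, (∃ i, lab (C t) i = r) →
          ‖C t r - labelMean P (lab (C t)) r‖ < ε / 2 := by
        rintro t ht ⟨i, rfl⟩
        exact norm_sub_mean_lt (by positivity) (hN t ht).1 i
      obtain ⟨t₁, ht₁, hu⟩ := frequently_atTop.1 hfr N
      refine eventually_atTop.2 ⟨t₁, fun t ht => ?_⟩
      induction t, ht using Nat.le_induction with
      | base =>
        exact ⟨labelMean P (lab (C t₁)) r, by simp, by linarith [hused t₁ ht₁ hu]⟩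
      | succ t ht ih =>
        by_cases hut : ∃ i, lab (C t) i = r
        · refine ⟨labelMean P (lab (C t)) r, by simp, ?_⟩
          have h1 := hused t (ht₁.trans ht) hut
          have h2 := (hN t (ht₁.trans ht)).2
          have h3 := norm_sub_le_norm_sub_add_norm_sub (C (t + 1) r) (C t r)
            (labelMean P (lab (C t)) r)
          linarith
        · rw [hunused t r (not_exists.1 hut)]
          exact ih
    · rw [not_frequently] at hfr
      obtain ⟨N, hN⟩ := eventually_atTop.1 hfr
      refine ⟨C N r, tendsto_const_nhds.congr' (eventually_atTop.2 ⟨N, fun t ht => ?_⟩)⟩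
      induction t, ht using Nat.le_induction with
      | base => rfl
      | succ t ht ih =>
        change C N r = C (t + 1) r
        rw [hunused t r (not_exists.1 (hN t ht))]
        exact ih
  choose Cs hCs using h
  exact ⟨Cs, tendsto_pi_nhds.2 hCs⟩

end Path

/-! ### Labellings at the limit -/

section Limit

open Filter Topology

variable {ι κ V : Type*} [Fintype ι] [Fintype κ] [DecidableEq κ]
  [NormedAddCommGroup V] [InnerProductSpace ℝ V] {m : ℕ}
  {P : ι → V} {a b : ι → κ} {Cs : κ → V}

/-- The labelling `a` is optimal for the centroids `Cs`, each centroid in use is the mean of its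
cell, and no point of a cell is equally close to another centroid in use. -/
structure IsLimitLabelling (P : ι → V) (Cs : κ → V) (a : ι → κ) : Prop where
  closest : IsClosest P a Cs
  eq_mean : ∀ i, Cs (a i) = labelMean P a (a i)
  strict : IsStrict P a

/-- Two limit labellings that use the same centroid give it the same cell. -/
lemma IsLimitLabelling.consistent (ha : IsLimitLabelling P Cs a) (hb : IsLimitLabelling P Cs b)
    {i j : ι} {r : κ} (hi : a i = r) (hj : b j = r) : b i = r := by
  by_contra hne
  have h1 := hb.strict i j (by rw [hj]; exact fun h => hne h.symm)
  rw [← hb.eq_mean, ← hb.eq_mean, hj, ← hi] at h1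
  exact absurd (ha.closest i (b i)) (not_le.2 h1)

/-- The points that carry the label `r` in some limit labelling. -/
noncomputable def limitCell (P : ι → V) (Cs : κ → V) (r : κ) : Finset ι := by
  classical exact Finset.univ.filter fun i => ∃ a, IsLimitLabelling P Cs a ∧ a i = r

lemma IsLimitLabelling.cell_eq (ha : IsLimitLabelling P Cs a) (j : ι) :
    Finset.univ.filter (fun i => a i = a j) = limitCell P Cs (a j) := by
  classical
  ext i
  simp only [limitCell, Finset.mem_filter, Finset.mem_univ, true_and]
  exact ⟨fun h => ⟨a, ha, h⟩, fun ⟨b, hb, h⟩ => hb.consistent ha h rfl⟩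

/-- The deviation from the limit of the centroids not in use, weighted by the sizes of the cells
that they have when they are in use. -/
noncomputable def frozenDev (P : ι → V) (Cs : κ → V) (a : ι → κ) (C : κ → V) : ℝ := by
  classical exact ∑ r, if ∃ i, a i = r then 0 else (limitCell P Cs r).card * ‖C r - Cs r‖ ^ 2

lemma frozenDev_nonneg {C : κ → V} : 0 ≤ frozenDev P Cs a C := by
  refine Finset.sum_nonneg fun r _ => ?_
  split_ifs <;> positivity

lemma frozenDev_add_labelDev (ha : IsLimitLabelling P Cs a) (C : κ → V) :
    frozenDev P Cs a C + labelDev P a C = ∑ r, (limitCell P Cs r).card * ‖C r - Cs r‖ ^ 2 := by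
  classical
  have h1 : labelDev P a C = ∑ i, ‖C (a i) - Cs (a i)‖ ^ 2 :=
    Finset.sum_congr rfl fun i _ => by rw [ha.eq_mean]
  rw [h1, sum_label_eq (fun r _ => ‖C r - Cs r‖ ^ 2) a, frozenDev, ← Finset.sum_add_distrib]
  refine Finset.sum_congr rfl fun r _ => ?_
  rw [Finset.sum_const, nsmul_eq_mul]
  split_ifs with h
  · obtain ⟨j, rfl⟩ := h
    rw [ha.cell_eq, zero_add]
  · have : Finset.univ.filter (fun i => a i = r) = ∅ := by
      rw [Finset.filter_eq_empty_iff]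
      exact fun i _ hi => h ⟨i, hi⟩
    rw [this, Finset.card_empty, Nat.cast_zero, zero_mul, add_zero]

lemma eq_limit_of_frozenDev_eq_zero {C : κ → V} (h : frozenDev P Cs a C = 0) {r : κ}
    (hr : ∀ i, a i ≠ r) (hb : IsLimitLabelling P Cs b) {j : ι} (hj : b j = r) : C r = Cs r := by
  classical
  rw [frozenDev, Finset.sum_eq_zero_iff_of_nonneg (fun r _ => by split_ifs <;> positivity)] at h
  have h1 := h r (Finset.mem_univ r)
  rw [if_neg (by simpa using hr)] at h1
  have hpos : 0 < (limitCell P Cs r).card := Finset.card_pos.2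
    ⟨j, by simp only [limitCell, Finset.mem_filter, Finset.mem_univ, true_and]; exact ⟨b, hb, hj⟩⟩
  have h2 : ‖C r - Cs r‖ ^ 2 = 0 := by
    rcases mul_eq_zero.1 h1 with h | h
    · exact absurd (by exact_mod_cast h) hpos.ne'
    · exact h
  rw [sq_eq_zero_iff, norm_eq_zero, sub_eq_zero] at h2
  exact h2

variable {lab : (κ → V) → ι → κ} {η : ℕ → ℝ} {C : ℕ → κ → V} {s : ℕ → Fin m → ι}

lemma eventually_isLimitLabelling (hlab : ∀ C, IsClosest P (lab C) C)
    (hgen : ∀ a : ι → κ, IsSelfConsistent P a → IsStrict P a)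
    (hsc : ∀ᶠ t in atTop, IsSelfConsistent P (lab (C t)))
    (hD : Tendsto (fun t => labelDev P (lab (C t)) (C t)) atTop (𝓝 0))
    (hC : Tendsto C atTop (𝓝 Cs)) : ∀ᶠ t in atTop, IsLimitLabelling P Cs (lab (C t)) := by
  have hCr : ∀ r, Tendsto (fun t => C t r) atTop (𝓝 (Cs r)) := fun r => tendsto_pi_nhds.1 hC r
  have key : ∀ a : ι → κ, (∃ᶠ t in atTop, lab (C t) = a) → IsLimitLabelling P Cs a := by
    intro a hfr
    refine ⟨fun i r => ?_, fun i => ?_, ?_⟩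
    · refine le_of_tendsto_of_tendsto_of_frequently ((hCr (a i)).const_sub (P i)).norm
        ((hCr r).const_sub (P i)).norm (hfr.mono fun t ht => ?_)
      rw [← ht]
      exact hlab (C t) i r
    · have h1 : ‖Cs (a i) - labelMean P a (a i)‖ ^ 2 ≤ 0 := by
        refine le_of_tendsto_of_tendsto_of_frequently
          (((hCr (a i)).sub_const (labelMean P a (a i))).norm.pow 2) hD (hfr.mono fun t ht => ?_)
        rw [ht]
        exact norm_sq_le_labelDev i
      have h2 : ‖Cs (a i) - labelMean P a (a i)‖ = 0 := by
        rw [← sq_eq_zero_iff]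
        exact le_antisymm h1 (by positivity)
      exact sub_eq_zero.1 (norm_eq_zero.1 h2)
    · obtain ⟨t, ht, hts⟩ := (hfr.and_eventually hsc).exists
      exact ht ▸ hgen _ hts
  have h : ∀ a : ι → κ, ∀ᶠ t in atTop, lab (C t) = a → IsLimitLabelling P Cs a := by
    intro a
    by_cases hfr : ∃ᶠ t in atTop, lab (C t) = a
    · exact Eventually.of_forall fun t _ => key a hfr
    · exact (not_frequently.1 hfr).mono fun t ht h => absurd h ht
  filter_upwards [eventually_all.2 h] with t ht using ht _ rfl

/-- If the labellings along the path share their value and are eventually limit labellings, then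
the centroids not in use sit exactly at their limits: their weighted deviation does not decrease
and tends to zero. -/
lemma eventually_frozenDev_eq_zero (hlab : ∀ C, IsClosest P (lab C) C) {v : ℝ}
    (hval : ∀ᶠ t in atTop, labelVal P (lab (C t)) = v)
    (hlim : ∀ᶠ t in atTop, IsLimitLabelling P Cs (lab (C t)))
    (hC : Tendsto C atTop (𝓝 Cs))
    (hunused : ∀ t r, (∀ i, lab (C t) i ≠ r) → C (t + 1) r = C t r) :
    ∀ᶠ t in atTop, frozenDev P Cs (lab (C t)) (C t) = 0 := by
  classical
  obtain ⟨T, hT⟩ := eventually_atTop.1 (hval.and hlim)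
  set Z : ℕ → ℝ := fun t => frozenDev P Cs (lab (C t)) (C t) with hZ
  have hstep : ∀ t ≥ T, Z t ≤ Z (t + 1) := by
    intro t ht
    have h1 : Z t = frozenDev P Cs (lab (C t)) (C (t + 1)) := by
      simp only [hZ, frozenDev]
      refine Finset.sum_congr rfl fun r _ => ?_
      split_ifs with h
      · rfl
      · rw [hunused t r (not_exists.1 h)]
    have h2 := frozenDev_add_labelDev (hT t ht).2 (C (t + 1))
    have h3 := frozenDev_add_labelDev (hT (t + 1) (by omega)).2 (C (t + 1))
    have h4 := (hlab (C (t + 1))).labelCost_le (lab (C t))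
    rw [labelCost_eq, labelCost_eq, (hT t ht).1, (hT (t + 1) (by omega)).1] at h4
    rw [h1]
    simp only [hZ]
    linarith
  have hmono : ∀ t ≥ T, ∀ u ≥ t, Z t ≤ Z u := by
    intro t ht u hu
    induction u, hu using Nat.le_induction with
    | base => exact le_rfl
    | succ u hu ih => exact ih.trans (hstep u (ht.trans hu))
  have hlim0 : Tendsto (fun t => ∑ r, ((limitCell P Cs r).card : ℝ) * ‖C t r - Cs r‖ ^ 2) atTop
      (𝓝 0) := by
    have : Tendsto (fun t => ∑ r, ((limitCell P Cs r).card : ℝ) * ‖C t r - Cs r‖ ^ 2) atTop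
        (𝓝 (∑ r, ((limitCell P Cs r).card : ℝ) * ‖Cs r - Cs r‖ ^ 2)) :=
      tendsto_finsetSum _ fun r _ =>
        (((tendsto_pi_nhds.1 hC r).sub_const (Cs r)).norm.pow 2).const_mul _
    simpa using this
  refine eventually_atTop.2 ⟨T, fun t ht => le_antisymm ?_ frozenDev_nonneg⟩
  refine ge_of_tendsto hlim0 (eventually_atTop.2 ⟨t, fun u hu => ?_⟩)
  refine (hmono t ht u hu).trans ?_
  rw [← frozenDev_add_labelDev (hT u (ht.trans hu)).2]
  linarith [labelDev_nonneg (P := P) (a := lab (C u)) (C := C u)]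

/-- The point `z` has at time `t` a label that was not in use just before, and it differs from its
centroid. -/
def HasFreshLabel (P : ι → V) (lab : (κ → V) → ι → κ) (C : ℕ → κ → V) (z : ι) (t : ℕ) : Prop :=
  1 ≤ t ∧ (∀ i, lab (C (t - 1)) i ≠ lab (C t) z) ∧ P z ≠ C t (lab (C t) z)

/-- Once the centroids not in use sit at their limits, a fresh label cannot be followed by a
mini-batch that is concentrated at a point with this label: the step would move the centroid off
the mean of its cell, while the cell could still be served at its old cost by the centroids that
were in use before. -/
lemma not_const_batch_of_hasFreshLabel (hm : 1 ≤ m) (hη : ∀ t, 0 < η t)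
    (hlab : ∀ C, IsClosest P (lab C) C)
    (hC : ∀ t, C (t + 1) = batchStep P (lab (C t)) (η (t + 1)) (s t) (C t)) {t : ℕ}
    (hlim : ∀ u ≥ t, IsLimitLabelling P Cs (lab (C u)))
    (hfr : ∀ u ≥ t, frozenDev P Cs (lab (C u)) (C u) = 0) {z : ι}
    (hz : HasFreshLabel P lab C z (t + 1)) : s (t + 1) ≠ fun _ => z := by
  intro hs
  obtain ⟨-, hz1, hz2⟩ := hz
  rw [Nat.add_sub_cancel] at hz1
  have hl0 := hlim t le_rfl
  have hl1 := hlim (t + 1) (by omega)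
  have hl2 := hlim (t + 2) (by omega)
  set a := lab (C t) with ha
  set b := lab (C (t + 1)) with hb
  set q := b z with hq
  have hCq : C (t + 1) q = Cs q := by
    rw [hC t, batchStep_of_unused hz1]
    exact eq_limit_of_frozenDev_eq_zero (hfr t le_rfl) hz1 hl1 rfl
  have hC2 : C (t + 2) = batchStep P b (η (t + 2)) (fun _ : Fin m => z) (C (t + 1)) := by
    rw [← hs]; exact hC (t + 1)
  have hCq2 : C (t + 2) q ≠ Cs q := by
    rw [hC2, hq, batchStep_const hm, ← hq, hCq]
    intro h
    have h1 : η (t + 2) • (P z - Cs q) = 0 := by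
      have : η (t + 2) • (P z - Cs q) = ((1 - η (t + 2)) • Cs q + η (t + 2) • P z) - Cs q := by
        module
      rw [this, h, sub_self]
    rcases smul_eq_zero.1 h1 with h2 | h2
    · exact (hη _).ne' h2
    · rw [sub_eq_zero, ← hCq] at h2
      exact hz2 h2
  have hused : ∃ j, lab (C (t + 2)) j = q := by
    by_contra hno
    exact hCq2 (eq_limit_of_frozenDev_eq_zero (hfr (t + 2) (by omega)) (not_exists.1 hno) hl1 rfl)
  obtain ⟨j, hj⟩ := hused
  have hpt : ∀ i ∈ Finset.univ.filter (fun i => b i = q), ‖P i - C (t + 2) q‖ ^ 2 ≤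
      ‖P i - labelMean P b q‖ ^ 2 := by
    intro i hi
    have hbi : b i = q := (Finset.mem_filter.1 hi).2
    have h1 : lab (C (t + 2)) i = q := hl1.consistent hl2 hbi hj
    have h2 : ∀ l, b l ≠ a i := by
      intro l hl
      have := hl0.consistent hl1 (rfl : a i = a i) hl
      rw [hbi] at this
      exact hz1 i this.symm
    have h3 : C (t + 2) (a i) = Cs (a i) := by
      rw [hC2, batchStep_of_unused h2]
      exact eq_limit_of_frozenDev_eq_zero (hfr (t + 1) (by omega)) h2 hl0 rfl
    have h4 := hlab (C (t + 2)) i (a i)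
    rw [h1, h3] at h4
    have h5 := hl0.closest i q
    have h6 : labelMean P b q = Cs q := by rw [← hbi, hl1.eq_mean]
    rw [h6]
    have := h4.trans h5
    gcongr
  have hsum := Finset.sum_le_sum hpt
  rw [sum_cell_sq, add_le_iff_nonpos_right, Finset.sum_const, nsmul_eq_mul] at hsum
  have hpos : (0 : ℝ) < (Finset.univ.filter (fun i => b i = q)).card := by
    exact_mod_cast cell_card_pos z
  have h6 : labelMean P b q = Cs q := by rw [hq, hl1.eq_mean]
  rw [h6] at hsum
  have h7 : 0 < ‖C (t + 2) q - Cs q‖ := norm_pos_iff.2 (sub_ne_zero.2 hCq2)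
  have : 0 < (Finset.univ.filter (fun i => b i = q)).card * ‖C (t + 2) q - Cs q‖ ^ 2 := by
    positivity
  linarith

/-- If no point gets a fresh label off its centroid, then the cells do not change. -/
lemma label_eq_iff_of_not_hasFreshLabel (hP : Function.Injective P)
    (hunused : ∀ t r, (∀ i, lab (C t) i ≠ r) → C (t + 1) r = C t r) {t : ℕ}
    (hlim : ∀ u ≥ t, IsLimitLabelling P Cs (lab (C u)))
    (hfr : ∀ u ≥ t, frozenDev P Cs (lab (C u)) (C u) = 0)
    (hJ : ∀ z, ¬ HasFreshLabel P lab C z (t + 1)) (i j : ι) :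
    lab (C (t + 1)) i = lab (C (t + 1)) j ↔ lab (C t) i = lab (C t) j := by
  have hl0 := hlim t le_rfl
  have hl1 := hlim (t + 1) (by omega)
  have hJ' : ∀ z, (∀ l, lab (C t) l ≠ lab (C (t + 1)) z) →
      P z = C (t + 1) (lab (C (t + 1)) z) := by
    intro z hz
    by_contra hne
    exact hJ z ⟨by omega, by rwa [Nat.add_sub_cancel], hne⟩
  set a := lab (C t) with ha
  set b := lab (C (t + 1)) with hb
  constructor
  · intro hij
    by_contra hne
    have hq : ∀ l, a l ≠ b i := by
      intro l hl
      have h1 := hl1.consistent hl0 (rfl : b i = b i) hl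
      have h2 := hl1.consistent hl0 hij.symm hl
      exact hne (h1.trans h2.symm)
    have h1 := hJ' i hq
    have h2 := hJ' j (by rw [← hij]; exact hq)
    rw [← hij, ← h1] at h2
    exact hne (by rw [hP h2])
  · intro hij
    by_contra hne
    have hr : ∀ l, b l ≠ a i := by
      intro l hl
      have h1 := hl0.consistent hl1 (rfl : a i = a i) hl
      have h2 := hl0.consistent hl1 hij.symm hl
      exact hne (h1.trans h2.symm)
    have hpt : ∀ x, a x = a i → P x = Cs (a i) := by
      intro x hx
      have hq : ∀ l, a l ≠ b x := by
        intro l hl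
        have h1 := hl1.consistent hl0 (rfl : b x = b x) hl
        exact hr x (by rw [← h1, hx])
      have h1 := hJ' x hq
      rw [hunused t _ hq, eq_limit_of_frozenDev_eq_zero (hfr t le_rfl) hq hl1 rfl] at h1
      have h2 := hl0.closest x (b x)
      rw [← h1, sub_self, norm_zero, hx] at h2
      exact sub_eq_zero.1 (norm_le_zero_iff.1 h2)
    exact hne (by rw [hP ((hpt i rfl).trans (hpt j hij.symm).symm)])

end Limit

/-! ### Stability of the clustering and the rate -/

section Convergence

open Filter Topology

variable {ι κ V : Type*} [Fintype ι] [Fintype κ] [DecidableEq κ]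
  [NormedAddCommGroup V] [InnerProductSpace ℝ V] {m : ℕ}
  {P : ι → V} {lab : (κ → V) → ι → κ} {η : ℕ → ℝ} {C₀ : κ → V} {M : ℝ}
  {Ω : Type*} [MeasurableSpace ι] [MeasurableSingletonClass ι] [MeasurableSpace Ω]
  {μ : Measure Ω} [IsProbabilityMeasure μ] {B : ℕ → Ω → Fin m → ι}

/-- Independent uniform points, grouped into mini-batches, are a uniform sampling of
mini-batches. -/
lemma isUniformSampling_batches [Nonempty ι] {S : ℕ → Fin m → Ω → ι}
    (hSmeas : ∀ t j, Measurable (S t j))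
    (hSindep : iIndepFun (fun (p : ℕ × Fin m) => S p.1 p.2) μ)
    (hSunif : ∀ t j (x : ι), μ (S t j ⁻¹' {x}) = (Fintype.card ι : ENNReal)⁻¹) :
    IsUniformSampling μ fun t ω j => S t j ω := by
  classical
  refine ⟨fun t => measurable_pi_lambda _ fun j => hSmeas t j, fun t h => ?_⟩
  have h1 := hSindep.measure_inter_preimage_eq_mul (Finset.range t ×ˢ Finset.univ)
    (sets := fun p => {extendHistory h p.1 p.2}) fun p _ => measurableSet_singleton _
  have h2 : {ω | ∀ i : Fin t, (fun j => S i j ω) = h i} =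
      ⋂ p ∈ Finset.range t ×ˢ (Finset.univ : Finset (Fin m)),
        S p.1 p.2 ⁻¹' {extendHistory h p.1 p.2} := by
    ext ω
    simp only [Set.mem_ofPred_eq, Set.mem_iInter, Finset.mem_product, Finset.mem_range,
      Finset.mem_univ, and_true, Set.mem_preimage, Set.mem_singleton_iff, Prod.forall]
    constructor
    · intro hω i j hi
      rw [extendHistory, dif_pos hi, ← hω ⟨i, hi⟩]
    · intro hω i
      funext j
      rw [hω i j i.2, extendHistory, dif_pos i.2]
  rw [h2, measureReal_def, h1]
  simp only [hSunif, Finset.prod_const, Finset.card_product, Finset.card_range, Finset.card_univ,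
    Fintype.card_fin, Fintype.card_fun, ENNReal.toReal_pow, ENNReal.toReal_inv,
    ENNReal.toReal_natCast]
  push_cast
  rw [← inv_pow, ← pow_mul, mul_comm m t]

/-- Almost surely, the cells eventually do not change, and the labelling is self-consistent. -/
lemma ae_eventually_stable [Nonempty ι] [Nonempty κ] (hP : Function.Injective P) (hm : 1 ≤ m)
    (hlab : ∀ C, IsClosest P (lab C) C)
    (hgen : ∀ a : ι → κ, IsSelfConsistent P a → IsStrict P a)
    (hM : ∀ i, ‖P i‖ ≤ M) (hM0 : 0 < M) (hC₀ : ∀ r, ‖C₀ r‖ ≤ M)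
    (hη : ∀ t, 0 < η t) (hη1 : ∀ t, η t ≤ 1) (hηa : Antitone η)
    (hη2 : ∀ t, η t ≤ 2 * η (t + 1)) (hη0 : Tendsto η atTop (𝓝 0))
    (hdiv : ¬ Summable fun t => η (t + 1)) (hηsq : Summable fun t => η (t + 1) ^ 2)
    (hB : IsUniformSampling μ B) :
    ∀ᵐ ω ∂μ, ∃ T, ∀ t ≥ T,
      IsSelfConsistent P (lab (labelIter P lab η C₀ (samplePath B ω) t)) ∧
      ∀ i j, lab (labelIter P lab η C₀ (samplePath B ω) t) i =
          lab (labelIter P lab η C₀ (samplePath B ω) t) j ↔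
        lab (labelIter P lab η C₀ (samplePath B ω) T) i =
          lab (labelIter P lab η C₀ (samplePath B ω) T) j := by
  classical
  obtain ⟨ρ, hρ, h₀, hh₀, hesc⟩ :=
    exists_ae_finite_escapes hm hlab hM hM0 hC₀ hη hη1 hηa hη0 hB
  -- Only finitely many groups of labellings occur, so one null set serves all of them.
  have hesc' : ∀ᵐ ω ∂μ, ∀ (A : Finset (ι → κ)) (b : ι → κ) (hA : A.Nonempty),
      (∀ a ∈ A, labelVal P a = labelVal P b) →
      (∀ a, IsSelfConsistent P a → labelVal P a = labelVal P b → a ∈ A) →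
      ∀ T, (∀ t ≥ T, groupDev P A hA (labelIter P lab η C₀ (samplePath B ω) t) < ρ ∧
        labelVal P b + groupDev P A hA (labelIter P lab η C₀ (samplePath B ω) t) -
          labelCost P (lab (labelIter P lab η C₀ (samplePath B ω) t))
            (labelIter P lab η C₀ (samplePath B ω) t) < h₀) →
        ∀ᶠ t in Filter.atTop,
          labelVal P b + groupDev P A hA (labelIter P lab η C₀ (samplePath B ω) t) -
            labelCost P (lab (labelIter P lab η C₀ (samplePath B ω) t))
              (labelIter P lab η C₀ (samplePath B ω) t) ≤
                32 * M ^ 2 * Fintype.card ι * η (t + 1) →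
          lab (labelIter P lab η C₀ (samplePath B ω) t) ∈ A := by
    rw [ae_all_iff]
    intro A
    rw [ae_all_iff]
    intro b
    by_cases h : A.Nonempty ∧ (∀ a ∈ A, labelVal P a = labelVal P b) ∧
        (∀ a, IsSelfConsistent P a → labelVal P a = labelVal P b → a ∈ A)
    · filter_upwards [hesc A h.1 (labelVal P b) h.2.1 h.2.2 (32 * M ^ 2 * Fintype.card ι)]
        with ω hω _ _ _ using hω
    · exact Eventually.of_forall fun ω hA h1 h2 => absurd ⟨hA, h1, h2⟩ h
  have hfresh : ∀ᵐ ω ∂μ, ∀ z : ι, ∀ T,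
      (∀ t ≥ T, HasFreshLabel P lab (labelIter P lab η C₀ (samplePath B ω)) z t →
        samplePath B ω t ≠ fun _ => z) →
      ∀ᶠ t in atTop, ¬ HasFreshLabel P lab (labelIter P lab η C₀ (samplePath B ω)) z t := by
    rw [ae_all_iff]
    intro z
    refine ae_eventually_not_of_not_draw hB
      (J := fun t w => HasFreshLabel P lab (labelIter P lab η C₀ w) z t) (fun t w w' hw => ?_) _
    have h1 := dependsOn_labelIter P lab η C₀ t hw
    have h2 := ((dependsOn_labelIter P lab η C₀ (t - 1)).mono
      (Set.Iio_subset_Iio (Nat.sub_le t 1))) hw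
    simp only at h1 h2
    simp only [HasFreshLabel, h1, h2]
  filter_upwards [hesc', hfresh, ae_summable_labelDev hm hlab hM hM0.le hC₀ hη hη1 hηsq hB]
    with ω h1 h2 h3
  set C := labelIter P lab η C₀ (samplePath B ω) with hCdef
  have hCstep : ∀ t, C (t + 1) = batchStep P (lab (C t)) (η (t + 1)) (samplePath B ω t) (C t) :=
    fun t => rfl
  have hunused : ∀ t r, (∀ i, lab (C t) i ≠ r) → C (t + 1) r = C t r := fun t r hr => by
    rw [hCstep, batchStep_of_unused hr]
  have hmove : ∀ t r, ‖C (t + 1) r - C t r‖ ≤ 2 * M * η (t + 1) :=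
    labelIter_move hM hM0.le hC₀ hη hη1 _
  obtain ⟨v, hv, hD⟩ := eventually_selfConsistent hlab hM hM0
    (norm_labelIter_le hM hM0.le hC₀ hη hη1 (samplePath B ω)) hη hη0 hη2 hdiv h3 hmove hρ hh₀
    (by
      intro A hA v hAv hAin
      obtain ⟨b, hb⟩ := id hA
      obtain rfl := hAv b hb
      exact h1 A b hA hAv hAin)
  obtain ⟨Cs, hCs⟩ := exists_tendsto_centroids hD hmove hη0 hunused
  have hlim := eventually_isLimitLabelling hlab hgen (hv.mono fun t h => h.1) hD hCs
  have hfr := eventually_frozenDev_eq_zero hlab (hv.mono fun t h => h.2) hlim hCs hunused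
  obtain ⟨T₁, hT₁⟩ := eventually_atTop.1 (hlim.and (hfr.and hv))
  have hJ : ∀ z : ι, ∀ᶠ t in atTop, ¬ HasFreshLabel P lab C z t := by
    intro z
    refine h2 z (T₁ + 1) fun t ht hz => ?_
    obtain ⟨u, rfl⟩ : ∃ u, t = u + 1 := ⟨t - 1, by omega⟩
    exact not_const_batch_of_hasFreshLabel hm hη hlab hCstep
      (fun x hx => (hT₁ x (by omega)).1) (fun x hx => (hT₁ x (by omega)).2.1) hz
  obtain ⟨T₂, hT₂⟩ := eventually_atTop.1 (eventually_all.2 hJ)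
  refine ⟨max T₁ T₂, fun t ht => ⟨(hT₁ t ((le_max_left _ _).trans ht)).2.2.1, fun i j => ?_⟩⟩
  induction t, ht using Nat.le_induction with
  | base => rfl
  | succ t ht ih =>
    rw [← ih]
    have h4 : T₁ ≤ t := (le_max_left _ _).trans ht
    have h5 : T₂ ≤ t := (le_max_right _ _).trans ht
    exact label_eq_iff_of_not_hasFreshLabel hP hunused (fun x hx => (hT₁ x (by omega)).1)
      (fun x hx => (hT₁ x (by omega)).2.1) (fun z => hT₂ (t + 1) (by omega) z) i j

/-- A contraction by `1 - q / (t + t₀)` with `q > 1`, perturbed by `O(1 / (t + t₀) ^ 2)`, forces a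
decay of order `1 / (t + t₀)`. -/
lemma le_div_of_recursion {x : ℕ → ℝ} {q β t₀ : ℝ} {T : ℕ} (hq : 1 < q) (hβ : 0 ≤ β)
    (hqt : q ≤ t₀)
    (hx : ∀ t ≥ T, x (t + 1) ≤ (1 - q / ((t + 1 : ℕ) + t₀)) * x t + β / ((t + 1 : ℕ) + t₀) ^ 2) :
    ∃ K ≥ 0, ∀ t ≥ T, x t ≤ K / (t + t₀) := by
  have hK0 : 0 ≤ β / (q - 1) := div_nonneg hβ (by linarith)
  refine ⟨max (x T * (T + t₀)) (β / (q - 1)), le_max_of_le_right hK0, fun t ht => ?_⟩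
  set K := max (x T * (T + t₀)) (β / (q - 1)) with hK
  have hKβ : β ≤ K * (q - 1) := by
    rw [← div_le_iff₀ (by linarith)]
    exact le_max_right _ _
  have ht₀ : 0 < t₀ := by linarith
  induction t, ht using Nat.le_induction with
  | base =>
    rw [le_div_iff₀ (by positivity)]
    exact le_max_left _ _
  | succ t ht ih =>
    refine (hx t ht).trans ?_
    have e : (((t + 1 : ℕ) : ℝ) + t₀) = (t + t₀) + 1 := by push_cast; ring
    rw [e]
    set N : ℝ := t + t₀ with hN
    have hNq : q ≤ N := by
      have : (0 : ℝ) ≤ t := Nat.cast_nonneg t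
      linarith
    have hN0 : 0 < N := by linarith
    have h1 : 0 ≤ 1 - q / (N + 1) := by
      rw [sub_nonneg, div_le_one (by linarith)]
      linarith
    calc (1 - q / (N + 1)) * x t + β / (N + 1) ^ 2
        ≤ (1 - q / (N + 1)) * (K / N) + K * (q - 1) / (N * (N + 1)) := by
          have h2 : β / (N + 1) ^ 2 ≤ K * (q - 1) / (N * (N + 1)) := by
            apply div_le_div₀ (hβ.trans hKβ) hKβ (by positivity)
            nlinarith
          gcongr
      _ = K / (N + 1) := by
          field_simp
          ring

/-- On the event that the labelling keeps the property `Q`, which fixes the value of the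
clustering, the excess cost decays at rate `1 / t`. -/
lemma exists_setIntegral_le [Nonempty ι] (hlab : ∀ C, IsClosest P (lab C) C)
    (hM : ∀ i, ‖P i‖ ≤ M) (hM0 : 0 ≤ M) (hC₀ : ∀ r, ‖C₀ r‖ ≤ M) {c t₀ : ℝ}
    (hη : ∀ t, η t = c / (t + t₀)) (hc : 0 < c) (hct : 2 * c ≤ t₀)
    (hp1 : 1 < 2 * hitProb (Fintype.card ι) m * c)
    (hB : IsUniformSampling μ B) (Q : (ι → κ) → Prop) {v : ℝ}
    (hQ : ∀ a, Q a → labelVal P a = v) (T : ℕ) :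
    ∃ K ≥ 0, ∀ t ≥ T, ∫ ω in {ω | ∀ u ≥ T, Q (lab (labelIter P lab η C₀ (samplePath B ω) u))},
      (labelCost P (lab (labelIter P lab η C₀ (samplePath B ω) t))
        (labelIter P lab η C₀ (samplePath B ω) t) - v) ∂μ ≤ K / (t + t₀) := by
  classical
  have ht₀ : 0 < t₀ := by linarith
  have hηpos : ∀ t, 0 < η t := fun t => by rw [hη]; positivity
  have hη1 : ∀ t, η t ≤ 1 := fun t => by
    rw [hη, div_le_one (by positivity)]
    have : (0 : ℝ) ≤ t := Nat.cast_nonneg t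
    linarith
  set Z : (ℕ → Fin m → ι) → ℕ → κ → V := fun w t => labelIter P lab η C₀ w t with hZ
  set R : ℕ → (ℕ → Fin m → ι) → Prop := fun t w => ∀ u, T ≤ u → u ≤ t → Q (lab (Z w u)) with hR
  set F : ℕ → (ℕ → Fin m → ι) → ℝ := fun t w =>
    if R t w then labelCost P (lab (Z w t)) (Z w t) - v else 0 with hF
  have hZdep : ∀ t u, u ≤ t → DependsOn (fun w => Z w u) (Set.Iio t) := fun t u hut =>
    (dependsOn_labelIter P lab η C₀ u).mono (Set.Iio_subset_Iio hut)
  have hRdep : ∀ t, DependsOn (R t) (Set.Iio t) := by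
    intro t w w' hw
    simp only [hR, eq_iff_iff]
    refine forall_congr' fun u => imp_congr_right fun _ => imp_congr_right fun hu => ?_
    have := hZdep t u hu hw
    simp only at this
    rw [this]
  have hFdep : ∀ t, DependsOn (F t) (Set.Iio t) := by
    intro t w w' hw
    have := hZdep t t le_rfl hw
    simp only at this
    simp only [hF, hRdep t hw, this]
  set Q' := 4 * M ^ 2 * Fintype.card ι with hQ'
  set p := hitProb (Fintype.card ι) m with hp
  have hstep : ∀ t ≥ T, ∀ w, avg (fun s => F (t + 1) (Function.update w t s)) ≤
      (1 - 2 * p * η (t + 1)) * F t w + Q' * η (t + 1) ^ 2 := by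
    intro t ht w
    have hZs : ∀ s, Z (Function.update w t s) (t + 1) =
        batchStep P (lab (Z w t)) (η (t + 1)) s (Z w t) := fun s => labelIter_update w t s
    have hR1 : ∀ s, R (t + 1) (Function.update w t s) → R t w := by
      intro s h u hu hut
      have h1 := h u hu (by omega)
      have h2 : Z (Function.update w t s) u = Z w u := labelIter_update_of_le w hut s
      rwa [h2] at h1
    by_cases hRt : R t w
    · have hv := hQ _ (hRt t ht le_rfl)
      have hd := avg_labelCost_batchStep_le (m := m) (a := lab (Z w t)) (η := η (t + 1)) hM hM0
        (norm_labelIter_le (lab := lab) hM hM0 hC₀ hηpos hη1 w t) (hηpos _).le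
      have hle : ∀ s, F (t + 1) (Function.update w t s) ≤
          labelCost P (lab (Z w t)) (batchStep P (lab (Z w t)) (η (t + 1)) s (Z w t)) + (-v) := by
        intro s
        have h0 : v ≤ labelCost P (lab (Z w t))
            (batchStep P (lab (Z w t)) (η (t + 1)) s (Z w t)) := hv ▸ labelVal_le_labelCost
        simp only [hF, hZs]
        split_ifs
        · linarith [(hlab (batchStep P (lab (Z w t)) (η (t + 1)) s (Z w t))).labelCost_le
            (lab (Z w t))]
        · linarith
      refine (avg_mono hle).trans ?_
      rw [avg_add, avg_const]
      simp only [hF, if_pos hRt]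
      rw [labelCost_eq, hv] at hd ⊢
      simp only [hZ] at hd ⊢
      linarith
    · have : ∀ s, F (t + 1) (Function.update w t s) = 0 := fun s => by
        simp only [hF]
        rw [if_neg fun h => hRt (hR1 s h)]
      simp only [this, avg_const]
      simp only [hF, if_neg hRt, mul_zero, zero_add]
      positivity
  set x : ℕ → ℝ := fun t => ∫ ω, F t (samplePath B ω) ∂μ with hx
  have hrec : ∀ t ≥ T, x (t + 1) ≤ (1 - 2 * p * η (t + 1)) * x t + Q' * η (t + 1) ^ 2 := by
    intro t ht
    have hi := integrable_of_dependsOn (μ := μ) hB.1 (hFdep t)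
    simp only [hx]
    rw [integral_avg_update hB (hFdep (t + 1))]
    calc _ ≤ ∫ ω, ((1 - 2 * p * η (t + 1)) * F t (samplePath B ω) + Q' * η (t + 1) ^ 2) ∂μ :=
          integral_mono
            (integrable_of_dependsOn (μ := μ) hB.1 (dependsOn_avg_update (hFdep (t + 1))))
            ((hi.const_mul _).add (integrable_const _)) fun ω => hstep t ht _
      _ = _ := by
          rw [integral_add (hi.const_mul _) (integrable_const _), integral_const_mul]; simp
  have hp0 : 0 < p := by
    by_contra h
    push Not at h
    nlinarith
  obtain ⟨K, hK, hxK⟩ := le_div_of_recursion (x := x) (q := 2 * p * c) (β := Q' * c ^ 2)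
    (t₀ := t₀) (T := T) hp1 (by positivity) (by nlinarith [hitProb_le_one (ι := ι) m]) (by
      intro t ht
      refine (hrec t ht).trans_eq ?_
      rw [hη, div_pow, mul_div_assoc, mul_div_assoc])
  refine ⟨K, hK, fun t ht => ?_⟩
  refine le_trans ?_ (hxK t ht)
  set G := {ω | ∀ u ≥ T, Q (lab (labelIter P lab η C₀ (samplePath B ω) u))} with hG
  have hi := integrable_of_dependsOn (μ := μ) hB.1 (hFdep t)
  have hFnn : ∀ w, 0 ≤ F t w := by
    intro w
    simp only [hF]
    split_ifs with h
    · have := labelVal_le_labelCost (P := P) (a := lab (Z w t)) (C := Z w t)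
      rw [hQ _ (h t ht le_rfl)] at this
      linarith
    · exact le_rfl
  have hGm : MeasurableSet G := by
    have : G = ⋂ u, ⋂ (_ : u ≥ T), {ω | Q (lab (labelIter P lab η C₀ (samplePath B ω) u))} := by
      ext ω; simp [hG]
    rw [this]
    refine MeasurableSet.iInter fun u => MeasurableSet.iInter fun _ => ?_
    refine measurableSet_setOfPred.2 (measurable_of_dependsOn hB.1 (t := u)
      (f := fun w => Q (lab (labelIter P lab η C₀ w u))) fun w w' hw => ?_)
    have := hZdep u u le_rfl hw
    simp only [hZ] at this
    simp only [this]
  calc _ = ∫ ω in G, F t (samplePath B ω) ∂μ := by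
        refine setIntegral_congr_fun hGm fun ω hω => ?_
        simp only [hF]
        rw [if_pos fun u hu _ => hω u hu]
    _ ≤ _ := setIntegral_le_integral hi (Eventually.of_forall fun ω => hFnn _)

end Convergence

/-! ### Clusterings and admissible values of the stability constant -/

section Clusterings

variable {d k : ℕ} {X : Finset (EuclideanSpace ℝ (Fin d))}

lemma bisectorGap_eq_zero {p q x : EuclideanSpace ℝ (Fin d)} (h : ‖x - p‖ = ‖x - q‖) :
    bisectorGap p q x = 0 := by
  have hp := EuclideanGeometry.dist_sq_eq_dist_orthogonalProjection_sq_add_dist_orthogonalProjection_sq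
    (s := affineSpan ℝ {p, q}) x (left_mem_affineSpan_pair ℝ p q)
  have hq := EuclideanGeometry.dist_sq_eq_dist_orthogonalProjection_sq_add_dist_orthogonalProjection_sq
    (s := affineSpan ℝ {p, q}) x (right_mem_affineSpan_pair ℝ p q)
  rw [dist_comm p x, dist_eq_norm x p, h, ← dist_eq_norm x q, dist_comm x q, hq,
    add_left_inj] at hp
  have h1 := (mul_self_inj dist_nonneg dist_nonneg).1 hp
  rw [bisectorGap, dist_comm _ p, dist_comm _ q, h1, sub_self, abs_zero]

/-- In a stationary clustering with a positive margin there are no ties. The margin is measured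
with an assignment of the points to closest means, but ties would make the gap vanish for every
such assignment. -/
lemma IsGeneral.strict (hA : IsGeneral X k) {A : Finpartition X}
    (hst : A ∈ stationaryClusterings X k) {S T : Finset (EuclideanSpace ℝ (Fin d))}
    (hS : S ∈ A.parts) (hT : T ∈ A.parts) (hne : T ≠ S) {x : EuclideanSpace ℝ (Fin d)}
    (hx : x ∈ S) : ‖x - clusterMean S‖ < ‖x - clusterMean T‖ := by
  obtain ⟨δ, hδ, a, ha, hgap⟩ := hA A hst
  have hxX : x ∈ X := A.le hS hx
  refine lt_of_le_of_ne (hst.2 S hS x hx T hT) fun heq => ?_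
  have hz : ∀ R R' : A.parts, R ≠ R' → (a x = R ∨ a x = R') →
      ‖x - clusterMean R.1‖ ≠ ‖x - clusterMean R'.1‖ := by
    intro R R' hRR hax h
    have h1 := hgap R R' hRR x hxX hax
    rw [bisectorGap_eq_zero (p := means A R) (q := means A R') h] at h1
    linarith
  have h1 : ‖x - clusterMean (a x).1‖ = ‖x - clusterMean S‖ :=
    le_antisymm (ha x hxX ⟨S, hS⟩) (hst.2 S hS x hx _ (a x).2)
  by_cases hax : a x = ⟨S, hS⟩
  · exact hz ⟨S, hS⟩ ⟨T, hT⟩ (fun h => hne (Subtype.ext_iff.1 h).symm) (Or.inl hax) heq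
  · exact hz (a x) ⟨S, hS⟩ hax (Or.inl rfl) h1

lemma sum_sq_sub_clusterMean (S : Finset (EuclideanSpace ℝ (Fin d)))
    (z : EuclideanSpace ℝ (Fin d)) :
    ∑ x ∈ S, ‖x - z‖ ^ 2 = ∑ x ∈ S, ‖x - clusterMean S‖ ^ 2 + S.card * ‖z - clusterMean S‖ ^ 2 := by
  have h := sum_cell_sq (P := fun x : S => (x : EuclideanSpace ℝ (Fin d)))
    (a := fun _ => ()) () z
  have hm : labelMean (fun x : S => (x : EuclideanSpace ℝ (Fin d))) (fun _ => ()) () =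
      clusterMean S := by
    simp only [labelMean, clusterMean, Finset.filter_true, Finset.card_univ, Fintype.card_coe]
    rw [Finset.sum_coe_sort S fun x => x]
  rw [hm] at h
  simp only [Finset.filter_true] at h
  rw [Finset.sum_coe_sort S fun x => ‖x - z‖ ^ 2,
    Finset.sum_coe_sort S fun x => ‖x - clusterMean S‖ ^ 2] at h
  rw [h, Finset.sum_const, nsmul_eq_mul, Finset.card_univ, Fintype.card_coe]

lemma clusteringCost_nonneg (A : Finpartition X) : 0 ≤ clusteringCost A :=
  Finset.sum_nonneg fun _ _ => Finset.sum_nonneg fun _ _ => by positivity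

lemma norm_sub_clusterMean_lt {A : Finpartition X} {C : Fin k → EuclideanSpace ℝ (Fin d)}
    {N : Finset (Fin k)} {π : A.parts ≃ N} {ε : ℝ} (hε : 0 < ε) (h : matchingCost A C π < ε ^ 2)
    (S : A.parts) : ‖C (π S).1 - clusterMean S.1‖ < ε := by
  refine lt_of_pow_lt_pow_left₀ 2 hε.le (lt_of_le_of_lt ?_ h)
  have h1 : (1 : ℝ) ≤ S.1.card := by
    exact_mod_cast Finset.card_pos.2 (A.nonempty_of_mem_parts S.2)
  calc ‖C (π S).1 - clusterMean S.1‖ ^ 2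
      ≤ S.1.card * ‖C (π S).1 - clusterMean S.1‖ ^ 2 := le_mul_of_one_le_left (by positivity) h1
    _ ≤ _ := Finset.single_le_sum
        (f := fun S : A.parts => (S.1.card : ℝ) * ‖C (π S).1 - clusterMean S.1‖ ^ 2)
        (fun _ _ => by positivity) (Finset.mem_univ S)

lemma mem_clusters {ι : Type*} {a : EuclideanSpace ℝ (Fin d) → ι}
    {S : Finset (EuclideanSpace ℝ (Fin d))} :
    S ∈ clusters X a ↔ ∃ x ∈ X, cell X a (a x) = S := by
  classical
  simp [clusters]

lemma mem_cell {ι : Type*} {a : EuclideanSpace ℝ (Fin d) → ι} {r : ι}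
    {x : EuclideanSpace ℝ (Fin d)} : x ∈ cell X a r ↔ x ∈ X ∧ a x = r := by
  classical
  simp [cell]

lemma card_clusters {ι : Type*} (a : EuclideanSpace ℝ (Fin d) → ι) :
    (clusters X a).card = (nondegenerate X a).card := by
  classical
  have h : clusters X a = (nondegenerate X a).image (cell X a) := by
    ext S
    simp [clusters, nondegenerate]
  rw [h]
  refine Finset.card_image_of_injOn fun r hr s _ hrs => ?_
  obtain ⟨x, hx, rfl⟩ := by simpa [nondegenerate] using hr
  have h1 : x ∈ cell X a (a x) := mem_cell.2 ⟨hx, rfl⟩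
  rw [hrs] at h1
  exact (mem_cell.1 h1).2

/-- The label of a data point is matched with some cluster. -/
lemma exists_matched {A : Finpartition X} {a : EuclideanSpace ℝ (Fin d) → Fin k}
    (π : A.parts ≃ nondegenerate X a) {x : EuclideanSpace ℝ (Fin d)} (hx : x ∈ X) :
    ∃ T : A.parts, (π T).1 = a x := by
  classical
  have : a x ∈ nondegenerate X a := by
    simpa [nondegenerate] using ⟨x, hx, rfl⟩
  exact ⟨π.symm ⟨a x, this⟩, by simp⟩

/-- Admissible values exist: there are finitely many clusterings, and each of them has a least
positive difference between the distances of a data point to two of its means. -/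
lemma exists_isRMin (hA : IsGeneral X k) : ∃ r : ℝ, IsRMin X k r := by
  classical
  have hgap : ∀ A : Finpartition X, ∃ ε > 0, ∀ x ∈ X, ∀ S ∈ A.parts, ∀ T ∈ A.parts,
      ‖x - clusterMean S‖ < ‖x - clusterMean T‖ →
      ‖x - clusterMean S‖ + 2 * ε ≤ ‖x - clusterMean T‖ := by
    intro A
    obtain ⟨g, hg, h⟩ := exists_pos_le_of_finite (α := X × A.parts × A.parts)
      (fun p => 0 < ‖p.1.1 - clusterMean p.2.2.1‖ - ‖p.1.1 - clusterMean p.2.1.1‖)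
      (fun p => ‖p.1.1 - clusterMean p.2.2.1‖ - ‖p.1.1 - clusterMean p.2.1.1‖) (fun _ h => h)
    refine ⟨g / 2, by positivity, fun x hx S hS T hT hlt => ?_⟩
    have := h (⟨x, hx⟩, ⟨S, hS⟩, ⟨T, hT⟩) (sub_pos.2 hlt)
    simp only at this
    linarith
  choose ε hε hεgap using hgap
  obtain ⟨r, hr, hrle⟩ := exists_pos_le_of_finite (α := Finpartition X) (fun _ => True)
    (fun A => ε A ^ 2 / (clusteringCost A + 1)) (fun A _ => by
      have := clusteringCost_nonneg A
      have := hε A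
      positivity)
  have hrA : ∀ A : Finpartition X, r * clusteringCost A < ε A ^ 2 := by
    intro A
    have h0 := clusteringCost_nonneg A
    have h1 := hrle A trivial
    rw [le_div_iff₀ (by linarith)] at h1
    linarith
  -- For a small matching cost, the labels follow the closest means.
  have hclose : ∀ (A : Finpartition X) (C : Fin k → EuclideanSpace ℝ (Fin d))
      (a : EuclideanSpace ℝ (Fin d) → Fin k), IsVoronoi X C a →
      ∀ π : A.parts ≃ nondegenerate X a, matchingCost A C π < ε A ^ 2 →
      ∀ x ∈ X, ∀ T : A.parts, (π T).1 = a x → ∀ S : A.parts,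
        ‖x - clusterMean T.1‖ ≤ ‖x - clusterMean S.1‖ := by
    intro A C a ha π hπ x hx T hT S
    by_contra hlt
    push Not at hlt
    have h1 := hεgap A x hx S.1 S.2 T.1 T.2 hlt
    have h2 := norm_sub_clusterMean_lt (hε A) hπ S
    have h3 := norm_sub_clusterMean_lt (hε A) hπ T
    have h4 := ha x hx (π S).1
    rw [← hT] at h4
    have h5 := norm_sub_le_norm_sub_add_norm_sub x (clusterMean S.1) (C (π S).1)
    have h6 := norm_sub_le_norm_sub_add_norm_sub x (C (π T).1) (clusterMean T.1)
    rw [norm_sub_rev (clusterMean S.1)] at h5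
    linarith
  refine ⟨r, hr, fun A hst => ⟨le_rfl, zero_lt_one, ?_⟩, ?_⟩
  · intro C a ha _ b' hb' hΔ
    refine ⟨0, le_rfl, by simp, fun π hπ S => ?_⟩
    have hπ' : matchingCost A C π < ε A ^ 2 := by
      rw [hπ]
      refine hΔ.trans_lt (lt_of_le_of_lt ?_ (hrA A))
      exact mul_le_mul_of_nonneg_right hb' (clusteringCost_nonneg A)
    have hcellsub : ∀ x ∈ X, ∀ S T : A.parts, x ∈ S.1 → (π T).1 = a x → T = S := by
      intro x hx S T hxS hT
      by_contra hne
      have h1 := hA.strict hst S.2 T.2 (fun h => hne (Subtype.ext h)) hxS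
      exact absurd (hclose A C a ha π hπ' x hx T hT S) (not_le.2 h1)
    have hcell : cell X a (π S).1 = S.1 := by
      ext x
      rw [mem_cell]
      constructor
      · rintro ⟨hx, hax⟩
        obtain ⟨T, hT, hxT⟩ := A.exists_mem hx
        rw [hcellsub x hx ⟨T, hT⟩ S hxT hax.symm]
        exact hxT
      · intro hxS
        have hx : x ∈ X := A.le S.2 hxS
        obtain ⟨T, hT⟩ := exists_matched π hx
        rw [← hT, hcellsub x hx S T hxS hT]
        exact ⟨hx, rfl⟩
    rw [hcell, symmDiff_self]
    simp
  · intro A hcard hno C a ha hcl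
    have hcards : Fintype.card A.parts = Fintype.card (nondegenerate X a) := by
      rw [Fintype.card_coe, Fintype.card_coe, ← hcl, card_clusters]
    have : Nonempty (A.parts ≃ nondegenerate X a) := ⟨Fintype.equivOfCardEq hcards⟩
    refine le_ciInf fun π => ?_
    by_contra hlt
    push Not at hlt
    have hπ := hlt.trans (hrA A)
    apply hno
    refine ⟨A, ⟨hcard, fun S hS x hx T hT => ?_⟩, rfl⟩
    have hxX : x ∈ X := A.le hS hx
    obtain ⟨R, hR⟩ := exists_matched π hxX
    -- All points of the cluster `S` carry the same label, which is matched with `R`.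
    have hall : ∀ y ∈ S, (π R).1 = a y := by
      intro y hy
      rw [hR]
      rw [← hcl] at hS
      obtain ⟨z, _, rfl⟩ := mem_clusters.1 hS
      rw [(mem_cell.1 hx).2, (mem_cell.1 hy).2]
    have hle : ∑ y ∈ S, ‖y - clusterMean R.1‖ ^ 2 ≤ ∑ y ∈ S, ‖y - clusterMean S‖ ^ 2 := by
      refine Finset.sum_le_sum fun y hy => ?_
      have := hclose A C a ha π hπ y (A.le hS hy) R (hall y hy) ⟨S, hS⟩
      gcongr
    rw [sum_sq_sub_clusterMean, add_le_iff_nonpos_right] at hle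
    have hpos : (0 : ℝ) < S.card := by
      exact_mod_cast Finset.card_pos.2 (A.nonempty_of_mem_parts hS)
    have h0 : ‖clusterMean R.1 - clusterMean S‖ = 0 := by
      by_contra hne
      have : 0 < ‖clusterMean R.1 - clusterMean S‖ := lt_of_le_of_ne (norm_nonneg _) (Ne.symm hne)
      have : 0 < S.card * ‖clusterMean R.1 - clusterMean S‖ ^ 2 := by positivity
      linarith
    rw [← sub_eq_zero.1 (norm_eq_zero.1 h0)]
    exact hclose A C a ha π hπ x hxX R hR ⟨T, hT⟩

end Clusterings

/-! ### Clusterings as labellings -/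

section Translation

variable {d k : ℕ} {X : Finset (EuclideanSpace ℝ (Fin d))}

lemma exists_finpartition_of_clusters {ι : Type*} (X : Finset (EuclideanSpace ℝ (Fin d)))
    (a : EuclideanSpace ℝ (Fin d) → ι) : ∃ A : Finpartition X, A.parts = clusters X a := by
  refine ⟨Finpartition.ofExistsUnique (clusters X a) ?_ ?_ ?_, rfl⟩
  · intro S hS x hx
    obtain ⟨y, _, rfl⟩ := mem_clusters.1 hS
    exact (mem_cell.1 hx).1
  · intro x hx
    refine ⟨cell X a (a x), ⟨mem_clusters.2 ⟨x, hx, rfl⟩, mem_cell.2 ⟨hx, rfl⟩⟩, ?_⟩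
    rintro S ⟨hS, hxS⟩
    obtain ⟨y, _, rfl⟩ := mem_clusters.1 hS
    rw [(mem_cell.1 hxS).2]
  · intro h
    obtain ⟨y, hy, he⟩ := mem_clusters.1 h
    have : y ∈ cell X a (a y) := mem_cell.2 ⟨hy, rfl⟩
    rw [he] at this
    simp at this

lemma clusters_congr {ι ι' : Type*} {a : EuclideanSpace ℝ (Fin d) → ι}
    {b : EuclideanSpace ℝ (Fin d) → ι'} (h : ∀ x ∈ X, ∀ y ∈ X, a x = a y ↔ b x = b y) :
    clusters X a = clusters X b := by
  have hc : ∀ x ∈ X, cell X a (a x) = cell X b (b x) := by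
    intro x hx
    ext y
    rw [mem_cell, mem_cell]
    exact and_congr_right fun hy => h y hy x hx
  ext S
  rw [mem_clusters, mem_clusters]
  constructor
  · rintro ⟨x, hx, rfl⟩; exact ⟨x, hx, (hc x hx).symm⟩
  · rintro ⟨x, hx, rfl⟩; exact ⟨x, hx, hc x hx⟩

lemma labelMean_eq_clusterMean (a : EuclideanSpace ℝ (Fin d) → Fin k) (r : Fin k) :
    labelMean (fun x : X => (x : EuclideanSpace ℝ (Fin d))) (fun x => a x) r =
      clusterMean (cell X a r) := by
  classical
  have h : (Finset.univ.filter (fun x : X => a x = r)).map (Function.Embedding.subtype _) =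
      cell X a r := by
    ext x
    simp [mem_cell, and_comm]
  rw [labelMean, clusterMean, ← h, Finset.card_map, Finset.sum_map]
  rfl

lemma labelVal_eq_clusteringCost {a : EuclideanSpace ℝ (Fin d) → Fin k} {A : Finpartition X}
    (h : clusters X a = A.parts) :
    labelVal (fun x : X => (x : EuclideanSpace ℝ (Fin d))) (fun x => a x) = clusteringCost A := by
  classical
  unfold labelVal clusteringCost
  simp only [labelMean_eq_clusterMean]
  rw [Finset.sum_coe_sort X fun x => ‖x - clusterMean (cell X a (a x))‖ ^ 2]
  have h1 : ∑ S ∈ A.parts, ∑ x ∈ S, ‖x - clusterMean S‖ ^ 2 =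
      ∑ S ∈ A.parts, ∑ x ∈ id S, ‖x - clusterMean (cell X a (a x))‖ ^ 2 := by
    refine Finset.sum_congr rfl fun S hS => Finset.sum_congr rfl fun x hx => ?_
    rw [← h] at hS
    obtain ⟨y, _, rfl⟩ := mem_clusters.1 hS
    rw [(mem_cell.1 hx).2]
  rw [h1, ← Finset.sum_biUnion A.disjoint, A.biUnion_parts]

lemma labelCost_eq_centroidCost {a : EuclideanSpace ℝ (Fin d) → Fin k}
    {C : Fin k → EuclideanSpace ℝ (Fin d)} (h : IsVoronoi X C a) :
    labelCost (fun x : X => (x : EuclideanSpace ℝ (Fin d))) (fun x => a x) C =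
      centroidCost X C := by
  unfold labelCost centroidCost
  rw [Finset.sum_coe_sort X fun x => ‖x - C (a x)‖ ^ 2]
  refine Finset.sum_congr rfl fun x hx => ?_
  have : Nonempty (Fin k) := ⟨a x⟩
  refine le_antisymm (le_ciInf fun r => ?_)
    (ciInf_le ⟨0, by rintro _ ⟨r, rfl⟩; positivity⟩ (a x))
  have := h x hx r
  gcongr

lemma mem_stationaryClusterings {a : EuclideanSpace ℝ (Fin d) → Fin k} {A : Finpartition X}
    (h : clusters X a = A.parts)
    (hsc : IsSelfConsistent (fun x : X => (x : EuclideanSpace ℝ (Fin d))) (fun x => a x)) :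
    A ∈ stationaryClusterings X k := by
  classical
  refine ⟨?_, fun S hS x hx T hT => ?_⟩
  · rw [← h, card_clusters]
    simpa using Finset.card_le_univ (nondegenerate X a)
  · rw [← h] at hS hT
    obtain ⟨y, hy, rfl⟩ := mem_clusters.1 hS
    obtain ⟨z, hz, rfl⟩ := mem_clusters.1 hT
    obtain ⟨hxX, hxy⟩ := mem_cell.1 hx
    have := hsc ⟨x, hxX⟩ ⟨z, hz⟩
    simpa only [labelMean_eq_clusterMean, hxy] using this

/-- A labelling of the data points, extended to the whole space. -/
noncomputable def extendLabel [Nonempty (Fin k)] (a : X → Fin k)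
    (x : EuclideanSpace ℝ (Fin d)) : Fin k := by
  classical exact if h : x ∈ X then a ⟨x, h⟩ else Classical.arbitrary _

lemma extendLabel_apply [Nonempty (Fin k)] (a : X → Fin k) (x : X) : extendLabel a x = a x := by
  simp [extendLabel]

lemma IsGeneral.isStrict [Nonempty (Fin k)] (hA : IsGeneral X k) (a : X → Fin k)
    (hsc : IsSelfConsistent (fun x : X => (x : EuclideanSpace ℝ (Fin d))) a) :
    IsStrict (fun x : X => (x : EuclideanSpace ℝ (Fin d))) a := by
  have he : (fun x : X => extendLabel a (x : EuclideanSpace ℝ (Fin d))) = a :=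
    funext fun x => extendLabel_apply a x
  obtain ⟨A, hAp⟩ := exists_finpartition_of_clusters X (extendLabel a)
  have hst := mem_stationaryClusterings (a := extendLabel a) hAp.symm (by rwa [he])
  intro x y hxy
  have hS : cell X (extendLabel a) (extendLabel a x) ∈ A.parts := by
    rw [hAp]; exact mem_clusters.2 ⟨x, x.2, rfl⟩
  have hT : cell X (extendLabel a) (extendLabel a y) ∈ A.parts := by
    rw [hAp]; exact mem_clusters.2 ⟨y, y.2, rfl⟩
  have hne : cell X (extendLabel a) (extendLabel a y) ≠
      cell X (extendLabel a) (extendLabel a x) := by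
    intro h
    have h1 : (y : EuclideanSpace ℝ (Fin d)) ∈ cell X (extendLabel a) (extendLabel a y) :=
      mem_cell.2 ⟨y.2, rfl⟩
    rw [h] at h1
    have h2 := (mem_cell.1 h1).2
    rw [extendLabel_apply, extendLabel_apply] at h2
    exact hxy h2
  have := hA.strict hst hS hT hne (mem_cell.2 ⟨x.2, rfl⟩)
  rw [← labelMean_eq_clusterMean, ← labelMean_eq_clusterMean, he, extendLabel_apply,
    extendLabel_apply] at this
  exact this

lemma kmeansStep_eq_batchStep {m : ℕ} (a : EuclideanSpace ℝ (Fin d) → Fin k) (η : ℝ)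
    (s : Fin m → X) (C : Fin k → EuclideanSpace ℝ (Fin d)) :
    kmeansStep a η (fun j => (s j : EuclideanSpace ℝ (Fin d))) C =
      batchStep (fun x : X => (x : EuclideanSpace ℝ (Fin d))) (fun x => a x) η s C := by
  funext r
  unfold kmeansStep batchStep batchMove
  split_ifs with h
  · simp
  · module

lemma kmeansIter_eq_labelIter {m : ℕ}
    (tie : (Fin k → EuclideanSpace ℝ (Fin d)) → EuclideanSpace ℝ (Fin d) → Fin k) (η : ℕ → ℝ)
    (C₀ : Fin k → EuclideanSpace ℝ (Fin d)) (w : ℕ → Fin m → X) (t : ℕ) :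
    kmeansIter tie η C₀ (fun i j => (w i j : EuclideanSpace ℝ (Fin d))) t =
      labelIter (fun x : X => (x : EuclideanSpace ℝ (Fin d))) (fun C x => tie C x) η C₀ w t := by
  induction t with
  | zero => rfl
  | succ t ih =>
    simp only [kmeansIter, labelIter]
    rw [ih, kmeansStep_eq_batchStep]

end Translation

/-! ### Learning rates, conditional expectations and the theorem -/

section Main

open Filter Topology

lemma one_sub_exp_le_hitProb {n m : ℕ} (hn : 1 ≤ n) :
    1 - Real.exp (-(4 * (m : ℝ)) / (5 * n)) ≤ hitProb n m := by
  have hn' : (1 : ℝ) ≤ n := by exact_mod_cast hn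
  have h1 : ((n : ℝ) - 1) / n ≤ Real.exp (-(1 / n)) := by
    have := Real.add_one_le_exp (-(1 / (n : ℝ)))
    have e : ((n : ℝ) - 1) / n = -(1 / (n : ℝ)) + 1 := by field_simp; ring
    rwa [e]
  have h0 : 0 ≤ ((n : ℝ) - 1) / n := div_nonneg (by linarith) (by linarith)
  have h2 : (((n : ℝ) - 1) / n) ^ m ≤ Real.exp (-(4 * (m : ℝ)) / (5 * n)) := by
    calc (((n : ℝ) - 1) / n) ^ m ≤ Real.exp (-(1 / n)) ^ m := pow_le_pow_left₀ h0 h1 m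
      _ = Real.exp (m * (-(1 / n))) := by rw [Real.exp_nat_mul]
      _ ≤ _ := by
        apply Real.exp_le_exp.2
        rw [le_div_iff₀ (by positivity)]
        have e : (m : ℝ) * (-(1 / n)) * (5 * n) = -(5 * m) := by field_simp
        rw [e]
        have : (0 : ℝ) ≤ m := Nat.cast_nonneg m
        linarith
  unfold hitProb
  linarith

lemma not_summable_rate {c t₀ : ℝ} (hc : 0 < c) (ht₀ : 0 < t₀) :
    ¬ Summable fun t : ℕ => c / (((t + 1 : ℕ) : ℝ) + t₀) := by
  intro h
  have h1 := (Real.summable_one_div_nat_add_rpow (1 + t₀) 1).1 ?_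
  · exact lt_irrefl _ h1
  · refine (h.mul_left c⁻¹).congr fun t => ?_
    rw [Real.rpow_one, abs_of_pos (by positivity)]
    push_cast
    field_simp
    ring

lemma summable_rate_sq (c : ℝ) {t₀ : ℝ} (ht₀ : 0 < t₀) :
    Summable fun t : ℕ => (c / (((t + 1 : ℕ) : ℝ) + t₀)) ^ 2 := by
  have h := (Real.summable_one_div_nat_add_rpow (1 + t₀) 2).2 (by norm_num)
  refine (h.mul_left (c ^ 2)).congr fun t => ?_
  rw [abs_of_pos (by positivity)]
  have : ((t : ℝ) + (1 + t₀)) ^ (2 : ℝ) = ((t : ℝ) + (1 + t₀)) ^ 2 := by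
    exact_mod_cast Real.rpow_natCast ((t : ℝ) + (1 + t₀)) 2
  rw [this]
  push_cast
  rw [div_pow, mul_one_div]
  congr 2
  ring

lemma exists_norm_bound {d k : ℕ} (X : Finset (EuclideanSpace ℝ (Fin d)))
    {C₀ : Fin k → EuclideanSpace ℝ (Fin d)}
    (hC₀ : ∀ r, C₀ r ∈ convexHull ℝ (X : Set (EuclideanSpace ℝ (Fin d)))) :
    ∃ M > 0, (∀ x : X, ‖(x : EuclideanSpace ℝ (Fin d))‖ ≤ M) ∧ ∀ r, ‖C₀ r‖ ≤ M := by
  obtain ⟨M, hM⟩ := (X.finite_toSet.image norm).bddAbove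
  have hX : ∀ x ∈ X, ‖x‖ ≤ max M 1 := fun x hx => (hM ⟨x, hx, rfl⟩).trans (le_max_left _ _)
  refine ⟨max M 1, lt_max_of_lt_right one_pos, fun x => hX x x.2, fun r => ?_⟩
  have hsub : convexHull ℝ (X : Set (EuclideanSpace ℝ (Fin d))) ⊆ Metric.closedBall 0 (max M 1) :=
    convexHull_min (fun x hx => by simpa using hX x hx) (convex_closedBall _ _)
  simpa using hsub (hC₀ r)

/-- A bound of order `1 / t` for late integrals over an event carries over to the conditional
expectations given the event, for all times. -/
lemma exists_abs_integral_cond_le {Ω : Type*} [MeasurableSpace Ω] {μ : Measure Ω}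
    [IsProbabilityMeasure μ] {G : Set Ω} (hG : MeasurableSet G) {f : ℕ → Ω → ℝ}
    (hf : ∀ t, Integrable (f t) μ) {t₀ K : ℝ} {T : ℕ} (ht₀ : 0 < t₀)
    (hf0 : ∀ t ≥ T, ∀ ω ∈ G, 0 ≤ f t ω) (hK : ∀ t ≥ T, ∫ ω in G, f t ω ∂μ ≤ K / (t + t₀)) :
    ∃ K' : ℝ, ∀ t : ℕ, Integrable (f t) (cond μ G) ∧
      |∫ ω, f t ω ∂(cond μ G)| ≤ K' / (t + t₀) := by
  rcases eq_or_ne (μ G) 0 with h0 | h0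
  · have hz : cond μ G = 0 := cond_eq_zero_of_meas_eq_zero h0
    refine ⟨0, fun t => ?_⟩
    rw [hz]
    simp
  have hint : ∀ t, Integrable (f t) (cond μ G) := fun t =>
    ((hf t).restrict).smul_measure (ENNReal.inv_ne_top.2 h0)
  set I : ℕ → ℝ := fun t => ∫ ω, f t ω ∂(cond μ G) with hI
  have hIeq : ∀ t, I t = (μ G)⁻¹.toReal * ∫ ω in G, f t ω ∂μ := fun t => by
    simp only [hI, ProbabilityTheory.cond, integral_smul_measure, smul_eq_mul]
  have hpos : ∀ t : ℕ, (0 : ℝ) < t + t₀ := fun t => by positivity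
  set K₂ := ∑ t ∈ Finset.range T, |I t| * (t + t₀) with hK₂
  have hK₂0 : 0 ≤ K₂ := Finset.sum_nonneg fun t _ => mul_nonneg (abs_nonneg _) (hpos t).le
  have hg : 0 ≤ (μ G)⁻¹.toReal := ENNReal.toReal_nonneg
  refine ⟨(μ G)⁻¹.toReal * |K| + K₂, fun t => ⟨hint t, ?_⟩⟩
  change |I t| ≤ _
  rw [le_div_iff₀ (hpos t)]
  rcases lt_or_ge t T with ht | ht
  · have h1 : |I t| * (t + t₀) ≤ K₂ :=
      Finset.single_le_sum (f := fun t : ℕ => |I t| * (t + t₀))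
        (fun t _ => mul_nonneg (abs_nonneg _) (hpos t).le) (Finset.mem_range.2 ht)
    have : 0 ≤ (μ G)⁻¹.toReal * |K| := by positivity
    linarith
  · have h1 : 0 ≤ ∫ ω in G, f t ω ∂μ := setIntegral_nonneg hG (hf0 t ht)
    have h2 := hK t ht
    rw [le_div_iff₀ (hpos t)] at h2
    rw [hIeq, abs_of_nonneg (mul_nonneg hg h1), mul_assoc]
    have h3 := mul_le_mul_of_nonneg_left (h2.trans (le_abs_self K)) hg
    linarith

end Main

theorem theorem1 {d k m : ℕ} (X : Finset (EuclideanSpace ℝ (Fin d)))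
    (hk : 1 ≤ k) (hkn : k < X.card) (hm : 1 ≤ m)
    (hA : IsGeneral X k)
    (C₀ : Fin k → EuclideanSpace ℝ (Fin d))
    (hC₀ : ∀ r, C₀ r ∈ convexHull ℝ (X : Set (EuclideanSpace ℝ (Fin d))))
    (tie : (Fin k → EuclideanSpace ℝ (Fin d)) → EuclideanSpace ℝ (Fin d) → Fin k)
    (htie : ∀ C, IsVoronoi X C (tie C))
    {Ω : Type*} [MeasurableSpace Ω] (μ : Measure Ω) [IsProbabilityMeasure μ]
    (S : ℕ → Fin m → Ω → X)
    (hSmeas : ∀ t j, Measurable (S t j))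
    (hSindep : iIndepFun (fun (p : ℕ × Fin m) => S p.1 p.2) μ)
    (hSunif : ∀ t j (x : X), μ (S t j ⁻¹' {x}) = (X.card : ENNReal)⁻¹) :
    (∃ r : ℝ, IsRMin X k r) ∧
    ∀ r : ℝ, IsRMin X k r →
    ∀ δ : ℝ, 0 < δ → δ < 1 / Real.exp 1 →
    ∀ c t₀ : ℝ,
      c > max
        (maxCost X m tie (fun t => c / (t + t₀)) C₀ /
          ((1 - Real.exp (-(m : ℝ) / (X.card : ℝ))) * r * optCost X k))
        (1 / (1 - Real.exp (-(4 * (m : ℝ)) / (5 * (X.card : ℝ))))) →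
      t₀ ≥ 768 * c ^ 2 * (1 + 1 / r) ^ 2 * (X.card : ℝ) ^ 2 * Real.log (1 / δ) ^ 2 →
      ∃ G : Finpartition X → Set Ω,
        (∀ A ∈ stationaryClusterings X k, MeasurableSet (G A)) ∧
        ENNReal.ofReal (1 - δ) ≤ μ (⋃ A ∈ stationaryClusterings X k, G A) ∧
        ∀ A ∈ stationaryClusterings X k,
          (∀ ω ∈ G A, ∃ T : ℕ, ∀ t ≥ T,
            clusters X (tie (kmeansIter tie (fun t => c / (t + t₀)) C₀
              (fun i j => (S i j ω : EuclideanSpace ℝ (Fin d))) t)) = A.parts) ∧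
          ∃ K : ℝ, ∀ t : ℕ,
            Integrable (fun ω => centroidCost X (kmeansIter tie (fun t => c / (t + t₀)) C₀
              (fun i j => (S i j ω : EuclideanSpace ℝ (Fin d))) t) - clusteringCost A)
              (ProbabilityTheory.cond μ (G A)) ∧
            |∫ ω, (centroidCost X (kmeansIter tie (fun t => c / (t + t₀)) C₀
              (fun i j => (S i j ω : EuclideanSpace ℝ (Fin d))) t) - clusteringCost A)
              ∂(ProbabilityTheory.cond μ (G A))| ≤ K / (t + t₀) := by
  classical
  refine ⟨exists_isRMin hA, ?_⟩
  intro r hr δ hδ0 hδ c t₀ hc ht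
  have hn : 1 ≤ X.card := by omega
  have hn' : (1 : ℝ) ≤ X.card := by exact_mod_cast hn
  have hXne : Nonempty X := (Finset.card_pos.1 hn).to_subtype
  have hkne : Nonempty (Fin k) := ⟨⟨0, hk⟩⟩
  have hcardX : Fintype.card X = X.card := Fintype.card_coe X
  have hm' : (1 : ℝ) ≤ m := by exact_mod_cast hm
  -- The requirements on the learning rate.
  have hE : Real.exp (-(4 * (m : ℝ)) / (5 * (X.card : ℝ))) < 1 := by
    rw [Real.exp_lt_one_iff]
    exact div_neg_of_neg_of_pos (by linarith) (by linarith)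
  have hE0 := Real.exp_pos (-(4 * (m : ℝ)) / (5 * (X.card : ℝ)))
  have hc1 : 1 / (1 - Real.exp (-(4 * (m : ℝ)) / (5 * (X.card : ℝ)))) < c :=
    (le_max_right _ _).trans_lt hc
  rw [div_lt_iff₀ (by linarith)] at hc1
  have hc0 : 0 < c := by
    by_contra h
    push Not at h
    nlinarith
  have hcgt : 1 < c := by nlinarith
  have hp1 : 1 < 2 * hitProb (Fintype.card X) m * c := by
    have h1 := one_sub_exp_le_hitProb (m := m) hn
    rw [hcardX]
    have h2 : c * (1 - Real.exp (-(4 * (m : ℝ)) / (5 * (X.card : ℝ)))) ≤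
        c * hitProb X.card m := by gcongr
    linarith
  have hlog : 1 ≤ Real.log (1 / δ) := by
    rw [Real.le_log_iff_exp_le (by positivity), le_div_iff₀ hδ0]
    rw [lt_div_iff₀ (Real.exp_pos 1)] at hδ
    linarith
  have hct : 2 * c ≤ t₀ := by
    have h1 : (1 : ℝ) ≤ (1 + 1 / r) ^ 2 := by
      have : 0 < 1 / r := one_div_pos.2 hr.1
      exact one_le_pow₀ (by linarith)
    have h2 : (1 : ℝ) ≤ (X.card : ℝ) ^ 2 := one_le_pow₀ hn'
    have h3 : (1 : ℝ) ≤ Real.log (1 / δ) ^ 2 := one_le_pow₀ hlog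
    have h4 : (1 : ℝ) ≤ (1 + 1 / r) ^ 2 * (X.card : ℝ) ^ 2 * Real.log (1 / δ) ^ 2 :=
      one_le_mul_of_one_le_of_one_le (one_le_mul_of_one_le_of_one_le h1 h2) h3
    have h5 : 768 * c ^ 2 * 1 ≤
        768 * c ^ 2 * ((1 + 1 / r) ^ 2 * (X.card : ℝ) ^ 2 * Real.log (1 / δ) ^ 2) := by gcongr
    nlinarith
  have ht₀ : 0 < t₀ := by linarith
  set η : ℕ → ℝ := fun t => c / (t + t₀) with hη
  have hηpos : ∀ t, 0 < η t := fun t => by simp only [hη]; positivity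
  have hη1 : ∀ t, η t ≤ 1 := fun t => by
    simp only [hη]
    rw [div_le_one (by positivity)]
    have : (0 : ℝ) ≤ t := Nat.cast_nonneg t
    linarith
  have hηa : Antitone η := fun s t hst => by
    simp only [hη]
    have : (s : ℝ) ≤ t := by exact_mod_cast hst
    gcongr
  have hη2 : ∀ t, η t ≤ 2 * η (t + 1) := fun t => by
    simp only [hη]
    rw [← mul_div_assoc, div_le_div_iff₀ (by positivity) (by positivity)]
    have : (0 : ℝ) ≤ t := Nat.cast_nonneg t
    push_cast
    nlinarith
  have hη0 : Filter.Tendsto η Filter.atTop (nhds 0) :=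
    Filter.Tendsto.const_div_atTop
      (Filter.tendsto_atTop_add_const_right _ _ tendsto_natCast_atTop_atTop) c
  obtain ⟨M, hM0, hM, hMC⟩ := exists_norm_bound X hC₀
  set P : X → EuclideanSpace ℝ (Fin d) := fun x => x with hP
  set lab : (Fin k → EuclideanSpace ℝ (Fin d)) → X → Fin k := fun C x => tie C x with hlabdef
  have hlab : ∀ C, IsClosest P (lab C) C := fun C x r => htie C x x.2 r
  set B : ℕ → Ω → Fin m → X := fun t ω j => S t j ω with hBdef
  have hB : IsUniformSampling μ B :=
    isUniformSampling_batches hSmeas hSindep fun t j x => by rw [hSunif, hcardX]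
  have hiter : ∀ ω t, kmeansIter tie η C₀ (fun i j => (S i j ω : EuclideanSpace ℝ (Fin d))) t =
      labelIter P lab η C₀ (samplePath B ω) t := fun ω t =>
    kmeansIter_eq_labelIter tie η C₀ (samplePath B ω) t
  simp only [hiter]
  set Z : Ω → ℕ → Fin k → EuclideanSpace ℝ (Fin d) := fun ω t =>
    labelIter P lab η C₀ (samplePath B ω) t with hZ
  have hae := ae_eventually_stable (μ := μ) (P := P) Subtype.val_injective hm hlab hA.isStrict hM
    hM0 hMC hηpos hη1 hηa hη2 hη0 (not_summable_rate hc0 ht₀) (summable_rate_sq c ht₀) hB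
  -- The events that the clustering is constant from a given time on.
  set GT : ℕ → Finpartition X → Set Ω := fun T A => {ω | ∀ t ≥ T, clusters X (tie (Z ω t)) = A.parts}
    with hGT
  have hGTmeas : ∀ T A, MeasurableSet (GT T A) := by
    intro T A
    have : GT T A = ⋂ t, ⋂ (_ : t ≥ T), {ω | clusters X (tie (Z ω t)) = A.parts} := by
      ext ω; simp [hGT]
    rw [this]
    refine MeasurableSet.iInter fun t => MeasurableSet.iInter fun _ => ?_
    refine measurableSet_setOfPred.2 (measurable_of_dependsOn hB.1 (t := t)
      (f := fun w => clusters X (tie (labelIter P lab η C₀ w t)) = A.parts) fun w w' hw => ?_)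
    have := dependsOn_labelIter P lab η C₀ t hw
    simp only at this
    simp only [this]
  set U : ℕ → Set Ω := fun T => ⋃ A ∈ stationaryClusterings X k, GT T A with hU
  have hUmono : Monotone U := fun T T' hTT => Set.iUnion₂_mono fun A _ ω hω t ht' =>
    hω t (hTT.trans ht')
  have hUae : ∀ᵐ ω ∂μ, ω ∈ ⋃ T, U T := by
    filter_upwards [hae] with ω ⟨T, hT⟩
    obtain ⟨A, hAp⟩ := exists_finpartition_of_clusters X (tie (Z ω T))
    refine Set.mem_iUnion.2 ⟨T, Set.mem_iUnion₂.2
      ⟨A, mem_stationaryClusterings hAp.symm (hT T le_rfl).1, fun t ht' => ?_⟩⟩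
    rw [hAp]
    exact clusters_congr fun x hx y hy => (hT t ht').2 ⟨x, hx⟩ ⟨y, hy⟩
  have hUlim : Filter.Tendsto (fun T => μ (U T)) Filter.atTop (nhds 1) := by
    have h1 := tendsto_measure_iUnion_atTop (μ := μ) hUmono
    have h2 : μ (⋃ T, U T) = 1 := by
      rw [← prob_compl_eq_zero_iff₀]
      · exact hUae
      · exact (MeasurableSet.iUnion fun T => MeasurableSet.iUnion fun A =>
          MeasurableSet.iUnion fun _ => hGTmeas T A).nullMeasurableSet
    rwa [h2] at h1
  obtain ⟨T, hT⟩ := (hUlim.eventually_const_lt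
    (show ENNReal.ofReal (1 - δ) < 1 by rw [ENNReal.ofReal_lt_one]; linarith)).exists
  refine ⟨GT T, fun A _ => hGTmeas T A, hT.le, fun A _ => ⟨fun ω hω => ⟨T, hω⟩, ?_⟩⟩
  obtain ⟨K, -, hK⟩ := exists_setIntegral_le (μ := μ) (P := P) (lab := lab) (C₀ := C₀) hlab hM
    hM0.le hMC (fun t => rfl : ∀ t, η t = c / (t + t₀)) hc0 hct hp1 hB
    (fun a => clusters X (extendLabel a) = A.parts) (v := clusteringCost A)
    (fun a ha => by
      rw [← labelVal_eq_clusteringCost ha]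
      simp only [extendLabel_apply]
      rfl) T
  have hset : {ω | ∀ u ≥ T, clusters X (extendLabel (lab (Z ω u))) = A.parts} = GT T A := by
    have : ∀ ω u, clusters X (extendLabel (lab (Z ω u))) = clusters X (tie (Z ω u)) :=
      fun ω u => clusters_congr fun x hx y hy => by
        rw [extendLabel_apply (lab (Z ω u)) ⟨x, hx⟩, extendLabel_apply (lab (Z ω u)) ⟨y, hy⟩]
    ext ω
    simp only [hGT, Set.mem_ofPred_eq, this]
  have hcost : ∀ ω t, labelCost P (lab (Z ω t)) (Z ω t) = centroidCost X (Z ω t) := fun ω t =>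
    labelCost_eq_centroidCost (htie (Z ω t))
  refine exists_abs_integral_cond_le (hGTmeas T A) (fun t => ?_) (K := K) (T := T) ht₀
    (fun t ht' ω hω => ?_) fun t ht' => ?_
  · refine integrable_of_dependsOn hB.1 (t := t)
      (f := fun w => centroidCost X (labelIter P lab η C₀ w t) - clusteringCost A)
      fun w w' hw => ?_
    have := dependsOn_labelIter P lab η C₀ t hw
    simp only at this
    simp only [this]
  · rw [← hcost, ← labelVal_eq_clusteringCost (hω t ht'), sub_nonneg]
    exact labelVal_le_labelCost
  · rw [← hset]
    refine (le_of_eq ?_).trans (hK t ht')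
    exact integral_congr_ae (Filter.Eventually.of_forall fun ω =>
      congrArg (fun y => y - clusteringCost A) (hcost ω t).symm)
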